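/- **Setting.** Let $T>0$ and let $n,m,k$ be dimensions. Let $A_1,A_2,A_4:[0,T]\to\mathbb R^{n\times n}$, $B_1,B_2,C_1,C_2:[0,T]\to\mathbb R^{n\times m}$, $D_1,D_2:[0,T]\to\mathbb R^{n\times k}$, $A_3:[0,T]\to\mathbb R^{m\times n}$, $B_3,B_4,C_3,C_4:[0,T]\to\mathbb R^{m\times m}$, $D_3:[0,T]\to\mathbb R^{m\times k}$, $D_4:[0,T]\to\mathbb R^{k\times k}$ be measurable and essentially bounded, with $A_4,B_4,C_4,D_4$ symmetric, and let $F\in\mathbb R^{m\times n}$ and $G\in\mathbb R^{n\times n}$, $H\in\mathbb R^{m\times m}$ symmetric. Assume $A_4\ge 0$, $B_4\ge 0$, $H\ge 0$ and $G>0$. (Relations between coefficient functions hold for a.e. $t\in[0,T]$; $X\ge Y$ is the Loewner order; differential equations are understood in integrated form.) **Auxiliary Riccati equations.** Put $$\tilde A=\begin{pmatrix}A_1&B_1\\-A_3&-B_3\end{pmatrix},\ \tilde B=\begin{pmatrix}D_1&C_1\\-D_3&-C_3\end{pmatrix},\ \tilde C=\begin{pmatrix}A_2&B_2\\0&0\end{pmatrix},\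 \tilde D=\begin{pmatrix}D_2&C_2\\0&I_m\end{pmatrix},\ \tilde Q=\begin{pmatrix}A_4&0\\0&B_4\end{pmatrix},\ \tilde R=\begin{pmatrix}D_4&0\\0&C_4\end{pmatrix}.$$ Assume that there is an integer $i_0\ge1$ such that, for each $i\ge i_0$, there is a continuous ${}_i\tilde P:[0,T]\to\mathbb R^{(n+m)\times(n+m)}$, symmetric positive definite at every $t\in[0,T]$, with $$\dot{\tilde P}+\tilde P\tilde A+\tilde A^\top\tilde P+\tilde C^\top\tilde P\tilde C+\tilde Q-(\tilde B^\top\tilde P+\tilde D^\top\tilde P\tilde C)^\top(\tilde R+\tilde D^\top\tilde P\tilde D)^{-1}(\tilde B^\top\tilde P+\tilde D^\top\tilde P\tilde C)=0,\qquad \tilde R+\tilde D^\top\tilde P\tilde D>0,$$ for $\tilde P={}_i\tilde P$, and terminal value ${}_i\tilde P(T)=\begin{pmatrix}G+iF^\top F&-iF^\top\\-iF&iI_m\end{pmatrix}$. Write ${}_i\tilde P=\begin{pmatrix}\tilde P_{1,i}&\tilde P_{2,i}^\top\\\tilde P_{2,i}&\tilde P_{3,i}\end{pmatrix}$ and define $$P_{1,i}=\tilde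 P_{1,i}-\tilde P_{2,i}^\top\tilde P_{3,i}^{-1}\tilde P_{2,i},\qquad P_{2,i}=-\tilde P_{3,i}^{-1}\tilde P_{2,i},\qquad P_{3,i}=\tilde P_{3,i}^{-1}.$$ **Non-Riccati system.** For a triple $(P_1,P_2,P_3)$ with values in $\mathbb R^{n\times n}\times\mathbb R^{m\times n}\times\mathbb R^{m\times m}$ put $$\begin{aligned} L_1&=I_m-P_2C_2+P_3C_4,\\ L_2&=I_n-P_2^\top C_2^\top+(P_1C_2+P_2^\top C_4)L_1^{-1}P_3C_2^\top,\\ L_3&=P_1A_2+P_1B_2P_2+P_2^\top C_1^\top P_1+(P_2^\top C_4+P_1C_2)L_1^{-1}(P_2A_2+P_2B_2P_2-P_3C_1^\top P_1),\\ L_4&=P_2^\top C_3^\top+P_2^\top C_1^\top P_2^\top-P_1B_2P_3-(P_2^\top C_4+P_1C_2)L_1^{-1}(P_2B_2P_3+P_3C_3^\top+P_3C_1^\top P_2^\top),\\ S_1&=P_1+(P_2^\top C_4+P_1C_2)L_1^{-1}P_2,\qquad L_5=D_4+D_2^\top L_2^{-1}S_1D_2,\\ L_6&=-L_5^{-1}(D_1^\top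 P_1+D_2^\top L_2^{-1}L_3),\qquad L_7=-L_5^{-1}(D_1^\top P_2^\top+D_2^\top L_2^{-1}L_4+D_3^\top),\\ L_8&=L_2^{-1}(L_3+S_1D_2L_6),\qquad L_9=L_2^{-1}(L_4+S_1D_2L_7),\\ L_{10}&=L_1^{-1}(P_2A_2+P_2B_2P_2-P_3C_1^\top P_1-P_3C_2^\top L_8+P_2D_2L_6),\\ L_{11}&=L_1^{-1}(P_2D_2L_7-P_3C_2^\top L_9-P_2B_2P_3-P_3C_3^\top-P_3C_1^\top P_2^\top), \end{aligned}$$ and consider the system $$\begin{aligned} \dot P_1&=-\{P_1A_1+P_1B_1P_2+P_1C_1L_{10}+P_1D_1L_6+P_2^\top B_1^\top P_1+P_2^\top B_2^\top L_8+P_2^\top B_4P_2+A_4+A_1^\top P_1+A_2^\top L_8\},\\ \dot P_2&=-\{P_2A_1+P_2B_1P_2+P_2C_1L_{10}+P_2D_1L_6-P_3B_1^\top P_1-P_3B_2^\top L_8-P_3B_4P_2+A_3+B_3P_2+C_3L_{10}+D_3L_6\},\\ \dot P_3&=-\{P_2B_1P_3-P_2C_1L_{11}-P_2D_1L_7+P_3B_3^\top+P_3B_1^\top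 P_2^\top+P_3B_2^\top L_9-P_3B_4P_3+B_3P_3-C_3L_{11}-D_3L_7\}, \end{aligned}\tag{$*$}$$ with $P_1(T)=G$, $P_2(T)=F$, $P_3(T)=0$. A solution of $(*)$ is a triple of continuous functions on $[0,T]$ for which $L_1,L_2,L_5$ are invertible for a.e. $t$, the right-hand sides are integrable, and the equations hold in integrated form. Let $L_{1,i},L_{2,i},L_{5,i}$ denote $L_1,L_2,L_5$ evaluated at $(P_{1,i},P_{2,i},P_{3,i})$. **Theorem.** Assume in addition that, for every $i\ge i_0$, $L_{1,i}(t)$ and $L_{2,i}(t)$ are invertible for a.e. $t$ and $(\tilde R+\tilde D^\top{}_i\tilde P\tilde D)^{-1}$ is essentially bounded on $[0,T]$ (with a bound that may depend on $i$). 1. For all $i\ge i_0$ and $t\in[0,T]$: $P_{3,i}(t)\ge P_{3,i+1}(t)\ge0$ and $P_{1,i+1}(t)\ge P_{1,i}(t)\ge0$. 2. Suppose moreover that there is a constant $c$ such that, for all $i\ge i_0$, $P_{1,i}(t)\le cI_n$ and $|P_{2,i}(t)|\le c$ for all $t\in[0,T]$, and, for a.e. $t\in[0,T]$, $L_{5,i}(t)$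 is invertible and $|L_{1,i}(t)^{-1}|,|L_{2,i}(t)^{-1}|,|L_{5,i}(t)^{-1}|\le c$. Then $(*)$ has a unique solution $(P_1,P_2,P_3)$ on $[0,T]$, and $(P_{1,i},P_{2,i},P_{3,i})\to(P_1,P_2,P_3)$ uniformly on $[0,T]$ as $i\to\infty$. -/

import Mathlib

open MeasureTheory Filter Matrix

noncomputable section

/-- The data of the linear-quadratic problem: deterministic matrix-valued functions of time
and the constant terminal / initial matrices `F`, `G`, `H`. -/
structure FBLQData (n m k : ℕ) where
  A1 : ℝ → Matrix (Fin n) (Fin n) ℝ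
  A2 : ℝ → Matrix (Fin n) (Fin n) ℝ
  A3 : ℝ → Matrix (Fin m) (Fin n) ℝ
  A4 : ℝ → Matrix (Fin n) (Fin n) ℝ
  B1 : ℝ → Matrix (Fin n) (Fin m) ℝ
  B2 : ℝ → Matrix (Fin n) (Fin m) ℝ
  B3 : ℝ → Matrix (Fin m) (Fin m) ℝ
  B4 : ℝ → Matrix (Fin m) (Fin m) ℝ
  C1 : ℝ → Matrix (Fin n) (Fin m) ℝ
  C2 : ℝ → Matrix (Fin n) (Fin m) ℝ
  C3 : ℝ → Matrix (Fin m) (Fin m) ℝ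
  C4 : ℝ → Matrix (Fin m) (Fin m) ℝ
  D1 : ℝ → Matrix (Fin n) (Fin k) ℝ
  D2 : ℝ → Matrix (Fin n) (Fin k) ℝ
  D3 : ℝ → Matrix (Fin m) (Fin k) ℝ
  D4 : ℝ → Matrix (Fin k) (Fin k) ℝ
  F : Matrix (Fin m) (Fin n) ℝ
  G : Matrix (Fin n) (Fin n) ℝ
  H : Matrix (Fin m) (Fin m) ℝ

/-- Membership in `L^∞(0, T)` of a matrix-valued function, entry by entry. -/
def MemLinfty {α β : Type*} (T : ℝ) (M : ℝ → Matrix α β ℝ) : Prop :=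
  ∀ a b, MemLp (fun t => M t a b) ⊤ (volume.restrict (Set.Icc 0 T))

/-- `t ↦ P t` is a solution on `[0, T]` (in integrated, Carathéodory form) of
`dP(t) = - f(t) dt`, `P(T) = Θ`, that is
`P(t) = Θ + ∫_t^T f(s) ds` with `f` integrable; matrices are integrated entry by entry. -/
def IsBackwardSolution {α β : Type*} (T : ℝ) (Θ : Matrix α β ℝ) (f P : ℝ → Matrix α β ℝ) :
    Prop :=
  ContinuousOn P (Set.Icc 0 T) ∧
  (∀ a b, IntervalIntegrable (fun s => f s a b) volume 0 T) ∧
  ∀ t ∈ Set.Icc 0 T, ∀ a b, P t a b = Θ a b + ∫ s in t..T, f s a b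

namespace FBLQData

variable {n m k : ℕ} (S : FBLQData n m k)

/-- The coefficients are essentially bounded, and the weights are symmetric. -/
structure Bounded (T : ℝ) : Prop where
  A1 : MemLinfty T S.A1
  A2 : MemLinfty T S.A2
  A3 : MemLinfty T S.A3
  A4 : MemLinfty T S.A4
  B1 : MemLinfty T S.B1
  B2 : MemLinfty T S.B2
  B3 : MemLinfty T S.B3
  B4 : MemLinfty T S.B4
  C1 : MemLinfty T S.C1
  C2 : MemLinfty T S.C2
  C3 : MemLinfty T S.C3
  C4 : MemLinfty T S.C4
  D1 : MemLinfty T S.D1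
  D2 : MemLinfty T S.D2
  D3 : MemLinfty T S.D3
  D4 : MemLinfty T S.D4
  symm_A4 : ∀ᵐ t ∂(volume.restrict (Set.Icc 0 T)), (S.A4 t).IsSymm
  symm_B4 : ∀ᵐ t ∂(volume.restrict (Set.Icc 0 T)), (S.B4 t).IsSymm
  symm_C4 : ∀ᵐ t ∂(volume.restrict (Set.Icc 0 T)), (S.C4 t).IsSymm
  symm_D4 : ∀ᵐ t ∂(volume.restrict (Set.Icc 0 T)), (S.D4 t).IsSymm
  symm_G : S.G.IsSymm
  symm_H : S.H.IsSymm

/-- `A₄`, `B₄` and `H` are nonnegative definite and `G` is positive definite. -/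
structure Nonneg (T : ℝ) : Prop where
  A4 : ∀ᵐ t ∂(volume.restrict (Set.Icc 0 T)), (S.A4 t).PosSemidef
  B4 : ∀ᵐ t ∂(volume.restrict (Set.Icc 0 T)), (S.B4 t).PosSemidef
  G : S.G.PosDef
  H : S.H.PosSemidef

/-! The auxiliary Riccati equation. -/

def At (t : ℝ) : Matrix (Fin n ⊕ Fin m) (Fin n ⊕ Fin m) ℝ :=
  fromBlocks (S.A1 t) (S.B1 t) (-S.A3 t) (-S.B3 t)

def Bt (t : ℝ) : Matrix (Fin n ⊕ Fin m) (Fin k ⊕ Fin m) ℝ :=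
  fromBlocks (S.D1 t) (S.C1 t) (-S.D3 t) (-S.C3 t)

def Ct (t : ℝ) : Matrix (Fin n ⊕ Fin m) (Fin n ⊕ Fin m) ℝ :=
  fromBlocks (S.A2 t) (S.B2 t) 0 0

def Dt (t : ℝ) : Matrix (Fin n ⊕ Fin m) (Fin k ⊕ Fin m) ℝ :=
  fromBlocks (S.D2 t) (S.C2 t) 0 1

def Qt (t : ℝ) : Matrix (Fin n ⊕ Fin m) (Fin n ⊕ Fin m) ℝ :=
  fromBlocks (S.A4 t) 0 0 (S.B4 t)

def Rt (t : ℝ) : Matrix (Fin k ⊕ Fin m) (Fin k ⊕ Fin m) ℝ :=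
  fromBlocks (S.D4 t) 0 0 (S.C4 t)

/-- `M₁ = R̃ + D̃ᵀ P̃ D̃`. -/
def M1 (Pt : Matrix (Fin n ⊕ Fin m) (Fin n ⊕ Fin m) ℝ) (t : ℝ) :
    Matrix (Fin k ⊕ Fin m) (Fin k ⊕ Fin m) ℝ :=
  S.Rt t + (S.Dt t)ᵀ * Pt * S.Dt t

/-- `M₂ = B̃ᵀ P̃ + D̃ᵀ P̃ C̃`. -/
def M2 (Pt : Matrix (Fin n ⊕ Fin m) (Fin n ⊕ Fin m) ℝ) (t : ℝ) :
    Matrix (Fin k ⊕ Fin m) (Fin n ⊕ Fin m) ℝ :=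
  (S.Bt t)ᵀ * Pt + (S.Dt t)ᵀ * Pt * S.Ct t

/-- The Riccati equation reads `dP̃/dt + riccatiDrift = 0`. -/
def riccatiDrift (Pt : Matrix (Fin n ⊕ Fin m) (Fin n ⊕ Fin m) ℝ) (t : ℝ) :
    Matrix (Fin n ⊕ Fin m) (Fin n ⊕ Fin m) ℝ :=
  Pt * S.At t + (S.At t)ᵀ * Pt + (S.Ct t)ᵀ * Pt * S.Ct t + S.Qt t
    - (S.M2 Pt t)ᵀ * (S.M1 Pt t)⁻¹ * S.M2 Pt t

/-- The terminal value of the `i`-th auxiliary Riccati equation. -/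
def riccatiTerminal (i : ℕ) : Matrix (Fin n ⊕ Fin m) (Fin n ⊕ Fin m) ℝ :=
  fromBlocks (S.G + (i : ℝ) • (S.Fᵀ * S.F)) (-((i : ℝ) • S.Fᵀ))
    (-((i : ℝ) • S.F)) ((i : ℝ) • (1 : Matrix (Fin m) (Fin m) ℝ))

/-- `Pt` is a positive definite solution on `[0, T]` of the Riccati equation (including its
constraint `R̃ + D̃ᵀ P̃ D̃ > 0`) with the `i`-th terminal value. -/
structure IsRiccatiSolution (T : ℝ) (i : ℕ)
    (Pt : ℝ → Matrix (Fin n ⊕ Fin m) (Fin n ⊕ Fin m) ℝ) : Prop where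
  posDef : ∀ t ∈ Set.Icc 0 T, (Pt t).PosDef
  constraint : ∀ᵐ t ∂(volume.restrict (Set.Icc 0 T)), (S.M1 (Pt t) t).PosDef
  equation : IsBackwardSolution T (S.riccatiTerminal i) (fun t => S.riccatiDrift (Pt t) t) Pt

/-! The matrices `L₁, …, L₁₁`, `S₁` and the non-Riccati-type system. They are functions of the
values `P1, P2, P3` of the unknowns and of time `t`. -/

section NonRiccati

variable (P1 : Matrix (Fin n) (Fin n) ℝ) (P2 : Matrix (Fin m) (Fin n) ℝ)
  (P3 : Matrix (Fin m) (Fin m) ℝ) (t : ℝ)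

def L1 : Matrix (Fin m) (Fin m) ℝ :=
  1 - P2 * S.C2 t + P3 * S.C4 t

def L2 : Matrix (Fin n) (Fin n) ℝ :=
  1 - P2ᵀ * (S.C2 t)ᵀ
    + (P1 * S.C2 t + P2ᵀ * S.C4 t) * (S.L1 P2 P3 t)⁻¹ * P3 * (S.C2 t)ᵀ

def L3 : Matrix (Fin n) (Fin n) ℝ :=
  P1 * S.A2 t + P1 * S.B2 t * P2 + P2ᵀ * (S.C1 t)ᵀ * P1
    + (P2ᵀ * S.C4 t + P1 * S.C2 t) * (S.L1 P2 P3 t)⁻¹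
      * (P2 * S.A2 t + P2 * S.B2 t * P2 - P3 * (S.C1 t)ᵀ * P1)

def L4 : Matrix (Fin n) (Fin m) ℝ :=
  P2ᵀ * (S.C3 t)ᵀ + P2ᵀ * (S.C1 t)ᵀ * P2ᵀ - P1 * S.B2 t * P3
    - (P2ᵀ * S.C4 t + P1 * S.C2 t) * (S.L1 P2 P3 t)⁻¹
      * (P2 * S.B2 t * P3 + P3 * (S.C3 t)ᵀ + P3 * (S.C1 t)ᵀ * P2ᵀ)

def S1 : Matrix (Fin n) (Fin n) ℝ :=
  P1 + (P2ᵀ * S.C4 t + P1 * S.C2 t) * (S.L1 P2 P3 t)⁻¹ * P2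

def L5 : Matrix (Fin k) (Fin k) ℝ :=
  S.D4 t + (S.D2 t)ᵀ * (S.L2 P1 P2 P3 t)⁻¹ * S.S1 P1 P2 P3 t * S.D2 t

def L6 : Matrix (Fin k) (Fin n) ℝ :=
  -((S.L5 P1 P2 P3 t)⁻¹
    * ((S.D1 t)ᵀ * P1 + (S.D2 t)ᵀ * (S.L2 P1 P2 P3 t)⁻¹ * S.L3 P1 P2 P3 t))

def L7 : Matrix (Fin k) (Fin m) ℝ :=
  -((S.L5 P1 P2 P3 t)⁻¹
    * ((S.D1 t)ᵀ * P2ᵀ + (S.D2 t)ᵀ * (S.L2 P1 P2 P3 t)⁻¹ * S.L4 P1 P2 P3 t + (S.D3 t)ᵀ))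

def L8 : Matrix (Fin n) (Fin n) ℝ :=
  (S.L2 P1 P2 P3 t)⁻¹ * (S.L3 P1 P2 P3 t + S.S1 P1 P2 P3 t * S.D2 t * S.L6 P1 P2 P3 t)

def L9 : Matrix (Fin n) (Fin m) ℝ :=
  (S.L2 P1 P2 P3 t)⁻¹ * (S.L4 P1 P2 P3 t + S.S1 P1 P2 P3 t * S.D2 t * S.L7 P1 P2 P3 t)

def L10 : Matrix (Fin m) (Fin n) ℝ :=
  (S.L1 P2 P3 t)⁻¹
    * (P2 * S.A2 t + P2 * S.B2 t * P2 - P3 * (S.C1 t)ᵀ * P1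
      - P3 * (S.C2 t)ᵀ * S.L8 P1 P2 P3 t + P2 * S.D2 t * S.L6 P1 P2 P3 t)

def L11 : Matrix (Fin m) (Fin m) ℝ :=
  (S.L1 P2 P3 t)⁻¹
    * (P2 * S.D2 t * S.L7 P1 P2 P3 t - P3 * (S.C2 t)ᵀ * S.L9 P1 P2 P3 t
      - P2 * S.B2 t * P3 - P3 * (S.C3 t)ᵀ - P3 * (S.C1 t)ᵀ * P2ᵀ)

/-- `dP₁ = - drift1 dt`. -/
def drift1 : Matrix (Fin n) (Fin n) ℝ :=
  P1 * S.A1 t + P1 * S.B1 t * P2 + P1 * S.C1 t * S.L10 P1 P2 P3 t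
    + P1 * S.D1 t * S.L6 P1 P2 P3 t + P2ᵀ * (S.B1 t)ᵀ * P1
    + P2ᵀ * (S.B2 t)ᵀ * S.L8 P1 P2 P3 t + P2ᵀ * S.B4 t * P2 + S.A4 t
    + (S.A1 t)ᵀ * P1 + (S.A2 t)ᵀ * S.L8 P1 P2 P3 t

/-- `dP₂ = - drift2 dt`. -/
def drift2 : Matrix (Fin m) (Fin n) ℝ :=
  P2 * S.A1 t + P2 * S.B1 t * P2 + P2 * S.C1 t * S.L10 P1 P2 P3 t
    + P2 * S.D1 t * S.L6 P1 P2 P3 t - P3 * (S.B1 t)ᵀ * P1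
    - P3 * (S.B2 t)ᵀ * S.L8 P1 P2 P3 t - P3 * S.B4 t * P2 + S.A3 t
    + S.B3 t * P2 + S.C3 t * S.L10 P1 P2 P3 t + S.D3 t * S.L6 P1 P2 P3 t

/-- `dP₃ = - drift3 dt`. -/
def drift3 : Matrix (Fin m) (Fin m) ℝ :=
  P2 * S.B1 t * P3 - P2 * S.C1 t * S.L11 P1 P2 P3 t
    - P2 * S.D1 t * S.L7 P1 P2 P3 t + P3 * (S.B3 t)ᵀ
    + P3 * (S.B1 t)ᵀ * P2ᵀ + P3 * (S.B2 t)ᵀ * S.L9 P1 P2 P3 t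
    - P3 * S.B4 t * P3 + S.B3 t * P3 - S.C3 t * S.L11 P1 P2 P3 t
    - S.D3 t * S.L7 P1 P2 P3 t

end NonRiccati

/-- `(P1, P2, P3)` is a solution on `[0, T]` of the non-Riccati-type system with terminal values
`P1(T) = G`, `P2(T) = F`, `P3(T) = 0`. The inverses that occur in the equations are required to
exist for almost every time. -/
structure IsSystemSolution (T : ℝ) (P1 : ℝ → Matrix (Fin n) (Fin n) ℝ)
    (P2 : ℝ → Matrix (Fin m) (Fin n) ℝ) (P3 : ℝ → Matrix (Fin m) (Fin m) ℝ) : Prop where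
  invertible : ∀ᵐ t ∂(volume.restrict (Set.Icc 0 T)),
    IsUnit (S.L1 (P2 t) (P3 t) t) ∧ IsUnit (S.L2 (P1 t) (P2 t) (P3 t) t) ∧
      IsUnit (S.L5 (P1 t) (P2 t) (P3 t) t)
  equation1 : IsBackwardSolution T S.G (fun t => S.drift1 (P1 t) (P2 t) (P3 t) t) P1
  equation2 : IsBackwardSolution T S.F (fun t => S.drift2 (P1 t) (P2 t) (P3 t) t) P2
  equation3 : IsBackwardSolution T 0 (fun t => S.drift3 (P1 t) (P2 t) (P3 t) t) P3

end FBLQData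

/-! The transformation `P̃ ↦ (P₁, P₂, P₃)`, where
`P̃ = (P̃₁, P̃₂ᵀ; P̃₂, P̃₃)` is symmetric. -/

def blockP1 {n m : ℕ} (Pt : Matrix (Fin n ⊕ Fin m) (Fin n ⊕ Fin m) ℝ) :
    Matrix (Fin n) (Fin n) ℝ :=
  Pt.toBlocks₁₁ - Pt.toBlocks₂₁ᵀ * Pt.toBlocks₂₂⁻¹ * Pt.toBlocks₂₁

def blockP2 {n m : ℕ} (Pt : Matrix (Fin n ⊕ Fin m) (Fin n ⊕ Fin m) ℝ) :
    Matrix (Fin m) (Fin n) ℝ :=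
  -(Pt.toBlocks₂₂⁻¹ * Pt.toBlocks₂₁)

def blockP3 {n m : ℕ} (Pt : Matrix (Fin n ⊕ Fin m) (Fin n ⊕ Fin m) ℝ) :
    Matrix (Fin m) (Fin m) ℝ :=
  Pt.toBlocks₂₂⁻¹

namespace FBLQData

variable {n m k : ℕ} (S : FBLQData n m k)

/-- `L₁`, `L₂`, `L₅` evaluated at the triple that comes from `P̃`. -/
def L1of (Pt : Matrix (Fin n ⊕ Fin m) (Fin n ⊕ Fin m) ℝ) (t : ℝ) : Matrix (Fin m) (Fin m) ℝ :=
  S.L1 (blockP2 Pt) (blockP3 Pt) t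

def L2of (Pt : Matrix (Fin n ⊕ Fin m) (Fin n ⊕ Fin m) ℝ) (t : ℝ) : Matrix (Fin n) (Fin n) ℝ :=
  S.L2 (blockP1 Pt) (blockP2 Pt) (blockP3 Pt) t

def L5of (Pt : Matrix (Fin n ⊕ Fin m) (Fin n ⊕ Fin m) ℝ) (t : ℝ) : Matrix (Fin k) (Fin k) ℝ :=
  S.L5 (blockP1 Pt) (blockP2 Pt) (blockP3 Pt) t

end FBLQData

end

/-!
The proof passes through the auxiliary Riccati equations in both parts.

*Monotonicity.* Completing the square (`FBLQData.closedLoop_eq_riccatiDrift_add`) shows that the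
Riccati drift is the minimum of the closed-loop drifts over all feedbacks. With the feedback of the
solution of index `i + 1`, the difference of two consecutive solutions satisfies a backward linear
Lyapunov inequality with bounded coefficients and positive semidefinite terminal value, hence is
positive semidefinite (`posSemidef_of_lyapunov`, proved by adding a small, fast growing multiple of
the identity and looking at the last time at which positivity fails). Inversion is antitone and the
Schur complement is monotone on positive definite matrices, which gives the two monotonicity
statements (`posSemidef_blockP3_sub`, `posSemidef_blockP1_sub`).

*The system.* The triple `(P₁, P₂, P₃)` expresses the linear map `P̃ : (x, y) ↦ (p, q)` in the
variables `(x, q)`: `y = P₂ x + P₃ q` and `p = P₁ x - P₂ᵀ q`. With `J : (x, q) ↦ (x, y)`, the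
derivative of the triple is, up to signs, the congruence of `dP̃/dt` by `J` (`HasDrift.block`), and
eliminating the feedback from the stationarity condition of the Riccati equation produces exactly
`L₁, …, L₁₁` (`FBLQData.elimination`, `FBLQData.stateMap_congr_riccatiDrift`). Hence the triples
solve the non-Riccati-type system with terminal values `G`, `F`, `i⁻¹ I`.

*Convergence and uniqueness.* The right-hand sides are rational in the unknowns, so they are
Lipschitz, uniformly in time, on states that are bounded together with the inverses of `L₁`, `L₂`,
`L₅` (`FBLQData.exists_driftGap_le`), and a uniform neighbourhood of such a state is again of this
kind (`FBLQData.exists_admissible_of_gap_le`). Gronwall's inequality then makes the triples a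
uniform Cauchy sequence with rate `i⁻¹`, and the limit solves the system
(`FBLQData.exists_limit_of_admissible`). An arbitrary solution, whose inverses are not assumed to
be bounded, cannot leave the neighbourhood of the limit, again by Gronwall's inequality
(`FBLQData.IsStateSolution.eq_of_admissible`).
-/

noncomputable section

/-! ### The entrywise norm of a matrix -/

/-- The sum of the absolute values of the entries of a real matrix. It is submultiplicative and
invariant under transposition for rectangular matrices, and needs no choice of a norm instance. -/
def Matrix.l1 {α β : Type*} [Fintype α] [Fintype β] (M : Matrix α β ℝ) : ℝ :=
  ∑ a, ∑ b, |M a b|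

section L1

variable {α β γ : Type*} [Fintype α] [Fintype β] [Fintype γ]

lemma Matrix.l1_nonneg (M : Matrix α β ℝ) : 0 ≤ M.l1 :=
  Finset.sum_nonneg fun _ _ => Finset.sum_nonneg fun _ _ => abs_nonneg _

lemma Matrix.abs_apply_le_l1 (M : Matrix α β ℝ) (a : α) (b : β) : |M a b| ≤ M.l1 :=
  (Finset.single_le_sum (f := fun b => |M a b|) (fun _ _ => abs_nonneg _)
    (Finset.mem_univ b)).trans
    (Finset.single_le_sum (f := fun a => ∑ b, |M a b|)
      (fun _ _ => Finset.sum_nonneg fun _ _ => abs_nonneg _) (Finset.mem_univ a))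

lemma Matrix.l1_le_of_abs_apply_le {M : Matrix α β ℝ} {c : ℝ} (h : ∀ a b, |M a b| ≤ c) :
    M.l1 ≤ Fintype.card α * (Fintype.card β * c) := by
  calc M.l1 ≤ ∑ _a : α, ∑ _b : β, c :=
        Finset.sum_le_sum fun a _ => Finset.sum_le_sum fun b _ => h a b
    _ = _ := by simp

lemma Matrix.l1_zero : (0 : Matrix α β ℝ).l1 = 0 := by simp [Matrix.l1]

lemma Matrix.l1_neg (M : Matrix α β ℝ) : (-M).l1 = M.l1 := by simp [Matrix.l1]

lemma Matrix.l1_sub_comm (M N : Matrix α β ℝ) : (M - N).l1 = (N - M).l1 := by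
  rw [← Matrix.l1_neg, neg_sub]

lemma Matrix.l1_transpose (M : Matrix α β ℝ) : Mᵀ.l1 = M.l1 := by
  simp only [Matrix.l1, Matrix.transpose_apply]
  exact Finset.sum_comm

lemma Matrix.l1_add_le (M N : Matrix α β ℝ) : (M + N).l1 ≤ M.l1 + N.l1 := by
  simp only [Matrix.l1, ← Finset.sum_add_distrib]
  exact Finset.sum_le_sum fun a _ => Finset.sum_le_sum fun b _ => abs_add_le _ _

lemma Matrix.l1_sub_le (M N : Matrix α β ℝ) : (M - N).l1 ≤ M.l1 + N.l1 := by
  rw [sub_eq_add_neg, ← Matrix.l1_neg N]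
  exact Matrix.l1_add_le _ _

lemma Matrix.l1_mul_le (M : Matrix α β ℝ) (N : Matrix β γ ℝ) : (M * N).l1 ≤ M.l1 * N.l1 := by
  have h1 : ∀ a c, |(M * N) a c| ≤ ∑ b, |M a b| * |N b c| := fun a c => by
    rw [Matrix.mul_apply]
    refine (Finset.abs_sum_le_sum_abs _ _).trans (Finset.sum_le_sum fun b _ => ?_)
    rw [abs_mul]
  calc (M * N).l1 ≤ ∑ a, ∑ c, ∑ b, |M a b| * |N b c| :=
        Finset.sum_le_sum fun a _ => Finset.sum_le_sum fun c _ => h1 a c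
    _ = ∑ a, ∑ b, |M a b| * ∑ c, |N b c| := by
        refine Finset.sum_congr rfl fun a _ => ?_
        rw [Finset.sum_comm]
        simp only [Finset.mul_sum]
    _ ≤ ∑ a, ∑ b, |M a b| * N.l1 := by
        refine Finset.sum_le_sum fun a _ => Finset.sum_le_sum fun b _ => ?_
        refine mul_le_mul_of_nonneg_left ?_ (abs_nonneg _)
        exact Finset.single_le_sum (f := fun b => ∑ c, |N b c|)
          (fun _ _ => Finset.sum_nonneg fun _ _ => abs_nonneg _) (Finset.mem_univ b)
    _ = M.l1 * N.l1 := by simp only [Matrix.l1, Finset.sum_mul]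

lemma Matrix.l1_smul (r : ℝ) (M : Matrix α β ℝ) :
    (r • M).l1 = |r| * M.l1 := by
  simp [Matrix.l1, Finset.mul_sum, abs_mul]

lemma Matrix.eq_of_l1_sub_le_zero {M N : Matrix α β ℝ} (h : (M - N).l1 ≤ 0) : M = N := by
  ext a b
  have := (Matrix.abs_apply_le_l1 (M - N) a b).trans h
  exact sub_eq_zero.mp (abs_nonpos_iff.mp this)

lemma Matrix.l1_fromBlocks {δ : Type*} [Fintype δ]
    (A : Matrix α β ℝ) (B : Matrix α γ ℝ) (C : Matrix δ β ℝ) (D : Matrix δ γ ℝ) :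
    (fromBlocks A B C D).l1 = A.l1 + B.l1 + (C.l1 + D.l1) := by
  simp only [Matrix.l1, Fintype.sum_sum_type, fromBlocks_apply₁₁, fromBlocks_apply₁₂,
    fromBlocks_apply₂₁, fromBlocks_apply₂₂, Finset.sum_add_distrib]
  exact add_add_add_comm _ _ _ _

/-- A matrix close to an invertible one is invertible, with a quantitative bound. -/
lemma Matrix.isUnit_of_l1_sub_le [DecidableEq α] {X Y : Matrix α α ℝ} {c : ℝ}
    (hX : IsUnit X) (hc : X⁻¹.l1 ≤ c) (h : c * (X - Y).l1 ≤ 1 / 2) :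
    IsUnit Y ∧ Y⁻¹.l1 ≤ 2 * c := by
  have hXd := (Matrix.isUnit_iff_isUnit_det X).mp hX
  have key : ∀ {β : Type _} [Fintype β] (V : Matrix α β ℝ), V.l1 ≤ 2 * (c * (Y * V).l1) := by
    intro β _ V
    have e : V = X⁻¹ * ((X - Y) * V) + X⁻¹ * (Y * V) := by
      rw [← Matrix.mul_add, ← Matrix.add_mul, sub_add_cancel,
        Matrix.nonsing_inv_mul_cancel_left X V hXd]
    have h1 : (X⁻¹ * ((X - Y) * V)).l1 ≤ c * ((X - Y).l1 * V.l1) :=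
      (Matrix.l1_mul_le _ _).trans (mul_le_mul hc (Matrix.l1_mul_le _ _) (Matrix.l1_nonneg _)
        ((Matrix.l1_nonneg _).trans hc))
    have h2 : (X⁻¹ * (Y * V)).l1 ≤ c * (Y * V).l1 :=
      (Matrix.l1_mul_le _ _).trans (mul_le_mul_of_nonneg_right hc (Matrix.l1_nonneg _))
    have h3 : V.l1 ≤ c * ((X - Y).l1 * V.l1) + c * (Y * V).l1 := by
      conv_lhs => rw [e]
      exact (Matrix.l1_add_le _ _).trans (add_le_add h1 h2)
    have h4 : c * ((X - Y).l1 * V.l1) ≤ 1 / 2 * V.l1 := by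
      rw [← mul_assoc]
      exact mul_le_mul_of_nonneg_right h (Matrix.l1_nonneg _)
    linarith
  have hY : IsUnit Y := by
    rw [← Matrix.mulVec_injective_iff_isUnit]
    intro v w hvw
    have h0 : (replicateCol Unit (v - w)).l1 ≤ 0 := by
      have := key (replicateCol Unit (v - w))
      have e : Y * replicateCol Unit (v - w) = 0 := by
        rw [← Matrix.replicateCol_mulVec, Matrix.mulVec_sub, sub_eq_zero.mpr hvw]
        rfl
      rwa [e, Matrix.l1_zero, mul_zero, mul_zero] at this
    funext a
    have := (Matrix.abs_apply_le_l1 (replicateCol Unit (v - w)) a ()).trans h0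
    exact sub_eq_zero.mp (abs_nonpos_iff.mp this)
  have hYd := (Matrix.isUnit_iff_isUnit_det Y).mp hY
  refine ⟨hY, ?_⟩
  -- The bound on `Y⁻¹` follows from `Y⁻¹ = X⁻¹ + X⁻¹ (X - Y) Y⁻¹`.
  have e : Y⁻¹ = X⁻¹ + X⁻¹ * ((X - Y) * Y⁻¹) := by
    rw [Matrix.sub_mul, Matrix.mul_sub, Matrix.nonsing_inv_mul_cancel_left X _ hXd,
      Matrix.mul_nonsing_inv Y hYd, Matrix.mul_one, add_sub_cancel]
  have h1 : (X⁻¹ * ((X - Y) * Y⁻¹)).l1 ≤ c * ((X - Y).l1 * Y⁻¹.l1) :=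
    (Matrix.l1_mul_le _ _).trans (mul_le_mul hc (Matrix.l1_mul_le _ _) (Matrix.l1_nonneg _)
      ((Matrix.l1_nonneg _).trans hc))
  have h3 : Y⁻¹.l1 ≤ c + c * ((X - Y).l1 * Y⁻¹.l1) := by
    conv_lhs => rw [e]
    exact (Matrix.l1_add_le _ _).trans (add_le_add hc h1)
  have h4 : c * ((X - Y).l1 * Y⁻¹.l1) ≤ 1 / 2 * Y⁻¹.l1 := by
    rw [← mul_assoc]
    exact mul_le_mul_of_nonneg_right h (Matrix.l1_nonneg _)
  linarith

end L1

/-! ### Bounded pairs of matrix families with comparable differences -/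

/-- Two families of matrices, indexed by the same set, are uniformly bounded and their difference
is dominated by a multiple of the weight `r`. Since this is stable under the algebraic operations
and under inversion, it turns Lipschitz estimates of rational matrix expressions into a
term-by-term verification. -/
def LipPair {Ω α β : Type*} [Fintype α] [Fintype β] (r : Ω → ℝ) (f g : Ω → Matrix α β ℝ) : Prop :=
  ∃ K : ℝ, 0 ≤ K ∧ ∀ ω, (f ω).l1 ≤ K ∧ (g ω).l1 ≤ K ∧ (f ω - g ω).l1 ≤ K * r ω

namespace LipPair

variable {Ω α β γ : Type*} [Fintype α] [Fintype β] [Fintype γ] {r : Ω → ℝ}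

lemma of_bound {f : Ω → Matrix α β ℝ} (hr : ∀ ω, 0 ≤ r ω) {c : ℝ} (h : ∀ ω, (f ω).l1 ≤ c) :
    LipPair r f f := by
  refine ⟨max c 0, le_max_right _ _, fun ω => ⟨(h ω).trans (le_max_left _ _),
    (h ω).trans (le_max_left _ _), ?_⟩⟩
  rw [sub_self, Matrix.l1_zero]
  exact mul_nonneg (le_max_right _ _) (hr ω)

lemma const (hr : ∀ ω, 0 ≤ r ω) (M : Matrix α β ℝ) : LipPair r (fun _ => M) (fun _ => M) :=
  of_bound hr (c := M.l1) fun _ => le_rfl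

lemma add {f g f' g' : Ω → Matrix α β ℝ} (h : LipPair r f g) (h' : LipPair r f' g') :
    LipPair r (fun ω => f ω + f' ω) (fun ω => g ω + g' ω) := by
  obtain ⟨K, hK, H⟩ := h
  obtain ⟨K', hK', H'⟩ := h'
  refine ⟨K + K', by positivity, fun ω => ⟨?_, ?_, ?_⟩⟩
  · exact (Matrix.l1_add_le _ _).trans (add_le_add (H ω).1 (H' ω).1)
  · exact (Matrix.l1_add_le _ _).trans (add_le_add (H ω).2.1 (H' ω).2.1)
  · rw [add_sub_add_comm, add_mul]
    exact (Matrix.l1_add_le _ _).trans (add_le_add (H ω).2.2 (H' ω).2.2)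

lemma neg {f g : Ω → Matrix α β ℝ} (h : LipPair r f g) :
    LipPair r (fun ω => -f ω) (fun ω => -g ω) := by
  obtain ⟨K, hK, H⟩ := h
  refine ⟨K, hK, fun ω => ?_⟩
  rw [neg_sub_neg, Matrix.l1_neg, Matrix.l1_neg, Matrix.l1_sub_comm]
  exact H ω

lemma sub {f g f' g' : Ω → Matrix α β ℝ} (h : LipPair r f g) (h' : LipPair r f' g') :
    LipPair r (fun ω => f ω - f' ω) (fun ω => g ω - g' ω) := by
  simpa only [sub_eq_add_neg] using h.add h'.neg

lemma transpose {f g : Ω → Matrix α β ℝ} (h : LipPair r f g) :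
    LipPair r (fun ω => (f ω)ᵀ) (fun ω => (g ω)ᵀ) := by
  obtain ⟨K, hK, H⟩ := h
  refine ⟨K, hK, fun ω => ?_⟩
  rw [← Matrix.transpose_sub, Matrix.l1_transpose, Matrix.l1_transpose, Matrix.l1_transpose]
  exact H ω

lemma mul {f g : Ω → Matrix α β ℝ} {f' g' : Ω → Matrix β γ ℝ} (h : LipPair r f g)
    (h' : LipPair r f' g') :
    LipPair r (fun ω => f ω * f' ω) (fun ω => g ω * g' ω) := by
  obtain ⟨K, hK, H⟩ := h
  obtain ⟨K', hK', H'⟩ := h'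
  refine ⟨2 * (K * K') + K * K', by positivity, fun ω => ?_⟩
  obtain ⟨h1, h2, h3⟩ := H ω
  obtain ⟨h1', h2', h3'⟩ := H' ω
  have hp : 0 ≤ K * K' := mul_nonneg hK hK'
  have p1 := (Matrix.l1_mul_le (f ω) (f' ω)).trans (mul_le_mul h1 h1' (Matrix.l1_nonneg _) hK)
  have p2 := (Matrix.l1_mul_le (g ω) (g' ω)).trans (mul_le_mul h2 h2' (Matrix.l1_nonneg _) hK)
  refine ⟨by linarith, by linarith, ?_⟩
  have e : f ω * f' ω - g ω * g' ω = (f ω - g ω) * f' ω + g ω * (f' ω - g' ω) := by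
    rw [Matrix.sub_mul, Matrix.mul_sub]
    abel
  have hKr : 0 ≤ K * r ω := (Matrix.l1_nonneg _).trans h3
  have q1 := (Matrix.l1_mul_le (f ω - g ω) (f' ω)).trans
    (mul_le_mul h3 h1' (Matrix.l1_nonneg _) hKr)
  have q2 := (Matrix.l1_mul_le (g ω) (f' ω - g' ω)).trans
    (mul_le_mul h2 h3' (Matrix.l1_nonneg _) hK)
  have q3 := Matrix.l1_add_le ((f ω - g ω) * f' ω) (g ω * (f' ω - g' ω))
  rw [e]
  nlinarith [mul_nonneg hKr hK']

lemma inv [DecidableEq α] {f g : Ω → Matrix α α ℝ} {c : ℝ} (hr : ∀ ω, 0 ≤ r ω) (h : LipPair r f g)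
    (hf : ∀ ω, IsUnit (f ω) ∧ (f ω)⁻¹.l1 ≤ c) (hg : ∀ ω, IsUnit (g ω) ∧ (g ω)⁻¹.l1 ≤ c) :
    LipPair r (fun ω => (f ω)⁻¹) (fun ω => (g ω)⁻¹) := by
  obtain ⟨K, hK, H⟩ := h
  have hc : ∀ ω : Ω, 0 ≤ c := fun ω => (Matrix.l1_nonneg _).trans (hf ω).2
  refine ⟨|c| + |c| * K * |c|, by positivity, fun ω => ?_⟩
  have hc := hc ω
  have hcK : 0 ≤ c * K * c := by positivity
  obtain ⟨h1, h2, h3⟩ := H ω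
  obtain ⟨uf, bf⟩ := hf ω
  obtain ⟨ug, bg⟩ := hg ω
  rw [abs_of_nonneg hc]
  refine ⟨by linarith, by linarith, ?_⟩
  -- The resolvent identity.
  have e : (f ω)⁻¹ - (g ω)⁻¹ = -((f ω)⁻¹ * (f ω - g ω) * (g ω)⁻¹) := by
    rw [Matrix.mul_sub, Matrix.sub_mul,
      Matrix.nonsing_inv_mul _ ((Matrix.isUnit_iff_isUnit_det _).mp uf), Matrix.one_mul,
      Matrix.mul_assoc, Matrix.mul_nonsing_inv _ ((Matrix.isUnit_iff_isUnit_det _).mp ug),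
      Matrix.mul_one, neg_sub]
  have hKr : 0 ≤ K * r ω := (Matrix.l1_nonneg _).trans h3
  rw [e, Matrix.l1_neg]
  have q1 := (Matrix.l1_mul_le (f ω)⁻¹ (f ω - g ω)).trans (mul_le_mul bf h3 (Matrix.l1_nonneg _) hc)
  have q2 := (Matrix.l1_mul_le ((f ω)⁻¹ * (f ω - g ω)) (g ω)⁻¹).trans
    (mul_le_mul q1 bg (Matrix.l1_nonneg _) (by positivity))
  nlinarith [mul_nonneg hc (hr ω)]

end LipPair
/-! ### Lipschitz dependence of the drifts on admissible states -/

/-- A value of the triple of unknowns of the non-Riccati-type system. -/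
structure FBState (n m : ℕ) where
  P1 : Matrix (Fin n) (Fin n) ℝ
  P2 : Matrix (Fin m) (Fin n) ℝ
  P3 : Matrix (Fin m) (Fin m) ℝ

namespace FBState

variable {n m : ℕ}

/-- The distance of two triples, measured by the entrywise norm. -/
def gap (X Y : FBState n m) : ℝ :=
  (X.P1 - Y.P1).l1 + (X.P2 - Y.P2).l1 + (X.P3 - Y.P3).l1

lemma gap_nonneg (X Y : FBState n m) : 0 ≤ X.gap Y :=
  add_nonneg (add_nonneg (Matrix.l1_nonneg _) (Matrix.l1_nonneg _)) (Matrix.l1_nonneg _)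

lemma l1_P1_le_gap (X Y : FBState n m) : (X.P1 - Y.P1).l1 ≤ X.gap Y := by
  have h2 := Matrix.l1_nonneg (X.P2 - Y.P2)
  have h3 := Matrix.l1_nonneg (X.P3 - Y.P3)
  unfold gap
  linarith

lemma l1_P2_le_gap (X Y : FBState n m) : (X.P2 - Y.P2).l1 ≤ X.gap Y := by
  have h1 := Matrix.l1_nonneg (X.P1 - Y.P1)
  have h3 := Matrix.l1_nonneg (X.P3 - Y.P3)
  unfold gap
  linarith

lemma l1_P3_le_gap (X Y : FBState n m) : (X.P3 - Y.P3).l1 ≤ X.gap Y := by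
  have h1 := Matrix.l1_nonneg (X.P1 - Y.P1)
  have h2 := Matrix.l1_nonneg (X.P2 - Y.P2)
  unfold gap
  linarith

end FBState

namespace FBLQData

variable {n m k : ℕ} (S : FBLQData n m k)

/-- All coefficients at time `t` are bounded by `c`. -/
structure CoeffBound (c t : ℝ) : Prop where
  A1 : (S.A1 t).l1 ≤ c
  A2 : (S.A2 t).l1 ≤ c
  A3 : (S.A3 t).l1 ≤ c
  A4 : (S.A4 t).l1 ≤ c
  B1 : (S.B1 t).l1 ≤ c
  B2 : (S.B2 t).l1 ≤ c
  B3 : (S.B3 t).l1 ≤ c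
  B4 : (S.B4 t).l1 ≤ c
  C1 : (S.C1 t).l1 ≤ c
  C2 : (S.C2 t).l1 ≤ c
  C3 : (S.C3 t).l1 ≤ c
  C4 : (S.C4 t).l1 ≤ c
  D1 : (S.D1 t).l1 ≤ c
  D2 : (S.D2 t).l1 ≤ c
  D3 : (S.D3 t).l1 ≤ c
  D4 : (S.D4 t).l1 ≤ c

/-- The state `X` is bounded by `c` and the three matrices inverted in the system are invertible
at `(t, X)`, with inverses bounded by `c`. -/
structure Admissible (c t : ℝ) (X : FBState n m) : Prop where
  P1 : X.P1.l1 ≤ c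
  P2 : X.P2.l1 ≤ c
  P3 : X.P3.l1 ≤ c
  L1 : IsUnit (S.L1 X.P2 X.P3 t) ∧ (S.L1 X.P2 X.P3 t)⁻¹.l1 ≤ c
  L2 : IsUnit (S.L2 X.P1 X.P2 X.P3 t) ∧ (S.L2 X.P1 X.P2 X.P3 t)⁻¹.l1 ≤ c
  L5 : IsUnit (S.L5 X.P1 X.P2 X.P3 t) ∧ (S.L5 X.P1 X.P2 X.P3 t)⁻¹.l1 ≤ c

lemma CoeffBound.mono {S : FBLQData n m k} {c c' t : ℝ} (h : S.CoeffBound c t)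
    (hc : c ≤ c') : S.CoeffBound c' t := by
  obtain ⟨x1, x2, x3, x4, x5, x6, x7, x8, x9, x10, x11, x12, x13, x14, x15, x16⟩ := h
  constructor <;> linarith

lemma Admissible.mono {S : FBLQData n m k} {c c' t : ℝ} {X : FBState n m}
    (h : S.Admissible c t X) (hc : c ≤ c') :
    S.Admissible c' t X :=
  ⟨h.P1.trans hc, h.P2.trans hc, h.P3.trans hc, ⟨h.L1.1, h.L1.2.trans hc⟩,
    ⟨h.L2.1, h.L2.2.trans hc⟩, ⟨h.L5.1, h.L5.2.trans hc⟩⟩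

/-- The distance of the right-hand sides of the system at two states. -/
def driftGap (t : ℝ) (X Y : FBState n m) : ℝ :=
  (S.drift1 X.P1 X.P2 X.P3 t - S.drift1 Y.P1 Y.P2 Y.P3 t).l1 +
  (S.drift2 X.P1 X.P2 X.P3 t - S.drift2 Y.P1 Y.P2 Y.P3 t).l1 +
  (S.drift3 X.P1 X.P2 X.P3 t - S.drift3 Y.P1 Y.P2 Y.P3 t).l1

section Lip

variable {S} {Ω : Type*} {c : ℝ} {τ : Ω → ℝ} {X Y : Ω → FBState n m}

lemma lipPair_P1 (hX : ∀ ω, (X ω).P1.l1 ≤ c) (hY : ∀ ω, (Y ω).P1.l1 ≤ c) :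
    LipPair (fun ω => (X ω).gap (Y ω)) (fun ω => (X ω).P1) (fun ω => (Y ω).P1) := by
  refine ⟨max c 1, by positivity, fun ω => ⟨(hX ω).trans (le_max_left _ _),
    (hY ω).trans (le_max_left _ _), ((X ω).l1_P1_le_gap (Y ω)).trans ?_⟩⟩
  exact le_mul_of_one_le_left ((X ω).gap_nonneg (Y ω)) (le_max_right _ _)

lemma lipPair_P2 (hX : ∀ ω, (X ω).P2.l1 ≤ c) (hY : ∀ ω, (Y ω).P2.l1 ≤ c) :
    LipPair (fun ω => (X ω).gap (Y ω)) (fun ω => (X ω).P2) (fun ω => (Y ω).P2) := by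
  refine ⟨max c 1, by positivity, fun ω => ⟨(hX ω).trans (le_max_left _ _),
    (hY ω).trans (le_max_left _ _), ((X ω).l1_P2_le_gap (Y ω)).trans ?_⟩⟩
  exact le_mul_of_one_le_left ((X ω).gap_nonneg (Y ω)) (le_max_right _ _)

lemma lipPair_P3 (hX : ∀ ω, (X ω).P3.l1 ≤ c) (hY : ∀ ω, (Y ω).P3.l1 ≤ c) :
    LipPair (fun ω => (X ω).gap (Y ω)) (fun ω => (X ω).P3) (fun ω => (Y ω).P3) := by
  refine ⟨max c 1, by positivity, fun ω => ⟨(hX ω).trans (le_max_left _ _),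
    (hY ω).trans (le_max_left _ _), ((X ω).l1_P3_le_gap (Y ω)).trans ?_⟩⟩
  exact le_mul_of_one_le_left ((X ω).gap_nonneg (Y ω)) (le_max_right _ _)

/-- Uniformly bounded coefficients and states: the hypotheses shared by the Lipschitz estimates. -/
structure BoundedFamily (S : FBLQData n m k) (c : ℝ) (τ : Ω → ℝ) (X Y : Ω → FBState n m) :
    Prop where
  coeff : ∀ ω, S.CoeffBound c (τ ω)
  left1 : ∀ ω, (X ω).P1.l1 ≤ c
  left2 : ∀ ω, (X ω).P2.l1 ≤ c
  left3 : ∀ ω, (X ω).P3.l1 ≤ c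
  right1 : ∀ ω, (Y ω).P1.l1 ≤ c
  right2 : ∀ ω, (Y ω).P2.l1 ≤ c
  right3 : ∀ ω, (Y ω).P3.l1 ≤ c

/-- The estimates for `L₁, …, L₁₁` and for the drifts follow their definitions term by term. The
inverses and the earlier matrices enter as hypotheses, so that the same estimates serve on
different neighbourhoods of the admissible states. -/
lemma lipPair_L1 (h : S.BoundedFamily c τ X Y) :
    LipPair (fun ω => (X ω).gap (Y ω)) (fun ω => S.L1 (X ω).P2 (X ω).P3 (τ ω))
      (fun ω => S.L1 (Y ω).P2 (Y ω).P3 (τ ω)) := by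
  have hr : ∀ ω, 0 ≤ (X ω).gap (Y ω) := fun ω => (X ω).gap_nonneg (Y ω)
  have h2 := lipPair_P2 h.left2 h.right2
  have h3 := lipPair_P3 h.left3 h.right3
  have hC2 := LipPair.of_bound hr fun ω => (h.coeff ω).C2
  have hC4 := LipPair.of_bound hr fun ω => (h.coeff ω).C4
  unfold L1
  repeat' first
    | with_reducible assumption
    | with_reducible exact LipPair.const hr _
    | with_reducible apply LipPair.add
    | with_reducible apply LipPair.sub
    | with_reducible apply LipPair.neg
    | with_reducible apply LipPair.mul

lemma lipPair_L2 (h : S.BoundedFamily c τ X Y)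
    (i1 : LipPair (fun ω => (X ω).gap (Y ω))
      (fun ω => (S.L1 (X ω).P2 (X ω).P3 (τ ω))⁻¹) (fun ω => (S.L1 (Y ω).P2 (Y ω).P3 (τ ω))⁻¹)) :
    LipPair (fun ω => (X ω).gap (Y ω)) (fun ω => S.L2 (X ω).P1 (X ω).P2 (X ω).P3 (τ ω))
      (fun ω => S.L2 (Y ω).P1 (Y ω).P2 (Y ω).P3 (τ ω)) := by
  have hr : ∀ ω, 0 ≤ (X ω).gap (Y ω) := fun ω => (X ω).gap_nonneg (Y ω)
  have h1 := lipPair_P1 h.left1 h.right1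
  have h2 := lipPair_P2 h.left2 h.right2
  have h3 := lipPair_P3 h.left3 h.right3
  have hC2 := LipPair.of_bound hr fun ω => (h.coeff ω).C2
  have hC4 := LipPair.of_bound hr fun ω => (h.coeff ω).C4
  unfold L2
  repeat' first
    | with_reducible assumption
    | with_reducible exact LipPair.const hr _
    | with_reducible apply LipPair.add
    | with_reducible apply LipPair.sub
    | with_reducible apply LipPair.neg
    | with_reducible apply LipPair.mul
    | with_reducible apply LipPair.transpose

lemma lipPair_L3 (h : S.BoundedFamily c τ X Y)
    (i1 : LipPair (fun ω => (X ω).gap (Y ω))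
      (fun ω => (S.L1 (X ω).P2 (X ω).P3 (τ ω))⁻¹) (fun ω => (S.L1 (Y ω).P2 (Y ω).P3 (τ ω))⁻¹)) :
    LipPair (fun ω => (X ω).gap (Y ω)) (fun ω => S.L3 (X ω).P1 (X ω).P2 (X ω).P3 (τ ω))
      (fun ω => S.L3 (Y ω).P1 (Y ω).P2 (Y ω).P3 (τ ω)) := by
  have hr : ∀ ω, 0 ≤ (X ω).gap (Y ω) := fun ω => (X ω).gap_nonneg (Y ω)
  have h1 := lipPair_P1 h.left1 h.right1
  have h2 := lipPair_P2 h.left2 h.right2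
  have h3 := lipPair_P3 h.left3 h.right3
  have hA2 := LipPair.of_bound hr fun ω => (h.coeff ω).A2
  have hB2 := LipPair.of_bound hr fun ω => (h.coeff ω).B2
  have hC1 := LipPair.of_bound hr fun ω => (h.coeff ω).C1
  have hC4 := LipPair.of_bound hr fun ω => (h.coeff ω).C4
  have hC2 := LipPair.of_bound hr fun ω => (h.coeff ω).C2
  unfold L3
  repeat' first
    | with_reducible assumption
    | with_reducible exact LipPair.const hr _
    | with_reducible apply LipPair.add
    | with_reducible apply LipPair.sub
    | with_reducible apply LipPair.neg
    | with_reducible apply LipPair.mul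
    | with_reducible apply LipPair.transpose

lemma lipPair_L4 (h : S.BoundedFamily c τ X Y)
    (i1 : LipPair (fun ω => (X ω).gap (Y ω))
      (fun ω => (S.L1 (X ω).P2 (X ω).P3 (τ ω))⁻¹) (fun ω => (S.L1 (Y ω).P2 (Y ω).P3 (τ ω))⁻¹)) :
    LipPair (fun ω => (X ω).gap (Y ω)) (fun ω => S.L4 (X ω).P1 (X ω).P2 (X ω).P3 (τ ω))
      (fun ω => S.L4 (Y ω).P1 (Y ω).P2 (Y ω).P3 (τ ω)) := by
  have hr : ∀ ω, 0 ≤ (X ω).gap (Y ω) := fun ω => (X ω).gap_nonneg (Y ω)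
  have h1 := lipPair_P1 h.left1 h.right1
  have h2 := lipPair_P2 h.left2 h.right2
  have h3 := lipPair_P3 h.left3 h.right3
  have hB2 := LipPair.of_bound hr fun ω => (h.coeff ω).B2
  have hC1 := LipPair.of_bound hr fun ω => (h.coeff ω).C1
  have hC2 := LipPair.of_bound hr fun ω => (h.coeff ω).C2
  have hC3 := LipPair.of_bound hr fun ω => (h.coeff ω).C3
  have hC4 := LipPair.of_bound hr fun ω => (h.coeff ω).C4
  unfold L4
  repeat' first
    | with_reducible assumption
    | with_reducible exact LipPair.const hr _
    | with_reducible apply LipPair.add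
    | with_reducible apply LipPair.sub
    | with_reducible apply LipPair.neg
    | with_reducible apply LipPair.mul
    | with_reducible apply LipPair.transpose

lemma lipPair_S1 (h : S.BoundedFamily c τ X Y)
    (i1 : LipPair (fun ω => (X ω).gap (Y ω))
      (fun ω => (S.L1 (X ω).P2 (X ω).P3 (τ ω))⁻¹) (fun ω => (S.L1 (Y ω).P2 (Y ω).P3 (τ ω))⁻¹)) :
    LipPair (fun ω => (X ω).gap (Y ω)) (fun ω => S.S1 (X ω).P1 (X ω).P2 (X ω).P3 (τ ω))
      (fun ω => S.S1 (Y ω).P1 (Y ω).P2 (Y ω).P3 (τ ω)) := by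
  have hr : ∀ ω, 0 ≤ (X ω).gap (Y ω) := fun ω => (X ω).gap_nonneg (Y ω)
  have h1 := lipPair_P1 h.left1 h.right1
  have h2 := lipPair_P2 h.left2 h.right2
  have hC2 := LipPair.of_bound hr fun ω => (h.coeff ω).C2
  have hC4 := LipPair.of_bound hr fun ω => (h.coeff ω).C4
  unfold S1
  repeat' first
    | with_reducible assumption
    | with_reducible exact LipPair.const hr _
    | with_reducible apply LipPair.add
    | with_reducible apply LipPair.sub
    | with_reducible apply LipPair.neg
    | with_reducible apply LipPair.mul
    | with_reducible apply LipPair.transpose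

lemma lipPair_L5 (h : S.BoundedFamily c τ X Y)
    (i2 : LipPair (fun ω => (X ω).gap (Y ω))
      (fun ω => (S.L2 (X ω).P1 (X ω).P2 (X ω).P3 (τ ω))⁻¹) (fun ω => (S.L2 (Y ω).P1 (Y ω).P2 (Y ω).P3 (τ ω))⁻¹))
    (hS1 : LipPair (fun ω => (X ω).gap (Y ω))
      (fun ω => S.S1 (X ω).P1 (X ω).P2 (X ω).P3 (τ ω)) (fun ω => S.S1 (Y ω).P1 (Y ω).P2 (Y ω).P3 (τ ω))) :
    LipPair (fun ω => (X ω).gap (Y ω)) (fun ω => S.L5 (X ω).P1 (X ω).P2 (X ω).P3 (τ ω))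
      (fun ω => S.L5 (Y ω).P1 (Y ω).P2 (Y ω).P3 (τ ω)) := by
  have hr : ∀ ω, 0 ≤ (X ω).gap (Y ω) := fun ω => (X ω).gap_nonneg (Y ω)
  have hD4 := LipPair.of_bound hr fun ω => (h.coeff ω).D4
  have hD2 := LipPair.of_bound hr fun ω => (h.coeff ω).D2
  unfold L5
  repeat' first
    | with_reducible assumption
    | with_reducible exact LipPair.const hr _
    | with_reducible apply LipPair.add
    | with_reducible apply LipPair.sub
    | with_reducible apply LipPair.neg
    | with_reducible apply LipPair.mul
    | with_reducible apply LipPair.transpose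

lemma lipPair_L6 (h : S.BoundedFamily c τ X Y)
    (i2 : LipPair (fun ω => (X ω).gap (Y ω))
      (fun ω => (S.L2 (X ω).P1 (X ω).P2 (X ω).P3 (τ ω))⁻¹) (fun ω => (S.L2 (Y ω).P1 (Y ω).P2 (Y ω).P3 (τ ω))⁻¹))
    (i5 : LipPair (fun ω => (X ω).gap (Y ω))
      (fun ω => (S.L5 (X ω).P1 (X ω).P2 (X ω).P3 (τ ω))⁻¹) (fun ω => (S.L5 (Y ω).P1 (Y ω).P2 (Y ω).P3 (τ ω))⁻¹))
    (hL3 : LipPair (fun ω => (X ω).gap (Y ω))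
      (fun ω => S.L3 (X ω).P1 (X ω).P2 (X ω).P3 (τ ω)) (fun ω => S.L3 (Y ω).P1 (Y ω).P2 (Y ω).P3 (τ ω))) :
    LipPair (fun ω => (X ω).gap (Y ω)) (fun ω => S.L6 (X ω).P1 (X ω).P2 (X ω).P3 (τ ω))
      (fun ω => S.L6 (Y ω).P1 (Y ω).P2 (Y ω).P3 (τ ω)) := by
  have hr : ∀ ω, 0 ≤ (X ω).gap (Y ω) := fun ω => (X ω).gap_nonneg (Y ω)
  have h1 := lipPair_P1 h.left1 h.right1
  have hD1 := LipPair.of_bound hr fun ω => (h.coeff ω).D1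
  have hD2 := LipPair.of_bound hr fun ω => (h.coeff ω).D2
  unfold L6
  repeat' first
    | with_reducible assumption
    | with_reducible exact LipPair.const hr _
    | with_reducible apply LipPair.add
    | with_reducible apply LipPair.sub
    | with_reducible apply LipPair.neg
    | with_reducible apply LipPair.mul
    | with_reducible apply LipPair.transpose

lemma lipPair_L7 (h : S.BoundedFamily c τ X Y)
    (i2 : LipPair (fun ω => (X ω).gap (Y ω))
      (fun ω => (S.L2 (X ω).P1 (X ω).P2 (X ω).P3 (τ ω))⁻¹) (fun ω => (S.L2 (Y ω).P1 (Y ω).P2 (Y ω).P3 (τ ω))⁻¹))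
    (i5 : LipPair (fun ω => (X ω).gap (Y ω))
      (fun ω => (S.L5 (X ω).P1 (X ω).P2 (X ω).P3 (τ ω))⁻¹) (fun ω => (S.L5 (Y ω).P1 (Y ω).P2 (Y ω).P3 (τ ω))⁻¹))
    (hL4 : LipPair (fun ω => (X ω).gap (Y ω))
      (fun ω => S.L4 (X ω).P1 (X ω).P2 (X ω).P3 (τ ω)) (fun ω => S.L4 (Y ω).P1 (Y ω).P2 (Y ω).P3 (τ ω))) :
    LipPair (fun ω => (X ω).gap (Y ω)) (fun ω => S.L7 (X ω).P1 (X ω).P2 (X ω).P3 (τ ω))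
      (fun ω => S.L7 (Y ω).P1 (Y ω).P2 (Y ω).P3 (τ ω)) := by
  have hr : ∀ ω, 0 ≤ (X ω).gap (Y ω) := fun ω => (X ω).gap_nonneg (Y ω)
  have h2 := lipPair_P2 h.left2 h.right2
  have hD1 := LipPair.of_bound hr fun ω => (h.coeff ω).D1
  have hD2 := LipPair.of_bound hr fun ω => (h.coeff ω).D2
  have hD3 := LipPair.of_bound hr fun ω => (h.coeff ω).D3
  unfold L7
  repeat' first
    | with_reducible assumption
    | with_reducible exact LipPair.const hr _
    | with_reducible apply LipPair.add
    | with_reducible apply LipPair.sub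
    | with_reducible apply LipPair.neg
    | with_reducible apply LipPair.mul
    | with_reducible apply LipPair.transpose

lemma lipPair_L8 (h : S.BoundedFamily c τ X Y)
    (i2 : LipPair (fun ω => (X ω).gap (Y ω))
      (fun ω => (S.L2 (X ω).P1 (X ω).P2 (X ω).P3 (τ ω))⁻¹) (fun ω => (S.L2 (Y ω).P1 (Y ω).P2 (Y ω).P3 (τ ω))⁻¹))
    (hL3 : LipPair (fun ω => (X ω).gap (Y ω))
      (fun ω => S.L3 (X ω).P1 (X ω).P2 (X ω).P3 (τ ω)) (fun ω => S.L3 (Y ω).P1 (Y ω).P2 (Y ω).P3 (τ ω)))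
    (hS1 : LipPair (fun ω => (X ω).gap (Y ω))
      (fun ω => S.S1 (X ω).P1 (X ω).P2 (X ω).P3 (τ ω)) (fun ω => S.S1 (Y ω).P1 (Y ω).P2 (Y ω).P3 (τ ω)))
    (hL6 : LipPair (fun ω => (X ω).gap (Y ω))
      (fun ω => S.L6 (X ω).P1 (X ω).P2 (X ω).P3 (τ ω)) (fun ω => S.L6 (Y ω).P1 (Y ω).P2 (Y ω).P3 (τ ω))) :
    LipPair (fun ω => (X ω).gap (Y ω)) (fun ω => S.L8 (X ω).P1 (X ω).P2 (X ω).P3 (τ ω))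
      (fun ω => S.L8 (Y ω).P1 (Y ω).P2 (Y ω).P3 (τ ω)) := by
  have hr : ∀ ω, 0 ≤ (X ω).gap (Y ω) := fun ω => (X ω).gap_nonneg (Y ω)
  have hD2 := LipPair.of_bound hr fun ω => (h.coeff ω).D2
  unfold L8
  repeat' first
    | with_reducible assumption
    | with_reducible exact LipPair.const hr _
    | with_reducible apply LipPair.add
    | with_reducible apply LipPair.sub
    | with_reducible apply LipPair.neg
    | with_reducible apply LipPair.mul

lemma lipPair_L9 (h : S.BoundedFamily c τ X Y)
    (i2 : LipPair (fun ω => (X ω).gap (Y ω))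
      (fun ω => (S.L2 (X ω).P1 (X ω).P2 (X ω).P3 (τ ω))⁻¹) (fun ω => (S.L2 (Y ω).P1 (Y ω).P2 (Y ω).P3 (τ ω))⁻¹))
    (hL4 : LipPair (fun ω => (X ω).gap (Y ω))
      (fun ω => S.L4 (X ω).P1 (X ω).P2 (X ω).P3 (τ ω)) (fun ω => S.L4 (Y ω).P1 (Y ω).P2 (Y ω).P3 (τ ω)))
    (hS1 : LipPair (fun ω => (X ω).gap (Y ω))
      (fun ω => S.S1 (X ω).P1 (X ω).P2 (X ω).P3 (τ ω)) (fun ω => S.S1 (Y ω).P1 (Y ω).P2 (Y ω).P3 (τ ω)))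
    (hL7 : LipPair (fun ω => (X ω).gap (Y ω))
      (fun ω => S.L7 (X ω).P1 (X ω).P2 (X ω).P3 (τ ω)) (fun ω => S.L7 (Y ω).P1 (Y ω).P2 (Y ω).P3 (τ ω))) :
    LipPair (fun ω => (X ω).gap (Y ω)) (fun ω => S.L9 (X ω).P1 (X ω).P2 (X ω).P3 (τ ω))
      (fun ω => S.L9 (Y ω).P1 (Y ω).P2 (Y ω).P3 (τ ω)) := by
  have hr : ∀ ω, 0 ≤ (X ω).gap (Y ω) := fun ω => (X ω).gap_nonneg (Y ω)
  have hD2 := LipPair.of_bound hr fun ω => (h.coeff ω).D2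
  unfold L9
  repeat' first
    | with_reducible assumption
    | with_reducible exact LipPair.const hr _
    | with_reducible apply LipPair.add
    | with_reducible apply LipPair.sub
    | with_reducible apply LipPair.neg
    | with_reducible apply LipPair.mul

lemma lipPair_L10 (h : S.BoundedFamily c τ X Y)
    (i1 : LipPair (fun ω => (X ω).gap (Y ω))
      (fun ω => (S.L1 (X ω).P2 (X ω).P3 (τ ω))⁻¹) (fun ω => (S.L1 (Y ω).P2 (Y ω).P3 (τ ω))⁻¹))
    (hL6 : LipPair (fun ω => (X ω).gap (Y ω))
      (fun ω => S.L6 (X ω).P1 (X ω).P2 (X ω).P3 (τ ω)) (fun ω => S.L6 (Y ω).P1 (Y ω).P2 (Y ω).P3 (τ ω)))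
    (hL8 : LipPair (fun ω => (X ω).gap (Y ω))
      (fun ω => S.L8 (X ω).P1 (X ω).P2 (X ω).P3 (τ ω)) (fun ω => S.L8 (Y ω).P1 (Y ω).P2 (Y ω).P3 (τ ω))) :
    LipPair (fun ω => (X ω).gap (Y ω)) (fun ω => S.L10 (X ω).P1 (X ω).P2 (X ω).P3 (τ ω))
      (fun ω => S.L10 (Y ω).P1 (Y ω).P2 (Y ω).P3 (τ ω)) := by
  have hr : ∀ ω, 0 ≤ (X ω).gap (Y ω) := fun ω => (X ω).gap_nonneg (Y ω)
  have h1 := lipPair_P1 h.left1 h.right1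
  have h2 := lipPair_P2 h.left2 h.right2
  have h3 := lipPair_P3 h.left3 h.right3
  have hA2 := LipPair.of_bound hr fun ω => (h.coeff ω).A2
  have hB2 := LipPair.of_bound hr fun ω => (h.coeff ω).B2
  have hC1 := LipPair.of_bound hr fun ω => (h.coeff ω).C1
  have hC2 := LipPair.of_bound hr fun ω => (h.coeff ω).C2
  have hD2 := LipPair.of_bound hr fun ω => (h.coeff ω).D2
  unfold L10
  repeat' first
    | with_reducible assumption
    | with_reducible exact LipPair.const hr _
    | with_reducible apply LipPair.add
    | with_reducible apply LipPair.sub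
    | with_reducible apply LipPair.neg
    | with_reducible apply LipPair.mul
    | with_reducible apply LipPair.transpose

lemma lipPair_L11 (h : S.BoundedFamily c τ X Y)
    (i1 : LipPair (fun ω => (X ω).gap (Y ω))
      (fun ω => (S.L1 (X ω).P2 (X ω).P3 (τ ω))⁻¹) (fun ω => (S.L1 (Y ω).P2 (Y ω).P3 (τ ω))⁻¹))
    (hL7 : LipPair (fun ω => (X ω).gap (Y ω))
      (fun ω => S.L7 (X ω).P1 (X ω).P2 (X ω).P3 (τ ω)) (fun ω => S.L7 (Y ω).P1 (Y ω).P2 (Y ω).P3 (τ ω)))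
    (hL9 : LipPair (fun ω => (X ω).gap (Y ω))
      (fun ω => S.L9 (X ω).P1 (X ω).P2 (X ω).P3 (τ ω)) (fun ω => S.L9 (Y ω).P1 (Y ω).P2 (Y ω).P3 (τ ω))) :
    LipPair (fun ω => (X ω).gap (Y ω)) (fun ω => S.L11 (X ω).P1 (X ω).P2 (X ω).P3 (τ ω))
      (fun ω => S.L11 (Y ω).P1 (Y ω).P2 (Y ω).P3 (τ ω)) := by
  have hr : ∀ ω, 0 ≤ (X ω).gap (Y ω) := fun ω => (X ω).gap_nonneg (Y ω)
  have h2 := lipPair_P2 h.left2 h.right2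
  have h3 := lipPair_P3 h.left3 h.right3
  have hB2 := LipPair.of_bound hr fun ω => (h.coeff ω).B2
  have hC1 := LipPair.of_bound hr fun ω => (h.coeff ω).C1
  have hC2 := LipPair.of_bound hr fun ω => (h.coeff ω).C2
  have hC3 := LipPair.of_bound hr fun ω => (h.coeff ω).C3
  have hD2 := LipPair.of_bound hr fun ω => (h.coeff ω).D2
  unfold L11
  repeat' first
    | with_reducible assumption
    | with_reducible exact LipPair.const hr _
    | with_reducible apply LipPair.add
    | with_reducible apply LipPair.sub
    | with_reducible apply LipPair.neg
    | with_reducible apply LipPair.mul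
    | with_reducible apply LipPair.transpose

lemma lipPair_drift1 (h : S.BoundedFamily c τ X Y)
    (hL6 : LipPair (fun ω => (X ω).gap (Y ω))
      (fun ω => S.L6 (X ω).P1 (X ω).P2 (X ω).P3 (τ ω)) (fun ω => S.L6 (Y ω).P1 (Y ω).P2 (Y ω).P3 (τ ω)))
    (hL8 : LipPair (fun ω => (X ω).gap (Y ω))
      (fun ω => S.L8 (X ω).P1 (X ω).P2 (X ω).P3 (τ ω)) (fun ω => S.L8 (Y ω).P1 (Y ω).P2 (Y ω).P3 (τ ω)))
    (hL10 : LipPair (fun ω => (X ω).gap (Y ω))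
      (fun ω => S.L10 (X ω).P1 (X ω).P2 (X ω).P3 (τ ω)) (fun ω => S.L10 (Y ω).P1 (Y ω).P2 (Y ω).P3 (τ ω))) :
    LipPair (fun ω => (X ω).gap (Y ω)) (fun ω => S.drift1 (X ω).P1 (X ω).P2 (X ω).P3 (τ ω))
      (fun ω => S.drift1 (Y ω).P1 (Y ω).P2 (Y ω).P3 (τ ω)) := by
  have hr : ∀ ω, 0 ≤ (X ω).gap (Y ω) := fun ω => (X ω).gap_nonneg (Y ω)
  have h1 := lipPair_P1 h.left1 h.right1
  have h2 := lipPair_P2 h.left2 h.right2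
  have hA1 := LipPair.of_bound hr fun ω => (h.coeff ω).A1
  have hA2 := LipPair.of_bound hr fun ω => (h.coeff ω).A2
  have hA4 := LipPair.of_bound hr fun ω => (h.coeff ω).A4
  have hB1 := LipPair.of_bound hr fun ω => (h.coeff ω).B1
  have hB2 := LipPair.of_bound hr fun ω => (h.coeff ω).B2
  have hB4 := LipPair.of_bound hr fun ω => (h.coeff ω).B4
  have hC1 := LipPair.of_bound hr fun ω => (h.coeff ω).C1
  have hD1 := LipPair.of_bound hr fun ω => (h.coeff ω).D1
  unfold drift1
  repeat' first
    | with_reducible assumption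
    | with_reducible exact LipPair.const hr _
    | with_reducible apply LipPair.add
    | with_reducible apply LipPair.sub
    | with_reducible apply LipPair.neg
    | with_reducible apply LipPair.mul
    | with_reducible apply LipPair.transpose

lemma lipPair_drift2 (h : S.BoundedFamily c τ X Y)
    (hL6 : LipPair (fun ω => (X ω).gap (Y ω))
      (fun ω => S.L6 (X ω).P1 (X ω).P2 (X ω).P3 (τ ω)) (fun ω => S.L6 (Y ω).P1 (Y ω).P2 (Y ω).P3 (τ ω)))
    (hL8 : LipPair (fun ω => (X ω).gap (Y ω))
      (fun ω => S.L8 (X ω).P1 (X ω).P2 (X ω).P3 (τ ω)) (fun ω => S.L8 (Y ω).P1 (Y ω).P2 (Y ω).P3 (τ ω)))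
    (hL10 : LipPair (fun ω => (X ω).gap (Y ω))
      (fun ω => S.L10 (X ω).P1 (X ω).P2 (X ω).P3 (τ ω)) (fun ω => S.L10 (Y ω).P1 (Y ω).P2 (Y ω).P3 (τ ω))) :
    LipPair (fun ω => (X ω).gap (Y ω)) (fun ω => S.drift2 (X ω).P1 (X ω).P2 (X ω).P3 (τ ω))
      (fun ω => S.drift2 (Y ω).P1 (Y ω).P2 (Y ω).P3 (τ ω)) := by
  have hr : ∀ ω, 0 ≤ (X ω).gap (Y ω) := fun ω => (X ω).gap_nonneg (Y ω)
  have h1 := lipPair_P1 h.left1 h.right1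
  have h2 := lipPair_P2 h.left2 h.right2
  have h3 := lipPair_P3 h.left3 h.right3
  have hA1 := LipPair.of_bound hr fun ω => (h.coeff ω).A1
  have hA3 := LipPair.of_bound hr fun ω => (h.coeff ω).A3
  have hB1 := LipPair.of_bound hr fun ω => (h.coeff ω).B1
  have hB2 := LipPair.of_bound hr fun ω => (h.coeff ω).B2
  have hB3 := LipPair.of_bound hr fun ω => (h.coeff ω).B3
  have hB4 := LipPair.of_bound hr fun ω => (h.coeff ω).B4
  have hC1 := LipPair.of_bound hr fun ω => (h.coeff ω).C1
  have hC3 := LipPair.of_bound hr fun ω => (h.coeff ω).C3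
  have hD1 := LipPair.of_bound hr fun ω => (h.coeff ω).D1
  have hD3 := LipPair.of_bound hr fun ω => (h.coeff ω).D3
  unfold drift2
  repeat' first
    | with_reducible assumption
    | with_reducible exact LipPair.const hr _
    | with_reducible apply LipPair.add
    | with_reducible apply LipPair.sub
    | with_reducible apply LipPair.neg
    | with_reducible apply LipPair.mul
    | with_reducible apply LipPair.transpose

lemma lipPair_drift3 (h : S.BoundedFamily c τ X Y)
    (hL7 : LipPair (fun ω => (X ω).gap (Y ω))
      (fun ω => S.L7 (X ω).P1 (X ω).P2 (X ω).P3 (τ ω)) (fun ω => S.L7 (Y ω).P1 (Y ω).P2 (Y ω).P3 (τ ω)))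
    (hL9 : LipPair (fun ω => (X ω).gap (Y ω))
      (fun ω => S.L9 (X ω).P1 (X ω).P2 (X ω).P3 (τ ω)) (fun ω => S.L9 (Y ω).P1 (Y ω).P2 (Y ω).P3 (τ ω)))
    (hL11 : LipPair (fun ω => (X ω).gap (Y ω))
      (fun ω => S.L11 (X ω).P1 (X ω).P2 (X ω).P3 (τ ω)) (fun ω => S.L11 (Y ω).P1 (Y ω).P2 (Y ω).P3 (τ ω))) :
    LipPair (fun ω => (X ω).gap (Y ω)) (fun ω => S.drift3 (X ω).P1 (X ω).P2 (X ω).P3 (τ ω))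
      (fun ω => S.drift3 (Y ω).P1 (Y ω).P2 (Y ω).P3 (τ ω)) := by
  have hr : ∀ ω, 0 ≤ (X ω).gap (Y ω) := fun ω => (X ω).gap_nonneg (Y ω)
  have h2 := lipPair_P2 h.left2 h.right2
  have h3 := lipPair_P3 h.left3 h.right3
  have hB1 := LipPair.of_bound hr fun ω => (h.coeff ω).B1
  have hB2 := LipPair.of_bound hr fun ω => (h.coeff ω).B2
  have hB3 := LipPair.of_bound hr fun ω => (h.coeff ω).B3
  have hB4 := LipPair.of_bound hr fun ω => (h.coeff ω).B4
  have hC1 := LipPair.of_bound hr fun ω => (h.coeff ω).C1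
  have hC3 := LipPair.of_bound hr fun ω => (h.coeff ω).C3
  have hD1 := LipPair.of_bound hr fun ω => (h.coeff ω).D1
  have hD3 := LipPair.of_bound hr fun ω => (h.coeff ω).D3
  unfold drift3
  repeat' first
    | with_reducible assumption
    | with_reducible exact LipPair.const hr _
    | with_reducible apply LipPair.add
    | with_reducible apply LipPair.sub
    | with_reducible apply LipPair.neg
    | with_reducible apply LipPair.mul
    | with_reducible apply LipPair.transpose

end Lip

/-- The drifts are Lipschitz on admissible states, uniformly in time. -/
lemma exists_driftGap_le (c : ℝ) : ∃ K : ℝ, 0 ≤ K ∧ ∀ (t : ℝ) (X Y : FBState n m),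
    S.CoeffBound c t → S.Admissible c t X → S.Admissible c t Y →
    S.driftGap t X Y ≤ K * X.gap Y ∧ (S.drift1 X.P1 X.P2 X.P3 t).l1 ≤ K ∧
      (S.drift2 X.P1 X.P2 X.P3 t).l1 ≤ K ∧ (S.drift3 X.P1 X.P2 X.P3 t).l1 ≤ K := by
  let Ω : Type := {x : ℝ × FBState n m × FBState n m //
    S.CoeffBound c x.1 ∧ S.Admissible c x.1 x.2.1 ∧ S.Admissible c x.1 x.2.2}
  let τ : Ω → ℝ := fun ω => ω.1.1
  let X : Ω → FBState n m := fun ω => ω.1.2.1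
  let Y : Ω → FBState n m := fun ω => ω.1.2.2
  have hX : ∀ ω, S.Admissible c (τ ω) (X ω) := fun ω => ω.2.2.1
  have hY : ∀ ω, S.Admissible c (τ ω) (Y ω) := fun ω => ω.2.2.2
  have hr : ∀ ω, 0 ≤ (X ω).gap (Y ω) := fun ω => (X ω).gap_nonneg (Y ω)
  have h : S.BoundedFamily c τ X Y := ⟨fun ω => ω.2.1, fun ω => (hX ω).P1, fun ω => (hX ω).P2,
    fun ω => (hX ω).P3, fun ω => (hY ω).P1, fun ω => (hY ω).P2, fun ω => (hY ω).P3⟩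
  have i1 := (lipPair_L1 h).inv hr (fun ω => (hX ω).L1) (fun ω => (hY ω).L1)
  have i2 := (lipPair_L2 h i1).inv hr (fun ω => (hX ω).L2) (fun ω => (hY ω).L2)
  have hS1 := lipPair_S1 h i1
  have i5 := (lipPair_L5 h i2 hS1).inv hr (fun ω => (hX ω).L5) (fun ω => (hY ω).L5)
  have h3 := lipPair_L3 h i1
  have h4 := lipPair_L4 h i1
  have h6 := lipPair_L6 h i2 i5 h3
  have h7 := lipPair_L7 h i2 i5 h4
  have h8 := lipPair_L8 h i2 h3 hS1 h6
  have h9 := lipPair_L9 h i2 h4 hS1 h7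
  have h10 := lipPair_L10 h i1 h6 h8
  have h11 := lipPair_L11 h i1 h7 h9
  obtain ⟨K1, hK1, H1⟩ := lipPair_drift1 h h6 h8 h10
  obtain ⟨K2, hK2, H2⟩ := lipPair_drift2 h h6 h8 h10
  obtain ⟨K3, hK3, H3⟩ := lipPair_drift3 h h7 h9 h11
  refine ⟨K1 + K2 + K3, by positivity, fun t x y hc hx hy => ?_⟩
  obtain ⟨a1, -, d1⟩ := H1 ⟨(t, x, y), hc, hx, hy⟩
  obtain ⟨a2, -, d2⟩ := H2 ⟨(t, x, y), hc, hx, hy⟩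
  obtain ⟨a3, -, d3⟩ := H3 ⟨(t, x, y), hc, hx, hy⟩
  refine ⟨?_, a1.trans (by linarith), a2.trans (by linarith), a3.trans (by linarith)⟩
  rw [add_mul, add_mul]
  exact add_le_add (add_le_add d1 d2) d3

/-- A uniform neighbourhood of an admissible state consists of admissible states. -/
lemma exists_admissible_of_gap_le (c : ℝ) : ∃ ε > 0, ∃ c' ≥ c, ∀ (t : ℝ) (X Y : FBState n m),
    S.CoeffBound c t → S.Admissible c t X → X.gap Y ≤ ε → S.Admissible c' t Y := by
  -- States within distance one of an admissible state are bounded by `c + 1`.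
  let Ω₁ : Type := {x : ℝ × FBState n m × FBState n m //
    S.CoeffBound c x.1 ∧ S.Admissible c x.1 x.2.1 ∧ x.2.1.gap x.2.2 ≤ 1}
  have near : ∀ {α β : Type} [Fintype α] [Fintype β] (M N : Matrix α β ℝ) (b δ : ℝ),
      M.l1 ≤ b → (M - N).l1 ≤ δ → N.l1 ≤ b + δ := by
    intro α β _ _ M N b δ hM hN
    have e : N = M - (M - N) := by abel
    rw [e]
    exact (Matrix.l1_sub_le _ _).trans (add_le_add hM hN)
  have hΩ : ∀ (Ω : Type) (ι : Ω → Ω₁), S.BoundedFamily (c + 1) (fun ω => (ι ω).1.1)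
      (fun ω => (ι ω).1.2.1) (fun ω => (ι ω).1.2.2) := by
    intro Ω ι
    refine ⟨fun ω => (ι ω).2.1.mono (by linarith), fun ω => ?_, fun ω => ?_, fun ω => ?_, fun ω => ?_,
      fun ω => ?_, fun ω => ?_⟩
    · linarith [(ι ω).2.2.1.P1]
    · linarith [(ι ω).2.2.1.P2]
    · linarith [(ι ω).2.2.1.P3]
    · exact near _ _ _ _ (ι ω).2.2.1.P1 ((FBState.l1_P1_le_gap _ _).trans (ι ω).2.2.2)
    · exact near _ _ _ _ (ι ω).2.2.1.P2 ((FBState.l1_P2_le_gap _ _).trans (ι ω).2.2.2)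
    · exact near _ _ _ _ (ι ω).2.2.1.P3 ((FBState.l1_P3_le_gap _ _).trans (ι ω).2.2.2)
  -- Closeness of `L₁`, then of `L₂`, then of `L₅`, each on a smaller neighbourhood.
  have small : ∀ K : ℝ, 0 ≤ K → ∀ δ : ℝ, 0 ≤ c → δ ≤ 1 / (2 * (c * K + 1)) →
      ∀ d : ℝ, d ≤ K * δ → c * d ≤ 1 / 2 := by
    intro K hK δ hc hδ d hd
    have hpos : 0 < 2 * (c * K + 1) := by positivity
    have h1 : c * d ≤ c * K * δ := by
      rw [mul_assoc]; exact mul_le_mul_of_nonneg_left hd hc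
    have h2 : c * K * δ ≤ c * K * (1 / (2 * (c * K + 1))) :=
      mul_le_mul_of_nonneg_left hδ (by positivity)
    have h3 : c * K * (1 / (2 * (c * K + 1))) ≤ 1 / 2 := by
      rw [mul_one_div, div_le_div_iff₀ hpos two_pos]
      linarith
    linarith
  obtain ⟨K1, hK1, H1⟩ := lipPair_L1 (hΩ Ω₁ id)
  have hr : ∀ (Ω : Type) (ι : Ω → Ω₁) (ω : Ω), 0 ≤ (ι ω).1.2.1.gap (ι ω).1.2.2 :=
    fun Ω ι ω => FBState.gap_nonneg _ _
  have hcc : ∀ ω : Ω₁, 0 ≤ c := fun ω => (Matrix.l1_nonneg _).trans ω.2.2.1.P1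
  let Ω₂ : Type := {ω : Ω₁ // ω.1.2.1.gap ω.1.2.2 ≤ 1 / (2 * (c * K1 + 1))}
  let ι₂ : Ω₂ → Ω₁ := fun ω => ω.1
  have u1 : ∀ ω : Ω₂, IsUnit (S.L1 (ι₂ ω).1.2.2.P2 (ι₂ ω).1.2.2.P3 (ι₂ ω).1.1) ∧
      (S.L1 (ι₂ ω).1.2.2.P2 (ι₂ ω).1.2.2.P3 (ι₂ ω).1.1)⁻¹.l1 ≤ 2 * c := fun ω =>
    Matrix.isUnit_of_l1_sub_le (ι₂ ω).2.2.1.L1.1 (ι₂ ω).2.2.1.L1.2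
      (small K1 hK1 _ (hcc ω.1) ω.2 _ (H1 ω.1).2.2)
  have i1 := (lipPair_L1 (hΩ Ω₂ ι₂)).inv (c := 2 * c) (hr _ _)
    (fun ω => ⟨(ι₂ ω).2.2.1.L1.1, by linarith [(ι₂ ω).2.2.1.L1.2, hcc ω.1]⟩) u1
  obtain ⟨K2, hK2, H2⟩ := lipPair_L2 (hΩ Ω₂ ι₂) i1
  let Ω₃ : Type := {ω : Ω₂ // ω.1.1.2.1.gap ω.1.1.2.2 ≤ 1 / (2 * (c * K2 + 1))}
  let ι₃ : Ω₃ → Ω₁ := fun ω => ω.1.1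
  have i1' := (lipPair_L1 (hΩ Ω₃ ι₃)).inv (c := 2 * c) (hr _ _)
    (fun ω => ⟨(ι₃ ω).2.2.1.L1.1, by linarith [(ι₃ ω).2.2.1.L1.2, hcc ω.1.1]⟩) fun ω => u1 ω.1
  have u2 : ∀ ω : Ω₃, IsUnit (S.L2 (ι₃ ω).1.2.2.P1 (ι₃ ω).1.2.2.P2 (ι₃ ω).1.2.2.P3 (ι₃ ω).1.1) ∧
      (S.L2 (ι₃ ω).1.2.2.P1 (ι₃ ω).1.2.2.P2 (ι₃ ω).1.2.2.P3 (ι₃ ω).1.1)⁻¹.l1 ≤ 2 * c := fun ω =>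
    Matrix.isUnit_of_l1_sub_le (ι₃ ω).2.2.1.L2.1 (ι₃ ω).2.2.1.L2.2
      (small K2 hK2 _ (hcc ω.1.1) ω.2 _ (H2 ω.1).2.2)
  have i2 := (lipPair_L2 (hΩ Ω₃ ι₃) i1').inv (c := 2 * c) (hr _ _)
    (fun ω => ⟨(ι₃ ω).2.2.1.L2.1, by linarith [(ι₃ ω).2.2.1.L2.2, hcc ω.1.1]⟩) u2
  obtain ⟨K5, hK5, H5⟩ := lipPair_L5 (hΩ Ω₃ ι₃) i2 (lipPair_S1 (hΩ Ω₃ ι₃) i1')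
  by_cases hc0 : 0 ≤ c
  · refine ⟨min 1 (min (1 / (2 * (c * K1 + 1))) (min (1 / (2 * (c * K2 + 1)))
      (1 / (2 * (c * K5 + 1))))), by positivity, 2 * c + 1, by linarith,
      fun t X Y hC hX hXY => ?_⟩
    simp only [le_min_iff] at hXY
    obtain ⟨g0, g1, g2, g5⟩ := hXY
    let ω : Ω₃ := ⟨⟨⟨(t, X, Y), hC, hX, g0⟩, g1⟩, g2⟩
    have hB := hΩ Ω₁ id
    obtain ⟨v1, w1⟩ := u1 ω.1
    obtain ⟨v2, w2⟩ := u2 ω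
    obtain ⟨v5, w5⟩ := Matrix.isUnit_of_l1_sub_le (X := S.L5 X.P1 X.P2 X.P3 t)
      (Y := S.L5 Y.P1 Y.P2 Y.P3 t) hX.L5.1 hX.L5.2
      (small K5 hK5 _ hc0 g5 _ (H5 ω).2.2)
    exact ⟨(hB.right1 ω.1.1).trans (by linarith), (hB.right2 ω.1.1).trans (by linarith),
      (hB.right3 ω.1.1).trans (by linarith), ⟨v1, w1.trans (by linarith)⟩,
      ⟨v2, w2.trans (by linarith)⟩, ⟨v5, w5.trans (by linarith)⟩⟩
  · exact ⟨1, one_pos, c, le_rfl, fun t X Y _ hX _ =>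
      absurd ((Matrix.l1_nonneg _).trans hX.P1) hc0⟩

end FBLQData

/-! ### The auxiliary Riccati equation and its feedback -/

namespace FBLQData

variable {n m k : ℕ} (S : FBLQData n m k)

/-- The optimal feedback `-M₁⁻¹ M₂` of the auxiliary Riccati equation. -/
def feedback (Pt : Matrix (Fin n ⊕ Fin m) (Fin n ⊕ Fin m) ℝ) (t : ℝ) :
    Matrix (Fin k ⊕ Fin m) (Fin n ⊕ Fin m) ℝ :=
  -((S.M1 Pt t)⁻¹ * S.M2 Pt t)

/-- Elimination in the stationarity conditions: if the control `u`, the diffusion coefficients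
`w`, `z` of the two state components and the adjoint variables `v₁`, `v₂` satisfy the linear
relations of the optimality system, with data `a`, `b`, `d`, then successive elimination of `v₂`,
`z`, `v₁` produces equations whose coefficients are `L₁`, `L₂` and `L₅`. -/
lemma elimination {γ : Type*} {P1 : Matrix (Fin n) (Fin n) ℝ}
    {P2 : Matrix (Fin m) (Fin n) ℝ} {P3 : Matrix (Fin m) (Fin m) ℝ} {t : ℝ}
    (h1 : IsUnit (S.L1 P2 P3 t)) (h2 : IsUnit (S.L2 P1 P2 P3 t)) (h5 : IsUnit (S.L5 P1 P2 P3 t))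
    {u d : Matrix (Fin k) γ ℝ} {z b v2 : Matrix (Fin m) γ ℝ} {a w v1 : Matrix (Fin n) γ ℝ}
    (e1 : S.D4 t * u + d + (S.D2 t)ᵀ * v1 = 0)
    (e2 : S.C4 t * z + b + (S.C2 t)ᵀ * v1 + v2 = 0)
    (e3 : v1 + P2ᵀ * v2 = P1 * w) (e4 : z = P2 * w + P3 * v2)
    (e5 : w = a + S.D2 t * u + S.C2 t * z) :
    let l := P1 * a + P2ᵀ * b
      + (P2ᵀ * S.C4 t + P1 * S.C2 t) * (S.L1 P2 P3 t)⁻¹ * (P2 * a - P3 * b)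
    u = -((S.L5 P1 P2 P3 t)⁻¹ * (d + (S.D2 t)ᵀ * (S.L2 P1 P2 P3 t)⁻¹ * l)) ∧
    v1 = (S.L2 P1 P2 P3 t)⁻¹ * (l + S.S1 P1 P2 P3 t * S.D2 t * u) ∧
    z = (S.L1 P2 P3 t)⁻¹ * (P2 * a - P3 * b - P3 * (S.C2 t)ᵀ * v1 + P2 * S.D2 t * u) := by
  intro l
  rw [Matrix.isUnit_iff_isUnit_det] at h1 h2 h5
  have f2 : v2 = -(S.C4 t * z + b + (S.C2 t)ᵀ * v1) :=
    eq_neg_of_add_eq_zero_right e2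
  have g1 : S.L1 P2 P3 t * z
      = P2 * a - P3 * b - P3 * (S.C2 t)ᵀ * v1 + P2 * S.D2 t * u := by
    have e : z = P2 * (a + S.D2 t * u + S.C2 t * z)
        - P3 * (S.C4 t * z + b + (S.C2 t)ᵀ * v1) := by
      rw [← e5, sub_eq_add_neg, ← Matrix.mul_neg, ← f2, ← e4]
    have e' : S.L1 P2 P3 t * z = z - P2 * (S.C2 t * z) + P3 * (S.C4 t * z) := by
      simp only [L1, Matrix.add_mul, Matrix.sub_mul, Matrix.one_mul, Matrix.mul_assoc]
    rw [e']
    nth_rewrite 1 [e]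
    simp only [Matrix.mul_add, Matrix.mul_assoc]
    abel
  have hz : z = (S.L1 P2 P3 t)⁻¹
      * (P2 * a - P3 * b - P3 * (S.C2 t)ᵀ * v1 + P2 * S.D2 t * u) := by
    rw [← g1, Matrix.nonsing_inv_mul_cancel_left _ _ h1]
  have g2 : S.L2 P1 P2 P3 t * v1 = l + S.S1 P1 P2 P3 t * S.D2 t * u := by
    have e : v1 = P1 * (a + S.D2 t * u + S.C2 t * z)
        + P2ᵀ * (S.C4 t * z + b + (S.C2 t)ᵀ * v1) := by
      rw [← e5, ← e3, f2]
      simp only [Matrix.mul_neg, neg_add_cancel_right]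
    have e' : v1 - P2ᵀ * ((S.C2 t)ᵀ * v1) = P1 * a + P2ᵀ * b + P1 * (S.D2 t * u)
        + (P2ᵀ * S.C4 t + P1 * S.C2 t) * z := by
      nth_rewrite 1 [e]
      simp only [Matrix.mul_add, Matrix.add_mul, Matrix.mul_assoc]
      abel
    have e'' : S.L2 P1 P2 P3 t * v1 = v1 - P2ᵀ * ((S.C2 t)ᵀ * v1)
        + (P2ᵀ * S.C4 t + P1 * S.C2 t) * ((S.L1 P2 P3 t)⁻¹ * (P3 * ((S.C2 t)ᵀ * v1))) := by
      simp only [L2, Matrix.add_mul, Matrix.sub_mul, Matrix.one_mul, Matrix.mul_assoc]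
      abel
    rw [e'', e', hz]
    simp only [l, S1, Matrix.mul_add, Matrix.mul_sub, Matrix.add_mul, Matrix.mul_assoc]
    abel
  have hv : v1 = (S.L2 P1 P2 P3 t)⁻¹ * (l + S.S1 P1 P2 P3 t * S.D2 t * u) := by
    rw [← g2, Matrix.nonsing_inv_mul_cancel_left _ _ h2]
  have g5 : S.L5 P1 P2 P3 t * u = -(d + (S.D2 t)ᵀ * (S.L2 P1 P2 P3 t)⁻¹ * l) := by
    rw [eq_neg_iff_add_eq_zero, ← e1]
    nth_rewrite 1 [hv]
    simp only [L5, Matrix.mul_add, Matrix.add_mul, Matrix.mul_assoc]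
    abel
  refine ⟨?_, hv, hz⟩
  rw [← Matrix.mul_neg, ← g5, Matrix.nonsing_inv_mul_cancel_left _ _ h5]

/-- The drift of the Riccati equation, written with the optimal feedback `Θ` and
`V = P̃ (C̃ + D̃ Θ)`; the second equation is the stationarity condition. -/
lemma riccatiDrift_eq_feedback {Pt : Matrix (Fin n ⊕ Fin m) (Fin n ⊕ Fin m) ℝ} {t : ℝ}
    (hP : Pt.IsSymm) (hM : IsUnit (S.M1 Pt t)) :
    S.riccatiDrift Pt t = Pt * S.At t + (S.At t)ᵀ * Pt
      + (S.Ct t)ᵀ * (Pt * (S.Ct t + S.Dt t * S.feedback Pt t))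
      + Pt * S.Bt t * S.feedback Pt t + S.Qt t ∧
    S.Rt t * S.feedback Pt t + (S.Bt t)ᵀ * Pt
      + (S.Dt t)ᵀ * (Pt * (S.Ct t + S.Dt t * S.feedback Pt t)) = 0 := by
  have hM2 : (S.M2 Pt t)ᵀ = Pt * S.Bt t + (S.Ct t)ᵀ * Pt * S.Dt t := by
    simp only [M2, Matrix.transpose_add, Matrix.transpose_mul, Matrix.transpose_transpose, hP.eq,
      Matrix.mul_assoc]
  rw [Matrix.isUnit_iff_isUnit_det] at hM
  have hf : S.M1 Pt t * S.feedback Pt t = -S.M2 Pt t := by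
    rw [feedback, Matrix.mul_neg, Matrix.mul_nonsing_inv_cancel_left _ _ hM]
  constructor
  · have e : (S.M2 Pt t)ᵀ * (S.M1 Pt t)⁻¹ * S.M2 Pt t
        = -((Pt * S.Bt t + (S.Ct t)ᵀ * Pt * S.Dt t) * S.feedback Pt t) := by
      rw [← hM2, feedback, Matrix.mul_neg, neg_neg, Matrix.mul_assoc]
    rw [riccatiDrift, e]
    simp only [Matrix.mul_add, Matrix.add_mul, Matrix.mul_assoc]
    abel
  · have e : S.M1 Pt t * S.feedback Pt t + S.M2 Pt t = 0 := by rw [hf, neg_add_cancel]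
    rw [← e]
    simp only [M1, M2, Matrix.mul_add, Matrix.add_mul, Matrix.mul_assoc]
    abel

/-- The closed-loop form of the Riccati drift with an arbitrary feedback `Θ`. -/
def closedLoop (Pt : Matrix (Fin n ⊕ Fin m) (Fin n ⊕ Fin m) ℝ)
    (Θ : Matrix (Fin k ⊕ Fin m) (Fin n ⊕ Fin m) ℝ) (t : ℝ) :
    Matrix (Fin n ⊕ Fin m) (Fin n ⊕ Fin m) ℝ :=
  Pt * (S.At t + S.Bt t * Θ) + (S.At t + S.Bt t * Θ)ᵀ * Pt
    + (S.Ct t + S.Dt t * Θ)ᵀ * Pt * (S.Ct t + S.Dt t * Θ) + (S.Qt t + Θᵀ * S.Rt t * Θ)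

lemma isSymm_M1 {Pt : Matrix (Fin n ⊕ Fin m) (Fin n ⊕ Fin m) ℝ} {t : ℝ}
    (hP : Pt.IsSymm) (hC : (S.C4 t).IsSymm) (hD : (S.D4 t).IsSymm) : (S.M1 Pt t).IsSymm := by
  unfold Matrix.IsSymm M1 Rt
  simp only [Matrix.transpose_add, Matrix.transpose_mul, Matrix.transpose_transpose, hP.eq,
      Matrix.fromBlocks_transpose, hC.eq, hD.eq, Matrix.transpose_zero, Matrix.mul_assoc]

/-- Completing the square: the optimal feedback minimizes the closed-loop drift. -/
lemma closedLoop_eq_riccatiDrift_add {Pt : Matrix (Fin n ⊕ Fin m) (Fin n ⊕ Fin m) ℝ} {t : ℝ}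
    (hP : Pt.IsSymm) (hMs : (S.M1 Pt t).IsSymm) (hM : IsUnit (S.M1 Pt t))
    (Θ : Matrix (Fin k ⊕ Fin m) (Fin n ⊕ Fin m) ℝ) :
    S.closedLoop Pt Θ t = S.riccatiDrift Pt t
      + (Θ - S.feedback Pt t)ᵀ * S.M1 Pt t * (Θ - S.feedback Pt t) := by
  have hM2 : (S.M2 Pt t)ᵀ = Pt * S.Bt t + (S.Ct t)ᵀ * Pt * S.Dt t := by
    simp only [M2, Matrix.transpose_add, Matrix.transpose_mul, Matrix.transpose_transpose, hP.eq,
      Matrix.mul_assoc]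
  rw [Matrix.isUnit_iff_isUnit_det] at hM
  have hi : (S.M1 Pt t)⁻¹ᵀ = (S.M1 Pt t)⁻¹ := by rw [Matrix.transpose_nonsing_inv, hMs.eq]
  have e1 : S.closedLoop Pt Θ t = Pt * S.At t + (S.At t)ᵀ * Pt + (S.Ct t)ᵀ * Pt * S.Ct t + S.Qt t
      + (S.M2 Pt t)ᵀ * Θ + Θᵀ * S.M2 Pt t + Θᵀ * S.M1 Pt t * Θ := by
    rw [hM2]
    simp only [closedLoop, M1, M2, Matrix.transpose_add, Matrix.transpose_mul, Matrix.mul_add,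
      Matrix.add_mul, Matrix.mul_assoc]
    abel
  have e2 : (Θ - S.feedback Pt t)ᵀ * S.M1 Pt t * (Θ - S.feedback Pt t)
      = (S.M2 Pt t)ᵀ * (S.M1 Pt t)⁻¹ * S.M2 Pt t + (S.M2 Pt t)ᵀ * Θ + Θᵀ * S.M2 Pt t
        + Θᵀ * S.M1 Pt t * Θ := by
    simp only [feedback, sub_neg_eq_add, Matrix.transpose_add, Matrix.transpose_mul, hi,
      Matrix.add_mul, Matrix.mul_add, Matrix.mul_assoc, Matrix.mul_nonsing_inv_cancel_left _ _ hM,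
      Matrix.nonsing_inv_mul_cancel_left _ _ hM]
    abel
  rw [e1, e2, riccatiDrift]
  abel

lemma isSymm_riccatiDrift {Pt : Matrix (Fin n ⊕ Fin m) (Fin n ⊕ Fin m) ℝ} {t : ℝ}
    (hP : Pt.IsSymm) (hA : (S.A4 t).IsSymm) (hB : (S.B4 t).IsSymm) (hM : (S.M1 Pt t).IsSymm) :
    (S.riccatiDrift Pt t).IsSymm := by
  have hi : (S.M1 Pt t)⁻¹ᵀ = (S.M1 Pt t)⁻¹ := by rw [Matrix.transpose_nonsing_inv, hM.eq]
  have hQ : (S.Qt t)ᵀ = S.Qt t := by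
    simp only [Qt, Matrix.fromBlocks_transpose, hA.eq, hB.eq, Matrix.transpose_zero]
  unfold Matrix.IsSymm riccatiDrift
  simp only [Matrix.transpose_add, Matrix.transpose_sub, Matrix.transpose_mul,
    Matrix.transpose_transpose, hP.eq, hi, hQ, Matrix.mul_assoc]
  abel

/-! ### The block transformation -/

/-- The change of variables `(x, q) ↦ (x, y)` with `y = P₂ x + P₃ q`. -/
def stateMap (P2 : Matrix (Fin m) (Fin n) ℝ) (P3 : Matrix (Fin m) (Fin m) ℝ) :
    Matrix (Fin n ⊕ Fin m) (Fin n ⊕ Fin m) ℝ :=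
  fromBlocks 1 0 P2 P3

end FBLQData

/-- If `q` is the second component of `P̃ (x, y)`, then `y = P₂ x + P₃ q`, and the first component
of `P̃ (x, y)` is `P₁ x - P₂ᵀ q`: the transformation exchanges the roles of `y` and `q`. -/
lemma mul_stateMap_block {n m : ℕ} {Pt : Matrix (Fin n ⊕ Fin m) (Fin n ⊕ Fin m) ℝ}
    (hP : Pt.IsSymm) (h : IsUnit Pt.toBlocks₂₂) :
    Pt * FBLQData.stateMap (blockP2 Pt) (blockP3 Pt)
      = fromBlocks (blockP1 Pt) (-(blockP2 Pt)ᵀ) 0 1 := by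
  rw [Matrix.isUnit_iff_isUnit_det] at h
  have h12 : Pt.toBlocks₁₂ = Pt.toBlocks₂₁ᵀ := by
    ext i j
    exact (hP.apply (Sum.inl i) (Sum.inr j)).symm
  have h22 : Pt.toBlocks₂₂ᵀ = Pt.toBlocks₂₂ := by
    ext i j
    exact hP.apply (Sum.inr i) (Sum.inr j)
  conv_lhs => rw [← Matrix.fromBlocks_toBlocks Pt]
  rw [FBLQData.stateMap, Matrix.fromBlocks_multiply, blockP1, blockP3, h12]
  congr 1
  · simp [blockP2, Matrix.mul_assoc, sub_eq_add_neg]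
  · simp [blockP2, Matrix.transpose_mul, Matrix.transpose_nonsing_inv, h22]
  · simp [blockP2, Matrix.mul_nonsing_inv_cancel_left _ _ h]
  · simp [Matrix.mul_nonsing_inv _ h]

lemma isSymm_blockP1 {n m : ℕ} {Pt : Matrix (Fin n ⊕ Fin m) (Fin n ⊕ Fin m) ℝ}
    (hP : Pt.IsSymm) : (blockP1 Pt)ᵀ = blockP1 Pt := by
  have h11 : Pt.toBlocks₁₁ᵀ = Pt.toBlocks₁₁ := by
    ext i j
    exact hP.apply (Sum.inl i) (Sum.inl j)
  have h22 : Pt.toBlocks₂₂ᵀ = Pt.toBlocks₂₂ := by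
    ext i j
    exact hP.apply (Sum.inr i) (Sum.inr j)
  simp [blockP1, Matrix.transpose_mul, Matrix.transpose_nonsing_inv, h11, h22, Matrix.mul_assoc]

lemma isSymm_blockP3 {n m : ℕ} {Pt : Matrix (Fin n ⊕ Fin m) (Fin n ⊕ Fin m) ℝ}
    (hP : Pt.IsSymm) : (blockP3 Pt)ᵀ = blockP3 Pt := by
  have h22 : Pt.toBlocks₂₂ᵀ = Pt.toBlocks₂₂ := by
    ext i j
    exact hP.apply (Sum.inr i) (Sum.inr j)
  simp [blockP3, Matrix.transpose_nonsing_inv, h22]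

namespace FBLQData

variable {n m k : ℕ} (S : FBLQData n m k)

/-- The congruence by `stateMap` transforms the Riccati drift into the drifts of the
non-Riccati-type system. -/
lemma stateMap_congr_riccatiDrift {Pt : Matrix (Fin n ⊕ Fin m) (Fin n ⊕ Fin m) ℝ} {t : ℝ}
    (hP : Pt.IsSymm) (h22 : IsUnit Pt.toBlocks₂₂) (hM : IsUnit (S.M1 Pt t))
    (h1 : IsUnit (S.L1of Pt t)) (h2 : IsUnit (S.L2of Pt t)) (h5 : IsUnit (S.L5of Pt t)) :
    let J := stateMap (blockP2 Pt) (blockP3 Pt)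
    let E := Jᵀ * S.riccatiDrift Pt t * J
    S.drift1 (blockP1 Pt) (blockP2 Pt) (blockP3 Pt) t = E.toBlocks₁₁ ∧
    S.drift2 (blockP1 Pt) (blockP2 Pt) (blockP3 Pt) t = -E.toBlocks₂₁ ∧
    S.drift3 (blockP1 Pt) (blockP2 Pt) (blockP3 Pt) t = -E.toBlocks₂₂ := by
  intro J E
  obtain ⟨hE, hst⟩ := S.riccatiDrift_eq_feedback hP hM
  have hN := mul_stateMap_block hP h22
  have hN' : Jᵀ * Pt = fromBlocks (blockP1 Pt) 0 (-(blockP2 Pt)) 1 := by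
    have := congrArg Matrix.transpose hN
    rw [Matrix.transpose_mul, hP.eq, Matrix.fromBlocks_transpose, isSymm_blockP1 hP] at this
    simpa using this
  have hJ : Jᵀ = fromBlocks 1 (blockP2 Pt)ᵀ 0 (blockP3 Pt) := by
    simp [J, stateMap, Matrix.fromBlocks_transpose, isSymm_blockP3 hP]
  have hP1 := isSymm_blockP1 hP
  have hP3 := isSymm_blockP3 hP
  unfold L1of at h1
  unfold L2of at h2
  unfold L5of at h5
  change Pt * J = _ at hN
  generalize hfb : S.feedback Pt t = Θ at hE hst
  generalize hV : Pt * (S.Ct t + S.Dt t * Θ) = V at hE hst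
  have hUJ := (Matrix.fromBlocks_toBlocks (Θ * J)).symm
  have hVJ := (Matrix.fromBlocks_toBlocks (V * J)).symm
  generalize hu1 : (Θ * J).toBlocks₁₁ = u1 at hUJ
  generalize hu2 : (Θ * J).toBlocks₁₂ = u2 at hUJ
  generalize hz1 : (Θ * J).toBlocks₂₁ = z1 at hUJ
  generalize hz2 : (Θ * J).toBlocks₂₂ = z2 at hUJ
  generalize hv11 : (V * J).toBlocks₁₁ = v11 at hVJ
  generalize hv12 : (V * J).toBlocks₁₂ = v12 at hVJ
  generalize hv21 : (V * J).toBlocks₂₁ = v21 at hVJ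
  generalize hv22 : (V * J).toBlocks₂₂ = v22 at hVJ
  -- The stationarity condition in blocks.
  have s1 : S.Rt t * (Θ * J) + (S.Bt t)ᵀ * (Pt * J) + (S.Dt t)ᵀ * (V * J) = 0 := by
    have := congrArg (· * J) hst
    simpa only [Matrix.add_mul, Matrix.mul_assoc, Matrix.zero_mul] using this
  -- The definition of `V` in blocks, after multiplication by `Jᵀ`.
  have s2 : Jᵀ * (V * J) = (Jᵀ * Pt) * (S.Ct t * J + S.Dt t * (Θ * J)) := by
    rw [← hV]
    simp only [Matrix.mul_add, Matrix.add_mul, Matrix.mul_assoc]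
  -- The Riccati drift in blocks.
  have s3 : E = (Jᵀ * Pt) * (S.At t * J) + Jᵀ * ((S.At t)ᵀ * (Pt * J))
      + Jᵀ * ((S.Ct t)ᵀ * (V * J)) + (Jᵀ * Pt) * (S.Bt t * (Θ * J)) + Jᵀ * (S.Qt t * J) := by
    simp only [E]
    rw [hE]
    simp only [Matrix.mul_add, Matrix.add_mul, Matrix.mul_assoc]
  rw [hUJ, hN, hVJ] at s1
  rw [hUJ, hN', hVJ, hJ] at s2
  rw [hUJ, hN, hN', hVJ, hJ] at s3
  simp only [J, stateMap] at s1 s2 s3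
  generalize blockP1 Pt = P1 at *
  generalize blockP2 Pt = P2 at *
  generalize blockP3 Pt = P3 at *
  simp only [Rt, Bt, Dt, Ct, At, Qt, Matrix.fromBlocks_transpose,
    Matrix.fromBlocks_multiply, Matrix.fromBlocks_add, Matrix.mul_zero, Matrix.zero_mul,
    Matrix.mul_one, Matrix.one_mul, add_zero, zero_add, Matrix.transpose_zero, Matrix.transpose_one,
    Matrix.transpose_neg, Matrix.neg_mul, Matrix.mul_neg, neg_zero] at s1 s2 s3
  rw [← Matrix.fromBlocks_zero, Matrix.fromBlocks_inj] at s1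
  rw [Matrix.fromBlocks_inj] at s2
  obtain ⟨s11, s12, s13, s14⟩ := s1
  obtain ⟨s21, s22, s23, s24⟩ := s2
  -- The columns `(x, q) = (1, 0)` and `(x, q) = (0, -1)`.
  obtain ⟨c6, c8, c10⟩ := S.elimination h1 h2 h5 (a := S.A2 t + S.B2 t * P2)
    (b := (S.C1 t)ᵀ * P1) (d := (S.D1 t)ᵀ * P1) (u := u1) (z := z1) (v1 := v11) (v2 := v21)
    (w := S.A2 t + S.B2 t * P2 + S.D2 t * u1 + S.C2 t * z1) s11
    (by rw [← s13]; abel) (by rw [s21]; congr 1; abel)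
    (by rw [s23]; simp only [Matrix.mul_add]; abel) rfl
  obtain ⟨c7, c9, c11⟩ := S.elimination h1 h2 h5 (a := -(S.B2 t * P3))
    (b := (S.C1 t)ᵀ * P2ᵀ + (S.C3 t)ᵀ) (d := (S.D1 t)ᵀ * P2ᵀ + (S.D3 t)ᵀ) (u := -u2) (z := -z2)
    (v1 := -v12) (v2 := -v22) (w := -(S.B2 t * P3) + S.D2 t * (-u2) + S.C2 t * (-z2))
    (by rw [← neg_eq_zero, ← s12]; simp only [Matrix.mul_neg]; abel)
    (by rw [← neg_eq_zero, ← s14]; simp only [Matrix.mul_neg]; abel)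
    (by rw [Matrix.mul_neg, ← neg_add, s22]; simp only [Matrix.mul_add, Matrix.mul_neg]; abel)
    (by rw [Matrix.mul_neg P3, s24]; simp only [Matrix.mul_add, Matrix.mul_neg]; abel) rfl
  have d6 : u1 = S.L6 P1 P2 P3 t := by
    rw [c6]
    simp only [L6, L3, Matrix.mul_add, Matrix.mul_sub, Matrix.mul_assoc]
  have d7 : -u2 = S.L7 P1 P2 P3 t := by
    rw [c7]
    simp only [L7, L4, Matrix.mul_add, Matrix.mul_sub, Matrix.mul_neg, Matrix.mul_assoc]
    abel_nf
  have d8 : v11 = S.L8 P1 P2 P3 t := by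
    rw [c8, d6]
    simp only [L8, L3, Matrix.mul_add, Matrix.mul_sub, Matrix.mul_assoc]
  have d9 : -v12 = S.L9 P1 P2 P3 t := by
    rw [c9, d7]
    simp only [L9, L4, Matrix.mul_add, Matrix.mul_sub, Matrix.mul_neg, Matrix.mul_assoc]
    abel_nf
  have d10 : z1 = S.L10 P1 P2 P3 t := by
    rw [c10, d6, d8]
    simp only [L10, Matrix.mul_add, Matrix.mul_sub, Matrix.mul_assoc]
  have d11 : -z2 = S.L11 P1 P2 P3 t := by
    rw [c11, d7, d9]
    simp only [L11, Matrix.mul_add, Matrix.mul_sub, Matrix.mul_neg, Matrix.mul_assoc]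
    abel_nf
  rw [s3, Matrix.toBlocks_fromBlocks₁₁, Matrix.toBlocks_fromBlocks₂₁,
    Matrix.toBlocks_fromBlocks₂₂]
  refine ⟨?_, ?_, ?_⟩
  · simp only [drift1, ← d6, ← d8, ← d10, Matrix.mul_add, Matrix.mul_assoc]
    abel
  · simp only [drift2, ← d6, ← d8, ← d10, Matrix.mul_add, Matrix.mul_assoc]
    abel
  · simp only [drift3, ← d7, ← d9, ← d11, Matrix.mul_add, Matrix.mul_neg, Matrix.mul_assoc]
    abel

end FBLQData

/-! ### Calculus of absolutely continuous matrix functions -/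

/-- `M` is absolutely continuous on `[0, T]`, entry by entry, with derivative `-f` almost
everywhere. -/
structure HasDrift {α β : Type*} (T : ℝ) (f M : ℝ → Matrix α β ℝ) : Prop where
  ac : ∀ a b, AbsolutelyContinuousOnInterval (fun t => M t a b) 0 T
  ae_hasDerivAt : ∀ᵐ t : ℝ, t ∈ Set.Icc 0 T → ∀ a b, HasDerivAt (fun s => M s a b) (-(f t a b)) t

lemma absolutelyContinuousOnInterval_const {a b : ℝ} (c : ℝ) :
    AbsolutelyContinuousOnInterval (fun _ => c) a b := by
  simpa [AbsolutelyContinuousOnInterval] using tendsto_const_nhds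

lemma AbsolutelyContinuousOnInterval.congr_of_eqOn {f g : ℝ → ℝ} {a b : ℝ}
    (hf : AbsolutelyContinuousOnInterval f a b) (h : Set.EqOn f g (Set.uIcc a b)) :
    AbsolutelyContinuousOnInterval g a b := by
  rw [absolutelyContinuousOnInterval_iff] at hf ⊢
  intro ε hε
  obtain ⟨δ, hδ, H⟩ := hf ε hε
  refine ⟨δ, hδ, fun E hE hs => lt_of_eq_of_lt (Finset.sum_congr rfl fun i hi => ?_) (H E hE hs)⟩
  rw [h (hE.1 i hi).1, h (hE.1 i hi).2]

/-- Absolute continuity passes to functions whose increments are dominated by the increments of an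
absolutely continuous matrix function. -/
lemma AbsolutelyContinuousOnInterval.of_abs_sub_le_l1 {α β : Type*} [Fintype α] [Fintype β]
    {M : ℝ → Matrix α β ℝ} {a b : ℝ}
    (hM : ∀ i j, AbsolutelyContinuousOnInterval (fun t => M t i j) a b) {g : ℝ → ℝ} {C : ℝ}
    (h : ∀ s ∈ Set.uIcc a b, ∀ t ∈ Set.uIcc a b, |g s - g t| ≤ C * (M s - M t).l1) :
    AbsolutelyContinuousOnInterval g a b := by
  have h0 : Tendsto (fun E : ℕ × (ℕ → ℝ × ℝ) => C * ∑ i, ∑ j, ∑ l ∈ Finset.range E.1,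
      dist (M (E.2 l).1 i j) (M (E.2 l).2 i j))
      (AbsolutelyContinuousOnInterval.totalLengthFilter ⊓
        𝓟 (AbsolutelyContinuousOnInterval.disjWithin a b)) (nhds 0) := by
    have := Tendsto.const_mul C (tendsto_finsetSum Finset.univ fun i _ =>
      tendsto_finsetSum Finset.univ fun j _ => hM i j)
    simpa using this
  refine squeeze_zero' (Eventually.of_forall fun E => Finset.sum_nonneg fun _ _ => dist_nonneg)
    ?_ h0
  filter_upwards [eventually_inf_principal.mpr (Eventually.of_forall fun E hE => hE)] with E hE
  have e : C * ∑ i, ∑ j, ∑ l ∈ Finset.range E.1, dist (M (E.2 l).1 i j) (M (E.2 l).2 i j)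
      = ∑ l ∈ Finset.range E.1, C * (M (E.2 l).1 - M (E.2 l).2).l1 := by
    rw [← Finset.mul_sum]
    simp only [Matrix.l1, Matrix.sub_apply, Real.dist_eq]
    rw [Finset.sum_comm (s := Finset.range E.1)]
    refine congrArg (C * ·) (Finset.sum_congr rfl fun i _ => ?_)
    exact Finset.sum_comm
  rw [e]
  exact Finset.sum_le_sum fun l hl => h _ (hE.1 l hl).1 _ (hE.1 l hl).2

namespace HasDrift

variable {α β γ : Type*} {T : ℝ}

lemma continuousOn_apply {f M : ℝ → Matrix α β ℝ} (hT : 0 ≤ T) (h : HasDrift T f M) (a : α)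
    (b : β) : ContinuousOn (fun t => M t a b) (Set.Icc 0 T) := by
  have := (h.ac a b).continuousOn
  rwa [Set.uIcc_of_le hT] at this

lemma congr {f g M N : ℝ → Matrix α β ℝ} (hT : 0 ≤ T) (h : HasDrift T f M)
    (hMN : Set.EqOn M N (Set.Icc 0 T)) (hfg : ∀ᵐ t : ℝ, t ∈ Set.Icc 0 T → f t = g t) :
    HasDrift T g N := by
  refine ⟨fun a b => (h.ac a b).congr_of_eqOn fun t ht => ?_, ?_⟩
  · rw [Set.uIcc_of_le hT] at ht
    simp only [hMN ht]
  · have h0 : ∀ᵐ t : ℝ, t ≠ 0 := by simp [ae_iff]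
    have h1 : ∀ᵐ t : ℝ, t ≠ T := by simp [ae_iff]
    filter_upwards [h.ae_hasDerivAt, hfg, h0, h1] with t hd he ht0 htT ht a b
    have hn : Set.Icc 0 T ∈ nhds t :=
      Icc_mem_nhds (lt_of_le_of_ne ht.1 (Ne.symm ht0)) (lt_of_le_of_ne ht.2 htT)
    rw [← he ht]
    refine (hd ht a b).congr_of_eventuallyEq ?_
    filter_upwards [hn] with s hs
    simp only [hMN hs]

lemma add {f g M N : ℝ → Matrix α β ℝ} (h : HasDrift T f M) (h' : HasDrift T g N) :
    HasDrift T (fun t => f t + g t) (fun t => M t + N t) := by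
  refine ⟨fun a b => (h.ac a b).add (h'.ac a b), ?_⟩
  filter_upwards [h.ae_hasDerivAt, h'.ae_hasDerivAt] with t h1 h2 ht a b
  simp only [Matrix.add_apply, neg_add]
  exact (h1 ht a b).add (h2 ht a b)

lemma neg {f M : ℝ → Matrix α β ℝ} (h : HasDrift T f M) :
    HasDrift T (fun t => -f t) (fun t => -M t) := by
  refine ⟨fun a b => (h.ac a b).neg, ?_⟩
  filter_upwards [h.ae_hasDerivAt] with t h1 ht a b
  simp only [Matrix.neg_apply]
  exact (h1 ht a b).neg

lemma sub {f g M N : ℝ → Matrix α β ℝ} (h : HasDrift T f M) (h' : HasDrift T g N) :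
    HasDrift T (fun t => f t - g t) (fun t => M t - N t) := by
  simpa only [sub_eq_add_neg] using h.add h'.neg

lemma transpose {f M : ℝ → Matrix α β ℝ} (h : HasDrift T f M) :
    HasDrift T (fun t => (f t)ᵀ) (fun t => (M t)ᵀ) :=
  ⟨fun a b => h.ac b a, by filter_upwards [h.ae_hasDerivAt] with t h1 ht a b using h1 ht b a⟩

lemma submatrix {α' β' : Type*} {f M : ℝ → Matrix α β ℝ} (h : HasDrift T f M) (i : α' → α)
    (j : β' → β) : HasDrift T (fun t => (f t).submatrix i j) (fun t => (M t).submatrix i j) :=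
  ⟨fun a b => h.ac (i a) (j b), by filter_upwards [h.ae_hasDerivAt] with t h1 ht a b using h1 ht (i a) (j b)⟩

lemma mul [Fintype β] {f M : ℝ → Matrix α β ℝ} {g N : ℝ → Matrix β γ ℝ} (h : HasDrift T f M)
    (h' : HasDrift T g N) :
    HasDrift T (fun t => f t * N t + M t * g t) (fun t => M t * N t) := by
  refine ⟨fun a b => ?_, ?_⟩
  · simp only [Matrix.mul_apply]
    have : ∀ s : Finset β, AbsolutelyContinuousOnInterval
        (fun t => ∑ j ∈ s, M t a j * N t j b) 0 T := by
      classical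
      intro s
      induction s using Finset.induction_on with
      | empty =>
        simp only [Finset.sum_empty]
        exact absolutelyContinuousOnInterval_const 0
      | insert i s hi ih =>
        simp only [Finset.sum_insert hi]
        exact ((h.ac a i).mul (h'.ac i b)).add ih
    exact this _
  · filter_upwards [h.ae_hasDerivAt, h'.ae_hasDerivAt] with t h1 h2 ht a b
    simp only [Matrix.mul_apply, Matrix.add_apply]
    have := HasDerivAt.fun_sum (u := Finset.univ) fun j _ => (h1 ht a j).mul (h2 ht j b)
    refine this.congr_deriv ?_
    rw [← Finset.sum_add_distrib, ← Finset.sum_neg_distrib]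
    refine Finset.sum_congr rfl fun j _ => ?_
    ring

lemma exists_l1_le [Fintype α] [Fintype β] {f M : ℝ → Matrix α β ℝ} (hT : 0 ≤ T) (h : HasDrift T f M) :
    ∃ C, ∀ t ∈ Set.Icc 0 T, (M t).l1 ≤ C := by
  have hc : ContinuousOn (fun t => (M t).l1) (Set.Icc 0 T) :=
    continuousOn_finsetSum _ fun a _ => continuousOn_finsetSum _ fun b _ =>
      (h.continuousOn_apply hT a b).abs
  obtain ⟨C, hC⟩ := isCompact_Icc.exists_bound_of_continuousOn hc
  exact ⟨C, fun t ht => (le_abs_self _).trans (hC t ht)⟩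

lemma inv [Fintype α] [DecidableEq α] {f M : ℝ → Matrix α α ℝ} (hT : 0 ≤ T) (h : HasDrift T f M)
    (hu : ∀ t ∈ Set.Icc 0 T, IsUnit (M t)) :
    HasDrift T (fun t => -((M t)⁻¹ * f t * (M t)⁻¹)) (fun t => (M t)⁻¹) := by
  have hd : ∀ t ∈ Set.Icc 0 T, IsUnit (M t).det := fun t ht =>
    (Matrix.isUnit_iff_isUnit_det _).mp (hu t ht)
  have hM : ContinuousOn M (Set.Icc 0 T) :=
    continuousOn_pi.2 fun a => continuousOn_pi.2 fun b => h.continuousOn_apply hT a b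
  have hc : ContinuousOn (fun t => (M t)⁻¹.l1) (Set.Icc 0 T) := by
    have hi : ContinuousOn (fun t => (M t)⁻¹) (Set.Icc 0 T) := fun t ht =>
      ContinuousAt.comp_continuousWithinAt (g := fun X : Matrix α α ℝ => X⁻¹)
        (continuousAt_matrix_inv _ (by
          rw [Ring.inverse_eq_inv']
          exact continuousAt_inv₀ (hd t ht).ne_zero)) (hM t ht)
    exact continuousOn_finsetSum _ fun a _ => continuousOn_finsetSum _ fun b _ =>
      ContinuousOn.abs (continuousOn_pi.1 (continuousOn_pi.1 hi a) b)
  obtain ⟨C, hC⟩ := isCompact_Icc.exists_bound_of_continuousOn hc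
  have hC' : ∀ t ∈ Set.Icc 0 T, (M t)⁻¹.l1 ≤ C := fun t ht => (le_abs_self _).trans (hC t ht)
  have hac : ∀ a b, AbsolutelyContinuousOnInterval (fun t => (M t)⁻¹ a b) 0 T := by
    intro a b
    refine AbsolutelyContinuousOnInterval.of_abs_sub_le_l1 h.ac (C := C * C) fun s hs t ht => ?_
    rw [Set.uIcc_of_le hT] at hs ht
    have e : (M s)⁻¹ - (M t)⁻¹ = -((M s)⁻¹ * (M s - M t) * (M t)⁻¹) := by
      rw [Matrix.mul_sub, Matrix.sub_mul, Matrix.nonsing_inv_mul _ (hd s hs), Matrix.one_mul,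
        Matrix.mul_assoc, Matrix.mul_nonsing_inv _ (hd t ht), Matrix.mul_one, neg_sub]
    have hC0 : 0 ≤ C := (Matrix.l1_nonneg _).trans (hC' s hs)
    calc |(M s)⁻¹ a b - (M t)⁻¹ a b| ≤ ((M s)⁻¹ - (M t)⁻¹).l1 :=
          Matrix.abs_apply_le_l1 ((M s)⁻¹ - (M t)⁻¹) a b
      _ ≤ (M s)⁻¹.l1 * (M s - M t).l1 * (M t)⁻¹.l1 := by
          rw [e, Matrix.l1_neg]
          exact (Matrix.l1_mul_le _ _).trans
            (mul_le_mul_of_nonneg_right (Matrix.l1_mul_le _ _) (Matrix.l1_nonneg _))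
      _ ≤ C * (M s - M t).l1 * C := by
          have hn := Matrix.l1_nonneg (M s - M t)
          exact mul_le_mul (mul_le_mul_of_nonneg_right (hC' s hs) hn) (hC' t ht)
            (Matrix.l1_nonneg _) (by positivity)
      _ = C * C * (M s - M t).l1 := by ring
  -- The derivative exists almost everywhere by absolute continuity; its value follows from
  -- `M M⁻¹ = 1`.
  let g : ℝ → Matrix α α ℝ := fun t => Matrix.of fun a b => -deriv (fun s => (M s)⁻¹ a b) t
  have hg : HasDrift T g (fun t => (M t)⁻¹) := by
    refine ⟨hac, ?_⟩
    have : ∀ᵐ t : ℝ, ∀ a b, t ∈ Set.uIcc 0 T → DifferentiableAt ℝ (fun s => (M s)⁻¹ a b) t :=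
      ae_all_iff.2 fun a => ae_all_iff.2 fun b => (hac a b).ae_differentiableAt
    filter_upwards [this] with t h1 ht a b
    rw [Set.uIcc_of_le hT] at h1
    simpa [g] using (h1 a b ht).hasDerivAt
  have hone : HasDrift T (fun t => f t * (M t)⁻¹ + M t * g t) (fun _ => (1 : Matrix α α ℝ)) :=
    (h.mul hg).congr hT (fun t ht => Matrix.mul_nonsing_inv _ (hd t ht))
      (Eventually.of_forall fun _ _ => rfl)
  refine hg.congr hT (fun _ _ => rfl) ?_
  filter_upwards [hone.ae_hasDerivAt] with t h1 ht
  have h0 : f t * (M t)⁻¹ + M t * g t = 0 := by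
    ext a b
    have := (h1 ht a b).unique (hasDerivAt_const t _)
    rwa [neg_eq_zero] at this
  have : (M t)⁻¹ * (f t * (M t)⁻¹ + M t * g t) = 0 := by rw [h0, Matrix.mul_zero]
  rw [Matrix.mul_add, Matrix.nonsing_inv_mul_cancel_left _ _ (hd t ht), ← Matrix.mul_assoc] at this
  exact eq_neg_of_add_eq_zero_right this

/-- The fundamental theorem of calculus: an absolutely continuous function solves the integrated
backward equation. -/
lemma isBackwardSolution {f M : ℝ → Matrix α β ℝ} {Θ : Matrix α β ℝ} (hT : 0 ≤ T)
    (h : HasDrift T f M) (hΘ : M T = Θ) : IsBackwardSolution T Θ f M := by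
  have hsub : ∀ {s : ℝ} {t : ℝ}, 0 ≤ t → t ≤ T → s ∈ Set.uIoc t T → s ∈ Set.Icc 0 T := by
    intro s t h0 h1 hs
    rw [Set.uIoc_of_le h1] at hs
    exact ⟨h0.trans hs.1.le, hs.2⟩
  have hint : ∀ a b, IntervalIntegrable (fun s => f s a b) volume 0 T := by
    intro a b
    refine ((h.ac a b).intervalIntegrable_deriv.neg).congr_ae ?_
    rw [EventuallyEq, ae_restrict_iff' measurableSet_uIoc]
    filter_upwards [h.ae_hasDerivAt] with s hs hs'
    simp [(hs (hsub le_rfl hT hs') a b).deriv]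
  refine ⟨continuousOn_pi.2 fun a => continuousOn_pi.2 fun b => h.continuousOn_apply hT a b, hint,
    fun t ht a b => ?_⟩
  have hac : AbsolutelyContinuousOnInterval (fun t => M t a b) t T := (h.ac a b).mono (by
    rw [Set.uIcc_of_le ht.2, Set.uIcc_of_le hT]
    exact Set.Icc_subset_Icc_left ht.1)
  have e : ∫ s in t..T, f s a b = -∫ s in t..T, deriv (fun s => M s a b) s := by
    rw [← intervalIntegral.integral_neg]
    refine intervalIntegral.integral_congr_ae ?_
    filter_upwards [h.ae_hasDerivAt] with s hs hs'
    simp [(hs (hsub ht.1 ht.2 hs') a b).deriv]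
  rw [e, hac.integral_deriv_eq_sub, hΘ]
  ring

end HasDrift

lemma IsBackwardSolution.hasDrift {α β : Type*} [Countable α] [Countable β] {T : ℝ}
    {Θ : Matrix α β ℝ} {f M : ℝ → Matrix α β ℝ} (hT : 0 ≤ T) (h : IsBackwardSolution T Θ f M) :
    HasDrift T f M := by
  obtain ⟨-, hint, heq⟩ := h
  have hTm : T ∈ Set.uIcc 0 T := Set.right_mem_uIcc
  -- The integrated right-hand side is absolutely continuous.
  let N : ℝ → Matrix α β ℝ := fun t => Matrix.of fun a b => Θ a b - ∫ s in T..t, f s a b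
  have hN : HasDrift T f N := by
    refine ⟨fun a b => ?_, ?_⟩
    · exact (absolutelyContinuousOnInterval_const (Θ a b)).sub
        ((hint a b).absolutelyContinuousOnInterval_intervalIntegral hTm)
    · have : ∀ᵐ t : ℝ, ∀ a b, t ∈ Set.uIcc 0 T → ∀ c ∈ Set.uIcc 0 T,
          HasDerivAt (fun x => ∫ s in c..x, f s a b) (f t a b) t :=
        ae_all_iff.2 fun a => ae_all_iff.2 fun b => (hint a b).ae_hasDerivAt_integral
      filter_upwards [this] with t h1 ht a b
      rw [← Set.uIcc_of_le hT] at ht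
      exact (h1 a b ht T hTm).const_sub (Θ a b)
  refine hN.congr hT (fun t ht => ?_) (Eventually.of_forall fun _ _ => rfl)
  ext a b
  rw [heq t ht a b, intervalIntegral.integral_symm]
  simp [N, sub_eq_add_neg]

/-! ### From the Riccati equation to the non-Riccati-type system -/

lemma isSymm_of_posDef {α : Type*} {M : Matrix α α ℝ} (h : M.PosDef) : M.IsSymm := by
  have := h.isHermitian
  rwa [Matrix.IsHermitian, Matrix.conjTranspose_eq_transpose_of_trivial] at this

lemma posDef_toBlocks₂₂ {n m : ℕ} {Pt : Matrix (Fin n ⊕ Fin m) (Fin n ⊕ Fin m) ℝ}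
    (h : Pt.PosDef) : Pt.toBlocks₂₂.PosDef :=
  h.submatrix Sum.inr_injective

/-- The triple `(P₁, P₂, P₃)` that comes from `P̃`. -/
def blockState {n m : ℕ} (Pt : Matrix (Fin n ⊕ Fin m) (Fin n ⊕ Fin m) ℝ) : FBState n m :=
  ⟨blockP1 Pt, blockP2 Pt, blockP3 Pt⟩

/-- Along an absolutely continuous family of symmetric matrices, the derivative of the block
transformation is the congruence by `stateMap`, up to signs. -/
lemma HasDrift.block {n m : ℕ} {T : ℝ} (hT : 0 ≤ T)
    {f Pt : ℝ → Matrix (Fin n ⊕ Fin m) (Fin n ⊕ Fin m) ℝ} (h : HasDrift T f Pt)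
    (hP : ∀ t ∈ Set.Icc 0 T, (Pt t).PosDef)
    (hf : ∀ᵐ t : ℝ, t ∈ Set.Icc 0 T → (f t).IsSymm)
    {E : ℝ → Matrix (Fin n ⊕ Fin m) (Fin n ⊕ Fin m) ℝ}
    (hE : ∀ t, E t = (FBLQData.stateMap (blockP2 (Pt t)) (blockP3 (Pt t)))ᵀ * f t
      * FBLQData.stateMap (blockP2 (Pt t)) (blockP3 (Pt t))) :
    HasDrift T (fun t => (E t).toBlocks₁₁) (fun t => blockP1 (Pt t)) ∧
    HasDrift T (fun t => -(E t).toBlocks₂₁) (fun t => blockP2 (Pt t)) ∧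
    HasDrift T (fun t => -(E t).toBlocks₂₂) (fun t => blockP3 (Pt t)) := by
  have h11 : HasDrift T (fun t => (f t).toBlocks₁₁) fun t => (Pt t).toBlocks₁₁ :=
    h.submatrix Sum.inl Sum.inl
  have h21 : HasDrift T (fun t => (f t).toBlocks₂₁) fun t => (Pt t).toBlocks₂₁ :=
    h.submatrix Sum.inr Sum.inl
  have h22 : HasDrift T (fun t => (f t).toBlocks₂₂) fun t => (Pt t).toBlocks₂₂ :=
    h.submatrix Sum.inr Sum.inr
  have h3 := h22.inv hT fun t ht => (posDef_toBlocks₂₂ (hP t ht)).isUnit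
  have h2 := (h3.mul h21).neg
  have h1 := h11.sub ((h21.transpose.mul h3).mul h21)
  -- The congruence in blocks.
  have hEb : ∀ᵐ t : ℝ, t ∈ Set.Icc 0 T →
      (E t).toBlocks₁₁ = (f t).toBlocks₁₁ + (f t).toBlocks₂₁ᵀ * blockP2 (Pt t)
        + (blockP2 (Pt t))ᵀ * (f t).toBlocks₂₁
        + (blockP2 (Pt t))ᵀ * ((f t).toBlocks₂₂ * blockP2 (Pt t)) ∧
      (E t).toBlocks₂₁ = blockP3 (Pt t) * (f t).toBlocks₂₁
        + blockP3 (Pt t) * ((f t).toBlocks₂₂ * blockP2 (Pt t)) ∧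
      (E t).toBlocks₂₂ = blockP3 (Pt t) * ((f t).toBlocks₂₂ * blockP3 (Pt t)) ∧
      (blockP2 (Pt t))ᵀ = -((Pt t).toBlocks₂₁ᵀ * blockP3 (Pt t)) := by
    filter_upwards [hf] with t hf ht
    have hf12 : (f t).toBlocks₁₂ = (f t).toBlocks₂₁ᵀ := by
      ext i j
      exact ((hf ht).apply (Sum.inl i) (Sum.inr j)).symm
    have hs := isSymm_of_posDef (hP t ht)
    have e : E t = fromBlocks 1 (blockP2 (Pt t))ᵀ 0 (blockP3 (Pt t))
        * fromBlocks (f t).toBlocks₁₁ (f t).toBlocks₂₁ᵀ (f t).toBlocks₂₁ (f t).toBlocks₂₂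
        * fromBlocks 1 0 (blockP2 (Pt t)) (blockP3 (Pt t)) := by
      rw [hE, ← hf12, Matrix.fromBlocks_toBlocks, FBLQData.stateMap, Matrix.fromBlocks_transpose,
        isSymm_blockP3 hs, Matrix.transpose_one, Matrix.transpose_zero]
    rw [Matrix.fromBlocks_multiply, Matrix.fromBlocks_multiply] at e
    rw [e, Matrix.toBlocks_fromBlocks₁₁, Matrix.toBlocks_fromBlocks₂₁,
      Matrix.toBlocks_fromBlocks₂₂]
    refine ⟨?_, ?_, ?_, ?_⟩
    · simp only [Matrix.one_mul, Matrix.mul_one, Matrix.add_mul, Matrix.mul_assoc]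
      abel
    · simp only [Matrix.zero_mul, Matrix.mul_one, Matrix.mul_assoc, zero_add]
    · simp only [Matrix.zero_mul, Matrix.mul_zero, Matrix.mul_assoc, zero_add]
    · rw [blockP2, Matrix.transpose_neg, Matrix.transpose_mul]
      congr 2
      exact isSymm_blockP3 hs
  refine ⟨h1.congr hT (fun _ _ => rfl) ?_, h2.congr hT (fun _ _ => rfl) ?_,
    h3.congr hT (fun _ _ => rfl) ?_⟩
  · filter_upwards [hEb] with t ht ht'
    obtain ⟨e, -, -, e2⟩ := ht ht'
    rw [e, e2]
    simp only [blockP2, blockP3, Matrix.add_mul, Matrix.mul_neg, Matrix.neg_mul,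
      Matrix.mul_assoc, neg_neg]
    abel
  · filter_upwards [hEb] with t ht ht'
    obtain ⟨-, e, -, -⟩ := ht ht'
    rw [e]
    simp only [blockP2, blockP3, Matrix.mul_neg, Matrix.neg_mul, Matrix.mul_assoc]
    abel
  · filter_upwards [hEb] with t ht ht'
    obtain ⟨-, -, e, -⟩ := ht ht'
    rw [e]
    simp only [blockP3, Matrix.mul_assoc]

namespace FBLQData

variable {n m k : ℕ} (S : FBLQData n m k)

lemma block_riccatiTerminal {i : ℕ} (hi : 1 ≤ i) :
    blockP1 (S.riccatiTerminal i) = S.G ∧ blockP2 (S.riccatiTerminal i) = S.F ∧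
      blockP3 (S.riccatiTerminal i) = ((i : ℝ)⁻¹) • (1 : Matrix (Fin m) (Fin m) ℝ) := by
  have hi0 : (i : ℝ) ≠ 0 := by positivity
  have hinv : ((i : ℝ) • (1 : Matrix (Fin m) (Fin m) ℝ))⁻¹ = ((i : ℝ)⁻¹) • 1 := by
    refine Matrix.inv_eq_right_inv ?_
    rw [Matrix.smul_mul, Matrix.one_mul, smul_smul, mul_inv_cancel₀ hi0, one_smul]
  refine ⟨?_, ?_, ?_⟩ <;>
  simp [blockP1, blockP2, blockP3, riccatiTerminal, hinv, smul_smul, hi0]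

/-- The triple obtained from a solution of the auxiliary Riccati equation solves the
non-Riccati-type system, up to the terminal value `P₃(T) = i⁻¹ I`. -/
lemma IsRiccatiSolution.system {S : FBLQData n m k} {T : ℝ} (hT : 0 ≤ T) (hb : S.Bounded T) {i : ℕ}
    (hi : 1 ≤ i) {Pt : ℝ → Matrix (Fin n ⊕ Fin m) (Fin n ⊕ Fin m) ℝ}
    (h : S.IsRiccatiSolution T i Pt)
    (hL : ∀ᵐ t ∂(volume.restrict (Set.Icc 0 T)),
      IsUnit (S.L1of (Pt t) t) ∧ IsUnit (S.L2of (Pt t) t) ∧ IsUnit (S.L5of (Pt t) t)) :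
    IsBackwardSolution T S.G
      (fun t => S.drift1 (blockP1 (Pt t)) (blockP2 (Pt t)) (blockP3 (Pt t)) t)
      (fun t => blockP1 (Pt t)) ∧
    IsBackwardSolution T S.F
      (fun t => S.drift2 (blockP1 (Pt t)) (blockP2 (Pt t)) (blockP3 (Pt t)) t)
      (fun t => blockP2 (Pt t)) ∧
    IsBackwardSolution T (((i : ℝ)⁻¹) • (1 : Matrix (Fin m) (Fin m) ℝ))
      (fun t => S.drift3 (blockP1 (Pt t)) (blockP2 (Pt t)) (blockP3 (Pt t)) t)
      (fun t => blockP3 (Pt t)) := by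
  have hTm : T ∈ Set.Icc 0 T := ⟨hT, le_rfl⟩
  have hterm : Pt T = S.riccatiTerminal i := by
    ext a b
    rw [h.equation.2.2 T hTm a b, intervalIntegral.integral_same, add_zero]
  obtain ⟨t1, t2, t3⟩ := S.block_riccatiTerminal hi
  have hsymm : ∀ᵐ t : ℝ, t ∈ Set.Icc 0 T → (S.riccatiDrift (Pt t) t).IsSymm := by
    rw [← ae_restrict_iff' measurableSet_Icc]
    filter_upwards [hb.symm_A4, hb.symm_B4, hb.symm_C4, hb.symm_D4,
      ae_restrict_mem measurableSet_Icc] with t hA hB hC hD ht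
    have hs := isSymm_of_posDef (h.posDef t ht)
    exact S.isSymm_riccatiDrift hs hA hB (S.isSymm_M1 hs hC hD)
  obtain ⟨d1, d2, d3⟩ := (h.equation.hasDrift hT).block hT h.posDef hsymm (fun _ => rfl)
  have key := (ae_restrict_iff' measurableSet_Icc).mp (hL.and h.constraint)
  have alg := fun t (ht : t ∈ Set.Icc 0 T) (hM : (S.M1 (Pt t) t).PosDef) =>
    S.stateMap_congr_riccatiDrift (isSymm_of_posDef (h.posDef t ht))
      (posDef_toBlocks₂₂ (h.posDef t ht)).isUnit hM.isUnit
  refine ⟨(d1.congr hT (fun _ _ => rfl) ?_).isBackwardSolution hT (by rw [hterm, t1]),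
    (d2.congr hT (fun _ _ => rfl) ?_).isBackwardSolution hT (by rw [hterm, t2]),
    (d3.congr hT (fun _ _ => rfl) ?_).isBackwardSolution hT (by rw [hterm, t3])⟩
  · filter_upwards [key] with t hk ht
    obtain ⟨⟨u1, u2, u5⟩, hM⟩ := hk ht
    exact (alg t ht hM u1 u2 u5).1.symm
  · filter_upwards [key] with t hk ht
    obtain ⟨⟨u1, u2, u5⟩, hM⟩ := hk ht
    exact (alg t ht hM u1 u2 u5).2.1.symm
  · filter_upwards [key] with t hk ht
    obtain ⟨⟨u1, u2, u5⟩, hM⟩ := hk ht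
    exact (alg t ht hM u1 u2 u5).2.2.symm

end FBLQData

/-! ### Positivity of solutions of a backward Lyapunov inequality -/

namespace IsBackwardSolution

variable {α β : Type*} {T : ℝ} {Θ : Matrix α β ℝ} {f M : ℝ → Matrix α β ℝ}

lemma intervalIntegrable (h : IsBackwardSolution T Θ f M) {t s : ℝ} (ht : t ∈ Set.Icc 0 T)
    (hs : s ∈ Set.Icc 0 T) (a : α) (b : β) :
    IntervalIntegrable (fun r => f r a b) volume t s := by
  refine (h.2.1 a b).mono_set ?_
  rw [Set.uIcc_of_le (ht.1.trans ht.2)]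
  exact Set.uIcc_subset_Icc ht hs

lemma apply_eq (h : IsBackwardSolution T Θ f M) {t s : ℝ} (ht : t ∈ Set.Icc 0 T)
    (hs : s ∈ Set.Icc 0 T) (a : α) (b : β) :
    M t a b = M s a b + ∫ r in t..s, f r a b := by
  have hTm : T ∈ Set.Icc 0 T := ⟨ht.1.trans ht.2, le_rfl⟩
  rw [h.2.2 t ht a b, h.2.2 s hs a b,
    ← intervalIntegral.integral_add_adjacent_intervals (h.intervalIntegrable ht hs a b)
      (h.intervalIntegrable hs hTm a b)]
  ring

lemma continuousOn_apply (h : IsBackwardSolution T Θ f M) (a : α) (b : β) :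
    ContinuousOn (fun t => M t a b) (Set.Icc 0 T) :=
  continuousOn_pi.1 (continuousOn_pi.1 h.1 a) b

lemma sub {Θ' : Matrix α β ℝ} {f' M' : ℝ → Matrix α β ℝ} (h : IsBackwardSolution T Θ f M)
    (h' : IsBackwardSolution T Θ' f' M') :
    IsBackwardSolution T (Θ - Θ') (fun t => f t - f' t) (fun t => M t - M' t) := by
  refine ⟨h.1.sub h'.1, fun a b => (h.2.1 a b).sub (h'.2.1 a b), fun t ht a b => ?_⟩
  have hTm : T ∈ Set.Icc 0 T := ⟨ht.1.trans ht.2, le_rfl⟩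
  simp only [Matrix.sub_apply]
  rw [intervalIntegral.integral_sub (h.intervalIntegrable ht hTm a b)
    (h'.intervalIntegrable ht hTm a b), h.2.2 t ht, h'.2.2 t ht]
  ring

end IsBackwardSolution

section Quadratic

variable {α : Type*} [Fintype α]

lemma dotProduct_mulVec_eq_sum (v : α → ℝ) (M : Matrix α α ℝ) :
    v ⬝ᵥ M *ᵥ v = ∑ a, ∑ b, v a * v b * M a b := by
  simp only [dotProduct, Matrix.mulVec, Finset.mul_sum]
  exact Finset.sum_congr rfl fun a _ => Finset.sum_congr rfl fun b _ => by ring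

lemma IsBackwardSolution.quadratic {T : ℝ} {Θ : Matrix α α ℝ} {f M : ℝ → Matrix α α ℝ}
    (h : IsBackwardSolution T Θ f M) {t s : ℝ} (ht : t ∈ Set.Icc 0 T) (hs : s ∈ Set.Icc 0 T)
    (v : α → ℝ) :
    IntervalIntegrable (fun r => v ⬝ᵥ f r *ᵥ v) volume t s ∧
    v ⬝ᵥ M t *ᵥ v = v ⬝ᵥ M s *ᵥ v + ∫ r in t..s, v ⬝ᵥ f r *ᵥ v := by
  have hi : ∀ a b, IntervalIntegrable (fun r => v a * v b * f r a b) volume t s :=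
    fun a b => (h.intervalIntegrable ht hs a b).const_mul _
  simp only [dotProduct_mulVec_eq_sum]
  have hi' : ∀ a, IntervalIntegrable (fun r => ∑ b, v a * v b * f r a b) volume t s := fun a => by
    simpa only [Finset.sum_fn] using IntervalIntegrable.sum Finset.univ fun b _ => hi a b
  refine ⟨by
    simpa only [Finset.sum_fn] using IntervalIntegrable.sum Finset.univ fun a _ => hi' a, ?_⟩
  rw [intervalIntegral.integral_finsetSum fun a _ => hi' a, ← Finset.sum_add_distrib]
  refine Finset.sum_congr rfl fun a _ => ?_
  rw [intervalIntegral.integral_finsetSum fun b _ => hi a b, ← Finset.sum_add_distrib]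
  refine Finset.sum_congr rfl fun b _ => ?_
  rw [intervalIntegral.integral_const_mul, h.apply_eq ht hs a b]
  ring

lemma posSemidef_of_forall_unit {M : Matrix α α ℝ} (hM : M.IsSymm)
    (h : ∀ v : α → ℝ, v ⬝ᵥ v = 1 → 0 ≤ v ⬝ᵥ M *ᵥ v) : M.PosSemidef := by
  rw [Matrix.posSemidef_iff_dotProduct_mulVec]
  refine ⟨by rwa [Matrix.IsHermitian, Matrix.conjTranspose_eq_transpose_of_trivial], fun v => ?_⟩
  rw [star_trivial]
  rcases (dotProduct_self_star_nonneg v).eq_or_lt with h0 | h0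
  · rw [star_trivial, eq_comm, dotProduct_self_eq_zero] at h0
    simp [h0]
  · rw [star_trivial] at h0
    have hs : √(v ⬝ᵥ v) * √(v ⬝ᵥ v) = v ⬝ᵥ v := Real.mul_self_sqrt h0.le
    have hs0 : 0 < √(v ⬝ᵥ v) := Real.sqrt_pos.mpr h0
    have := h ((√(v ⬝ᵥ v))⁻¹ • v) (by
      rw [smul_dotProduct, dotProduct_smul, smul_eq_mul, smul_eq_mul, ← mul_assoc, ← mul_inv, hs,
        inv_mul_cancel₀ h0.ne'])
    rw [Matrix.mulVec_smul, smul_dotProduct, dotProduct_smul, smul_eq_mul, smul_eq_mul,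
      ← mul_assoc] at this
    exact nonneg_of_mul_nonneg_right this (by positivity)

lemma abs_mulVec_apply_le {A : Matrix α α ℝ} {v : α → ℝ} (hv : ∀ b, |v b| ≤ 1) (a : α) :
    |(A *ᵥ v) a| ≤ ∑ b, |A a b| := by
  refine (Finset.abs_sum_le_sum_abs _ _).trans (Finset.sum_le_sum fun b _ => ?_)
  rw [abs_mul]
  exact mul_le_of_le_one_right (abs_nonneg _) (hv b)

lemma abs_mulVec_dotProduct_le {A : Matrix α α ℝ} {v w : α → ℝ} {δ : ℝ} (hv : ∀ b, |v b| ≤ 1)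
    (hw : ∀ a, |w a| ≤ δ) : |(A *ᵥ v) ⬝ᵥ w| ≤ A.l1 * δ := by
  rw [Matrix.l1, Finset.sum_mul]
  refine (Finset.abs_sum_le_sum_abs _ _).trans (Finset.sum_le_sum fun a _ => ?_)
  rw [abs_mul]
  exact mul_le_mul (abs_mulVec_apply_le hv a) (hw a) (abs_nonneg _)
    (Finset.sum_nonneg fun _ _ => abs_nonneg _)

lemma abs_apply_le_one_of_dotProduct_self {v : α → ℝ} (hv : v ⬝ᵥ v = 1) (a : α) : |v a| ≤ 1 := by
  rw [abs_le_one_iff_mul_self_le_one, ← hv]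
  exact Finset.single_le_sum (f := fun a => v a * v a) (fun _ _ => mul_self_nonneg _)
    (Finset.mem_univ a)

lemma isCompact_unit_dotProduct : IsCompact {v : α → ℝ | v ⬝ᵥ v = 1} := by
  have hc : IsClosed {v : α → ℝ | v ⬝ᵥ v = 1} :=
    isClosed_eq (continuous_id.dotProduct continuous_id) continuous_const
  refine (isCompact_univ_pi fun _ : α => isCompact_Icc (a := (-1 : ℝ)) (b := 1)).of_isClosed_subset
    hc fun v hv a _ => ?_
  exact abs_le.mp (abs_apply_le_one_of_dotProduct_self hv a)

/-- The strict version of the positivity statement, for the perturbation of `Δ` by a fast growing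
multiple of the identity. At the last time where the perturbed form fails to be positive it is
still semidefinite, so that a null vector lies in its kernel; the inequality then forces the form
to be positive there. -/
lemma perturbed_pos_of_lyapunov [DecidableEq α] {T : ℝ} {Θ : Matrix α α ℝ}
    {f Δ A C : ℝ → Matrix α α ℝ} (h : IsBackwardSolution T Θ f Δ)
    (hs : ∀ t ∈ Set.Icc 0 T, (Δ t).IsSymm) (hΘ : Θ.PosSemidef) {c : ℝ} (hc : 0 ≤ c)
    (hA : ∀ᵐ t : ℝ, t ∈ Set.Icc 0 T → (A t).l1 ≤ c) (hC : ∀ᵐ t : ℝ, t ∈ Set.Icc 0 T → (C t).l1 ≤ c)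
    (hf : ∀ᵐ t : ℝ, t ∈ Set.Icc 0 T →
      (f t - (Δ t * A t + (A t)ᵀ * Δ t + (C t)ᵀ * Δ t * C t)).PosSemidef)
    {ε : ℝ} (hε : 0 < ε) {t : ℝ} (ht : t ∈ Set.Icc 0 T) {v : α → ℝ} (hv : v ⬝ᵥ v = 1) :
    0 < v ⬝ᵥ Δ t *ᵥ v + ε * Real.exp ((2 * c + c * c + 1) * (T - t)) := by
  -- The growth rate absorbs `2 vᵀ A v` and `|C v|²`, which are at most `2 c` and `c²`.
  set l : ℝ := 2 * c + c * c + 1 with hl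
  have hl0 : 0 < l := by positivity
  set e : ℝ → ℝ := fun t => ε * Real.exp (l * (T - t)) with he
  have he0 : ∀ t, 0 < e t := fun t => by positivity
  have heε : ∀ t ≤ T, ε ≤ e t := fun t ht => by
    refine le_mul_of_one_le_right hε.le (Real.one_le_exp ?_)
    exact mul_nonneg hl0.le (by linarith)
  have hec : Continuous e := by fun_prop
  have hder : ∀ t, HasDerivAt e (-(l * e t)) t := fun t => by
    have h1 : HasDerivAt (fun t : ℝ => l * (T - t)) (l * (-1)) t :=
      ((hasDerivAt_id t).const_sub T).const_mul l
    refine (h1.exp.const_mul ε).congr_deriv ?_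
    simp only [he]
    ring
  -- The perturbed form, as a function of time and direction.
  set g : ℝ × (α → ℝ) → ℝ := fun p => p.2 ⬝ᵥ Δ p.1 *ᵥ p.2 + e p.1 with hg
  change 0 < g (t, v)
  by_contra hneg
  set X : Set (ℝ × (α → ℝ)) := Set.Icc 0 T ×ˢ {v : α → ℝ | v ⬝ᵥ v = 1} with hX
  have hXc : IsCompact X := isCompact_Icc.prod isCompact_unit_dotProduct
  have hentry : ∀ a b, ContinuousOn (fun p : ℝ × (α → ℝ) => Δ p.1 a b) X := fun a b =>
    (h.continuousOn_apply a b).comp continuousOn_fst fun p hp => hp.1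
  have hgc : ContinuousOn g X := by
    simp only [hg, dotProduct_mulVec_eq_sum]
    refine ContinuousOn.add ?_ (hec.comp continuous_fst).continuousOn
    refine continuousOn_finsetSum _ fun a _ => continuousOn_finsetSum _ fun b _ =>
      ContinuousOn.mul ?_ (hentry a b)
    fun_prop
  have hKc : IsCompact (X ∩ g ⁻¹' Set.Iic 0) :=
    hXc.of_isClosed_subset (hgc.preimage_isClosed_of_isClosed hXc.isClosed isClosed_Iic)
      Set.inter_subset_left
  obtain ⟨⟨t₀, v₀⟩, ⟨⟨ht₀, hv₀⟩, hg₀⟩, hmax⟩ :=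
    hKc.exists_isMaxOn ⟨(t, v), ⟨ht, hv⟩, not_lt.mp hneg⟩ continuous_fst.continuousOn
  simp only [Set.mem_ofPred_eq] at hv₀
  have hTm : T ∈ Set.Icc 0 T := ⟨ht₀.1.trans ht₀.2, le_rfl⟩
  have hpos : ∀ s, t₀ < s → s ≤ T → ∀ w : α → ℝ, w ⬝ᵥ w = 1 → 0 < g (s, w) := by
    intro s h1 h2 w hw
    by_contra hn
    have := hmax (show (s, w) ∈ X ∩ g ⁻¹' Set.Iic 0 from
      ⟨⟨⟨ht₀.1.trans h1.le, h2⟩, hw⟩, not_lt.mp hn⟩)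
    exact absurd h1 (not_lt.mpr this)
  have hlt : t₀ < T := by
    refine lt_of_le_of_ne ht₀.2 fun hT => ?_
    have hΔT : Δ T = Θ := by
      ext a b
      rw [h.2.2 T hTm a b, intervalIntegral.integral_same, add_zero]
    have h1 := (Matrix.posSemidef_iff_dotProduct_mulVec.mp hΘ).2 v₀
    rw [star_trivial] at h1
    have h2 : v₀ ⬝ᵥ Δ t₀ *ᵥ v₀ + e t₀ ≤ 0 := hg₀
    rw [hT, hΔT] at h2
    linarith [he0 T]
  -- The perturbed matrix is positive semidefinite after `t₀`, hence at `t₀`.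
  have hqe : ∀ s (w : α → ℝ), w ⬝ᵥ (Δ s + e s • (1 : Matrix α α ℝ)) *ᵥ w
      = w ⬝ᵥ Δ s *ᵥ w + e s * (w ⬝ᵥ w) := by
    intro s w
    rw [Matrix.add_mulVec, Matrix.smul_mulVec, Matrix.one_mulVec, dotProduct_add, dotProduct_smul,
      smul_eq_mul]
  have hsymm : ∀ s ∈ Set.Icc 0 T, (Δ s + e s • (1 : Matrix α α ℝ)).IsSymm := fun s hs' =>
    (hs s hs').add (Matrix.isSymm_one.smul _)
  have hpsd : ∀ s, t₀ < s → s ≤ T → (Δ s + e s • (1 : Matrix α α ℝ)).PosSemidef := by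
    intro s h1 h2
    refine posSemidef_of_forall_unit (hsymm s ⟨ht₀.1.trans h1.le, h2⟩) fun w hw => ?_
    rw [hqe, hw, mul_one]
    exact (hpos s h1 h2 w hw).le
  have hpsd₀ : (Δ t₀ + e t₀ • (1 : Matrix α α ℝ)).PosSemidef := by
    refine posSemidef_of_forall_unit (hsymm t₀ ht₀) fun w hw => ?_
    rw [hqe, hw, mul_one]
    have hcont : ContinuousWithinAt (fun s => g (s, w)) (Set.Ioc t₀ T) t₀ := by
      have : ContinuousOn (fun s => g (s, w)) (Set.Icc 0 T) :=
        hgc.comp (by fun_prop) fun s hs => ⟨hs, hw⟩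
      exact (this t₀ ht₀).mono fun s hs => ⟨ht₀.1.trans hs.1.le, hs.2⟩
    have : (nhdsWithin t₀ (Set.Ioc t₀ T)).NeBot := by
      rw [← mem_closure_iff_nhdsWithin_neBot, closure_Ioc hlt.ne]
      exact ⟨le_rfl, hlt.le⟩
    refine ge_of_tendsto hcont ?_
    filter_upwards [self_mem_nhdsWithin] with s hs
    exact (hpos s hs.1 hs.2 w hw).le
  have hker : (Δ t₀ + e t₀ • (1 : Matrix α α ℝ)) *ᵥ v₀ = 0 := by
    rw [← hpsd₀.dotProduct_mulVec_zero_iff, star_trivial]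
    refine le_antisymm ?_ ?_
    · rw [hqe, hv₀, mul_one]
      exact hg₀
    · have := (Matrix.posSemidef_iff_dotProduct_mulVec.mp hpsd₀).2 v₀
      rwa [star_trivial] at this
  -- By continuity the image of `v₀` stays small shortly after `t₀`.
  set δ : ℝ := ε / (2 * (c + 1)) with hδ
  have hδ0 : 0 < δ := by positivity
  have hsmall : ∀ᶠ s in nhdsWithin t₀ (Set.Icc 0 T),
      ∀ a, |((Δ s + e s • (1 : Matrix α α ℝ)) *ᵥ v₀) a| < δ := by
    refine eventually_all.mpr fun a => ?_
    have hca : ContinuousOn (fun s => |((Δ s + e s • (1 : Matrix α α ℝ)) *ᵥ v₀) a|)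
        (Set.Icc 0 T) := by
      refine ContinuousOn.abs ?_
      simp only [Matrix.mulVec, dotProduct, Matrix.add_apply, Matrix.smul_apply]
      refine continuousOn_finsetSum _ fun b _ => ContinuousOn.mul ?_ continuousOn_const
      exact (h.continuousOn_apply a b).add (hec.continuousOn.smul continuousOn_const)
    refine (hca t₀ ht₀).eventually (gt_mem_nhds ?_)
    simpa [hker] using hδ0
  obtain ⟨η, hη, hball⟩ := Metric.mem_nhdsWithin_iff.mp hsmall
  set s₁ : ℝ := min (t₀ + η / 2) T with hs₁
  have h01 : t₀ < s₁ := lt_min (by linarith) hlt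
  have hs₁m : s₁ ∈ Set.Icc 0 T := ⟨ht₀.1.trans h01.le, min_le_right _ _⟩
  obtain ⟨hint, hquad⟩ := h.quadratic ht₀ hs₁m v₀
  have heint : IntervalIntegrable (fun r => l * e r) volume t₀ s₁ :=
    (continuous_const.mul hec).intervalIntegrable _ _
  have heq : e t₀ = e s₁ + ∫ r in t₀..s₁, l * e r := by
    have := intervalIntegral.integral_eq_sub_of_hasDerivAt (fun r _ => hder r) heint.neg
    simp only [intervalIntegral.integral_neg] at this
    linarith
  have hnn : 0 ≤ ∫ r in t₀..s₁, (v₀ ⬝ᵥ f r *ᵥ v₀ + l * e r) := by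
    refine intervalIntegral.integral_nonneg_of_ae_restrict h01.le ?_
    rw [EventuallyLE, ae_restrict_iff' measurableSet_Icc]
    have hne : ∀ᵐ r : ℝ, r ≠ t₀ := by simp [ae_iff]
    filter_upwards [hA, hC, hf, hne] with r hA hC hf hne hr
    have hrm : r ∈ Set.Icc 0 T := ⟨ht₀.1.trans hr.1, hr.2.trans hs₁m.2⟩
    have hrt : t₀ < r := lt_of_le_of_ne hr.1 (Ne.symm hne)
    have hw : ∀ a, |((Δ r + e r • (1 : Matrix α α ℝ)) *ᵥ v₀) a| ≤ δ := fun a => by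
      refine (hball (a := r) ⟨?_, hrm⟩ a).le
      rw [Metric.mem_ball, Real.dist_eq, abs_of_pos (by linarith)]
      have := hr.2.trans (min_le_left _ _)
      linarith
    have hv1 := abs_apply_le_one_of_dotProduct_self hv₀
    have hfr := (Matrix.posSemidef_iff_dotProduct_mulVec.mp (hf hrm)).2 v₀
    have hCC := (Matrix.posSemidef_iff_dotProduct_mulVec.mp (hpsd r hrt hrm.2)).2 (C r *ᵥ v₀)
    rw [star_trivial] at hfr hCC
    rw [hqe] at hCC
    have b1 : |(A r *ᵥ v₀) ⬝ᵥ ((Δ r + e r • (1 : Matrix α α ℝ)) *ᵥ v₀)| ≤ c * δ :=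
      (abs_mulVec_dotProduct_le hv1 hw).trans (mul_le_mul_of_nonneg_right (hA hrm) hδ0.le)
    have b2 : |(A r *ᵥ v₀) ⬝ᵥ v₀| ≤ c :=
      (abs_mulVec_dotProduct_le hv1 hv1).trans (by rw [mul_one]; exact hA hrm)
    have b3 : |(C r *ᵥ v₀) ⬝ᵥ (C r *ᵥ v₀)| ≤ c * c := by
      refine (abs_mulVec_dotProduct_le (δ := c) hv1 fun a => ?_).trans
        (mul_le_mul_of_nonneg_right (hC hrm) hc)
      refine (abs_mulVec_apply_le hv1 a).trans ((hC hrm).trans' ?_)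
      exact Finset.single_le_sum (f := fun a => ∑ b, |C r a b|)
        (fun _ _ => Finset.sum_nonneg fun _ _ => abs_nonneg _) (Finset.mem_univ a)
    have e1 : v₀ ⬝ᵥ (Δ r * A r) *ᵥ v₀ = (A r *ᵥ v₀) ⬝ᵥ (Δ r *ᵥ v₀) := by
      rw [← Matrix.mulVec_mulVec, Matrix.dotProduct_mulVec, ← Matrix.mulVec_transpose,
        (hs r hrm).eq, dotProduct_comm]
    have e2 : v₀ ⬝ᵥ ((A r)ᵀ * Δ r) *ᵥ v₀ = (A r *ᵥ v₀) ⬝ᵥ (Δ r *ᵥ v₀) := by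
      rw [← Matrix.mulVec_mulVec, Matrix.dotProduct_mulVec, Matrix.vecMul_transpose]
    have e3 : v₀ ⬝ᵥ ((C r)ᵀ * Δ r * C r) *ᵥ v₀ = (C r *ᵥ v₀) ⬝ᵥ (Δ r *ᵥ (C r *ᵥ v₀)) := by
      rw [← Matrix.mulVec_mulVec, ← Matrix.mulVec_mulVec, Matrix.dotProduct_mulVec,
        Matrix.vecMul_transpose]
    have e4 : (A r *ᵥ v₀) ⬝ᵥ ((Δ r + e r • (1 : Matrix α α ℝ)) *ᵥ v₀)
        = (A r *ᵥ v₀) ⬝ᵥ (Δ r *ᵥ v₀) + e r * ((A r *ᵥ v₀) ⬝ᵥ v₀) := by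
      rw [Matrix.add_mulVec, Matrix.smul_mulVec, Matrix.one_mulVec, dotProduct_add,
        dotProduct_smul, smul_eq_mul]
    rw [Matrix.sub_mulVec, Matrix.add_mulVec, Matrix.add_mulVec, dotProduct_sub, dotProduct_add,
      dotProduct_add, e1, e2, e3] at hfr
    rw [e4] at b1
    have her := he0 r
    have m2 := mul_le_mul_of_nonneg_left (le_of_abs_le b2) her.le
    have m3 := mul_le_mul_of_nonneg_left (le_of_abs_le b3) her.le
    have m1 := neg_le_of_abs_le b1
    have hcδ : c * δ ≤ ε / 2 := by
      rw [hδ, mul_div_assoc', div_le_div_iff₀ (by positivity) two_pos]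
      nlinarith
    have := heε r hrm.2
    simp only [Pi.zero_apply]
    have hle : l * e r = 2 * (e r * c) + e r * (c * c) + e r := by rw [hl]; ring
    linarith
  rw [intervalIntegral.integral_add hint heint] at hnn
  have h1 : v₀ ⬝ᵥ Δ t₀ *ᵥ v₀ + e t₀ ≤ 0 := hg₀
  have h2 : 0 < v₀ ⬝ᵥ Δ s₁ *ᵥ v₀ + e s₁ := hpos s₁ h01 hs₁m.2 v₀ hv₀
  linarith

/-- A solution of a backward Lyapunov inequality with positive semidefinite terminal value is
positive semidefinite. -/
lemma posSemidef_of_lyapunov [DecidableEq α] {T : ℝ} {Θ : Matrix α α ℝ}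
    {f Δ A C : ℝ → Matrix α α ℝ} (h : IsBackwardSolution T Θ f Δ)
    (hs : ∀ t ∈ Set.Icc 0 T, (Δ t).IsSymm) (hΘ : Θ.PosSemidef) {c : ℝ} (hc : 0 ≤ c)
    (hA : ∀ᵐ t : ℝ, t ∈ Set.Icc 0 T → (A t).l1 ≤ c) (hC : ∀ᵐ t : ℝ, t ∈ Set.Icc 0 T → (C t).l1 ≤ c)
    (hf : ∀ᵐ t : ℝ, t ∈ Set.Icc 0 T →
      (f t - (Δ t * A t + (A t)ᵀ * Δ t + (C t)ᵀ * Δ t * C t)).PosSemidef) :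
    ∀ t ∈ Set.Icc 0 T, (Δ t).PosSemidef := by
  intro t ht
  refine posSemidef_of_forall_unit (hs t ht) fun v hv => ?_
  have hlim : Tendsto (fun ε : ℝ => v ⬝ᵥ Δ t *ᵥ v
      + ε * Real.exp ((2 * c + c * c + 1) * (T - t))) (nhdsWithin 0 (Set.Ioi 0))
      (nhds (v ⬝ᵥ Δ t *ᵥ v + 0 * Real.exp ((2 * c + c * c + 1) * (T - t)))) :=
    ((continuous_const.add (continuous_id.mul continuous_const)).tendsto 0).mono_left
      nhdsWithin_le_nhds
  rw [zero_mul, add_zero] at hlim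
  refine ge_of_tendsto hlim ?_
  filter_upwards [self_mem_nhdsWithin] with ε hε
  exact (perturbed_pos_of_lyapunov h hs hΘ hc hA hC hf hε ht hv).le

end Quadratic


/-! ### Comparison of the auxiliary Riccati equations -/

/-- Essential boundedness on `[0, T]` in the entrywise norm, without measurability. -/
def EssBounded {α β : Type*} [Fintype α] [Fintype β] (T : ℝ) (M : ℝ → Matrix α β ℝ) : Prop :=
  ∃ c : ℝ, 0 ≤ c ∧ ∀ᵐ t : ℝ, t ∈ Set.Icc 0 T → (M t).l1 ≤ c

lemma MemLinfty.essBounded {α β : Type*} [Fintype α] [Fintype β] {T : ℝ}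
    {M : ℝ → Matrix α β ℝ} (h : MemLinfty T M) : EssBounded T M := by
  have h1 : ∀ a b, ∃ c : ℝ, ∀ᵐ t ∂(volume.restrict (Set.Icc 0 T)), |M t a b| ≤ c := by
    intro a b
    have hb := (h a b).eLpNorm_lt_top
    rw [eLpNorm_exponent_top] at hb
    refine ⟨(eLpNormEssSup (fun t => M t a b) (volume.restrict (Set.Icc 0 T))).toReal, ?_⟩
    filter_upwards [ae_le_eLpNormEssSup (f := fun t => M t a b)
      (μ := volume.restrict (Set.Icc 0 T))] with t ht
    rw [← Real.norm_eq_abs, ← toReal_enorm]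
    exact ENNReal.toReal_mono hb.ne ht
  choose c hc using h1
  refine ⟨∑ a, ∑ b, |c a b|, Finset.sum_nonneg fun _ _ => Finset.sum_nonneg fun _ _ =>
    abs_nonneg _, ?_⟩
  rw [← ae_restrict_iff' measurableSet_Icc]
  filter_upwards [ae_all_iff.2 fun a => ae_all_iff.2 fun b => hc a b] with t ht
  exact Finset.sum_le_sum fun a _ => Finset.sum_le_sum fun b _ => (ht a b).trans (le_abs_self _)

namespace EssBounded

variable {α β γ δ : Type*} [Fintype α] [Fintype β] [Fintype γ] [Fintype δ] {T : ℝ}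

lemma const (M : Matrix α β ℝ) : EssBounded T (fun _ => M) :=
  ⟨M.l1, Matrix.l1_nonneg _, Eventually.of_forall fun _ _ => le_rfl⟩

lemma add {M N : ℝ → Matrix α β ℝ} (hM : EssBounded T M) (hN : EssBounded T N) :
    EssBounded T (fun t => M t + N t) := by
  obtain ⟨c, hc, h⟩ := hM
  obtain ⟨c', hc', h'⟩ := hN
  refine ⟨c + c', by positivity, ?_⟩
  filter_upwards [h, h'] with t h1 h2 ht
  exact (Matrix.l1_add_le _ _).trans (add_le_add (h1 ht) (h2 ht))

lemma neg {M : ℝ → Matrix α β ℝ} (hM : EssBounded T M) : EssBounded T (fun t => -M t) := by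
  obtain ⟨c, hc, h⟩ := hM
  refine ⟨c, hc, ?_⟩
  filter_upwards [h] with t h1 ht
  rw [Matrix.l1_neg]
  exact h1 ht

lemma mul {M : ℝ → Matrix α β ℝ} {N : ℝ → Matrix β γ ℝ} (hM : EssBounded T M)
    (hN : EssBounded T N) : EssBounded T (fun t => M t * N t) := by
  obtain ⟨c, hc, h⟩ := hM
  obtain ⟨c', hc', h'⟩ := hN
  refine ⟨c * c', by positivity, ?_⟩
  filter_upwards [h, h'] with t h1 h2 ht
  exact (Matrix.l1_mul_le _ _).trans (mul_le_mul (h1 ht) (h2 ht) (Matrix.l1_nonneg _) hc)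

lemma transpose {M : ℝ → Matrix α β ℝ} (hM : EssBounded T M) :
    EssBounded T (fun t => (M t)ᵀ) := by
  obtain ⟨c, hc, h⟩ := hM
  refine ⟨c, hc, ?_⟩
  filter_upwards [h] with t h1 ht
  rw [Matrix.l1_transpose]
  exact h1 ht

lemma fromBlocks {A : ℝ → Matrix α β ℝ} {B : ℝ → Matrix α γ ℝ} {C : ℝ → Matrix δ β ℝ}
    {D : ℝ → Matrix δ γ ℝ} (hA : EssBounded T A) (hB : EssBounded T B) (hC : EssBounded T C)
    (hD : EssBounded T D) : EssBounded T (fun t => Matrix.fromBlocks (A t) (B t) (C t) (D t)) := by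
  obtain ⟨a, ha, h1⟩ := hA
  obtain ⟨b, hb, h2⟩ := hB
  obtain ⟨c, hc, h3⟩ := hC
  obtain ⟨d, hd, h4⟩ := hD
  refine ⟨a + b + (c + d), by positivity, ?_⟩
  filter_upwards [h1, h2, h3, h4] with t h1 h2 h3 h4 ht
  rw [Matrix.l1_fromBlocks]
  exact add_le_add (add_le_add (h1 ht) (h2 ht)) (add_le_add (h3 ht) (h4 ht))

end EssBounded

lemma HasDrift.essBounded {α β : Type*} [Fintype α] [Fintype β] {T : ℝ}
    {f M : ℝ → Matrix α β ℝ} (hT : 0 ≤ T) (h : HasDrift T f M) : EssBounded T M := by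
  obtain ⟨C, hC⟩ := h.exists_l1_le hT
  exact ⟨C, (Matrix.l1_nonneg _).trans (hC 0 ⟨le_rfl, hT⟩), Eventually.of_forall fun t ht => hC t ht⟩

namespace FBLQData

variable {n m k : ℕ} {S : FBLQData n m k} {T : ℝ}

lemma posSemidef_riccatiTerminal_succ_sub (i : ℕ) :
    (S.riccatiTerminal (i + 1) - S.riccatiTerminal i).PosSemidef := by
  -- The difference is the Gram matrix of `(-F, I)`.
  have e : S.riccatiTerminal (i + 1) - S.riccatiTerminal i
      = (Matrix.fromCols (-S.F) (1 : Matrix (Fin m) (Fin m) ℝ))ᴴ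
        * Matrix.fromCols (-S.F) (1 : Matrix (Fin m) (Fin m) ℝ) := by
    rw [Matrix.conjTranspose_eq_transpose_of_trivial, Matrix.transpose_fromCols,
      Matrix.fromRows_mul_fromCols]
    rw [sub_eq_iff_eq_add, riccatiTerminal, riccatiTerminal, Matrix.fromBlocks_add]
    congr 1
    · simp [add_smul, add_left_comm, add_comm]
    · simp [add_smul, add_comm]
    · simp [add_smul]
    · simp [add_smul, add_comm]
  rw [e]
  exact Matrix.posSemidef_conjTranspose_mul_self _

/-- The solutions of the auxiliary Riccati equations increase with the terminal weight. With the
optimal feedback of the larger one, the difference solves a backward Lyapunov inequality. -/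
lemma posSemidef_riccati_succ_sub (hT : 0 ≤ T) (hb : S.Bounded T) {i : ℕ}
    {P Q : ℝ → Matrix (Fin n ⊕ Fin m) (Fin n ⊕ Fin m) ℝ} (hP : S.IsRiccatiSolution T i P)
    (hQ : S.IsRiccatiSolution T (i + 1) Q) (hM : MemLinfty T (fun t => (S.M1 (Q t) t)⁻¹)) :
    ∀ t ∈ Set.Icc 0 T, (Q t - P t).PosSemidef := by
  have bQ : EssBounded T Q := (hQ.equation.hasDrift hT).essBounded hT
  have z : ∀ {α β : Type} [Fintype α] [Fintype β], EssBounded T fun _ => (0 : Matrix α β ℝ) :=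
    EssBounded.const 0
  have bA : EssBounded T S.At :=
    EssBounded.fromBlocks hb.A1.essBounded hb.B1.essBounded (hb.A3.essBounded.neg)
      (hb.B3.essBounded.neg)
  have bB : EssBounded T S.Bt :=
    EssBounded.fromBlocks hb.D1.essBounded hb.C1.essBounded (hb.D3.essBounded.neg)
      (hb.C3.essBounded.neg)
  have bC : EssBounded T S.Ct := EssBounded.fromBlocks hb.A2.essBounded hb.B2.essBounded z z
  have bD : EssBounded T S.Dt :=
    EssBounded.fromBlocks hb.D2.essBounded hb.C2.essBounded z (EssBounded.const 1)
  have bΘ : EssBounded T fun t => S.feedback (Q t) t :=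
    (hM.essBounded.mul ((bB.transpose.mul bQ).add
      ((bD.transpose.mul bQ).mul bC))).neg
  obtain ⟨c₁, hc₁, h₁⟩ := bA.add (bB.mul bΘ)
  obtain ⟨c₂, hc₂, h₂⟩ := bC.add (bD.mul bΘ)
  have hsub := hQ.equation.sub hP.equation
  have hsP : ∀ t ∈ Set.Icc 0 T, (P t).IsSymm := fun t ht => isSymm_of_posDef (hP.posDef t ht)
  have hsQ : ∀ t ∈ Set.Icc 0 T, (Q t).IsSymm := fun t ht => isSymm_of_posDef (hQ.posDef t ht)
  refine posSemidef_of_lyapunov (A := fun t => S.At t + S.Bt t * S.feedback (Q t) t)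
    (C := fun t => S.Ct t + S.Dt t * S.feedback (Q t) t) (c := c₁ + c₂) hsub
    (fun t ht => (hsQ t ht).sub (hsP t ht)) (posSemidef_riccatiTerminal_succ_sub i) (by positivity)
    ?_ ?_ ?_
  · filter_upwards [h₁] with t h ht using (h ht).trans (by linarith)
  · filter_upwards [h₂] with t h ht using (h ht).trans (by linarith)
  · rw [← ae_restrict_iff' measurableSet_Icc]
    filter_upwards [hb.symm_C4, hb.symm_D4, hP.constraint, hQ.constraint,
      ae_restrict_mem measurableSet_Icc] with t hC hD hMP hMQ ht
    have e1 := S.closedLoop_eq_riccatiDrift_add (hsP t ht) (S.isSymm_M1 (hsP t ht) hC hD) hMP.isUnit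
      (S.feedback (Q t) t)
    have e2 := S.closedLoop_eq_riccatiDrift_add (hsQ t ht) (S.isSymm_M1 (hsQ t ht) hC hD) hMQ.isUnit
      (S.feedback (Q t) t)
    rw [sub_self, Matrix.mul_zero, add_zero] at e2
    have e3 := eq_sub_of_add_eq e1.symm
    have hps := hMP.posSemidef.conjTranspose_mul_mul_same (S.feedback (Q t) t - S.feedback (P t) t)
    rw [Matrix.conjTranspose_eq_transpose_of_trivial] at hps
    convert hps using 1
    rw [← e2, e3]
    generalize (S.feedback (Q t) t - S.feedback (P t) t)ᵀ * S.M1 (P t) t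
      * (S.feedback (Q t) t - S.feedback (P t) t) = W
    simp only [closedLoop]
    generalize S.At t + S.Bt t * S.feedback (Q t) t = A
    generalize S.Ct t + S.Dt t * S.feedback (Q t) t = C
    simp only [Matrix.sub_mul, Matrix.mul_sub]
    abel

end FBLQData

/-! ### Monotonicity of the block transformation -/

/-- Inversion of positive definite matrices is antitone. -/
lemma posSemidef_inv_sub_inv {α : Type*} [Fintype α] [DecidableEq α] {X Y : Matrix α α ℝ}
    (hX : X.PosDef) (hY : Y.PosDef) (h : (Y - X).PosSemidef) : (X⁻¹ - Y⁻¹).PosSemidef := by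
  have uX := (Matrix.isUnit_iff_isUnit_det _).mp hX.isUnit
  have uY := (Matrix.isUnit_iff_isUnit_det _).mp hY.isUnit
  have e : X⁻¹ - Y⁻¹ = (Y⁻¹)ᴴ * (Y - X) * Y⁻¹ + (X⁻¹ - Y⁻¹)ᴴ * X * (X⁻¹ - Y⁻¹) := by
    rw [Matrix.conjTranspose_sub, hY.inv.isHermitian.eq, hX.inv.isHermitian.eq]
    simp only [Matrix.mul_sub, Matrix.sub_mul, Matrix.nonsing_inv_mul _ uX,
      Matrix.nonsing_inv_mul _ uY, Matrix.one_mul, Matrix.mul_assoc,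
      Matrix.mul_nonsing_inv _ uX, Matrix.mul_one]
    abel
  rw [e]
  exact (h.conjTranspose_mul_mul_same _).add (hX.posSemidef.conjTranspose_mul_mul_same _)

section Blocks

variable {n m : ℕ} {P Q : Matrix (Fin n ⊕ Fin m) (Fin n ⊕ Fin m) ℝ}

lemma posSemidef_blockP3_sub (hP : P.PosDef) (hQ : Q.PosDef) (h : (Q - P).PosSemidef) :
    (blockP3 P - blockP3 Q).PosSemidef :=
  posSemidef_inv_sub_inv (posDef_toBlocks₂₂ hP) (posDef_toBlocks₂₂ hQ) (h.submatrix Sum.inr)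

lemma posSemidef_blockP3 (hP : P.PosDef) : (blockP3 P).PosSemidef :=
  (posDef_toBlocks₂₂ hP).inv.posSemidef

/-- The embedding `x ↦ (x, K x)`. -/
def graphMap (K : Matrix (Fin m) (Fin n) ℝ) : Matrix (Fin n ⊕ Fin m) (Fin n) ℝ :=
  fromRows 1 K

/-- The quadratic form of `P̃` at `(x, K x)` exceeds that of the Schur complement by a square. -/
lemma graphMap_congr_eq_blockP1_add (hP : P.PosDef) (K : Matrix (Fin m) (Fin n) ℝ) :
    (graphMap K)ᵀ * P * graphMap K
      = blockP1 P + (K - blockP2 P)ᵀ * P.toBlocks₂₂ * (K - blockP2 P) := by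
  have hs := isSymm_of_posDef hP
  have h12 : P.toBlocks₁₂ = P.toBlocks₂₁ᵀ := by
    ext i j
    exact (hs.apply (Sum.inl i) (Sum.inr j)).symm
  have h22 : P.toBlocks₂₂ᵀ = P.toBlocks₂₂ := isSymm_of_posDef (posDef_toBlocks₂₂ hP)
  have u := (Matrix.isUnit_iff_isUnit_det _).mp (posDef_toBlocks₂₂ hP).isUnit
  conv_lhs => rw [← Matrix.fromBlocks_toBlocks P]
  rw [graphMap, Matrix.transpose_fromRows, Matrix.fromCols_mul_fromBlocks, Matrix.fromCols_mul_fromRows, h12]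
  simp only [blockP1, blockP2, sub_neg_eq_add, Matrix.transpose_add, Matrix.transpose_mul,
    Matrix.transpose_nonsing_inv, h22, Matrix.mul_add, Matrix.add_mul, Matrix.mul_assoc,
    Matrix.mul_nonsing_inv_cancel_left _ _ u, Matrix.nonsing_inv_mul_cancel_left _ _ u,
    Matrix.transpose_one, Matrix.one_mul, Matrix.mul_one]
  abel

lemma posSemidef_blockP1 (hP : P.PosDef) : (blockP1 P).PosSemidef := by
  have h := graphMap_congr_eq_blockP1_add hP (blockP2 P)
  rw [sub_self, Matrix.mul_zero, add_zero] at h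
  rw [← h, ← Matrix.conjTranspose_eq_transpose_of_trivial]
  exact hP.posSemidef.conjTranspose_mul_mul_same _

lemma posSemidef_blockP1_sub (hP : P.PosDef) (hQ : Q.PosDef) (h : (Q - P).PosSemidef) :
    (blockP1 Q - blockP1 P).PosSemidef := by
  have h1 := graphMap_congr_eq_blockP1_add hP (blockP2 Q)
  have h2 := graphMap_congr_eq_blockP1_add hQ (blockP2 Q)
  rw [sub_self, Matrix.mul_zero, add_zero] at h2
  have h3 := eq_sub_of_add_eq h1.symm
  have e : blockP1 Q - blockP1 P
      = (graphMap (blockP2 Q))ᴴ * (Q - P) * graphMap (blockP2 Q)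
        + (blockP2 Q - blockP2 P)ᴴ * P.toBlocks₂₂ * (blockP2 Q - blockP2 P) := by
    rw [← h2, h3, Matrix.conjTranspose_eq_transpose_of_trivial,
      Matrix.conjTranspose_eq_transpose_of_trivial, Matrix.mul_sub (graphMap (blockP2 Q))ᵀ,
      Matrix.sub_mul]
    abel
  rw [e]
  exact (h.conjTranspose_mul_mul_same _).add
    ((posDef_toBlocks₂₂ hP).posSemidef.conjTranspose_mul_mul_same _)

end Blocks

/-! ### Stability of backward equations -/

/-- Gronwall's inequality in integrated form, backwards from `T`. -/
lemma backward_gronwall {u : ℝ → ℝ} {s T a K : ℝ} (hK : 0 ≤ K)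
    (hu : ContinuousOn u (Set.Icc s T)) (hu0 : ∀ t ∈ Set.Icc s T, 0 ≤ u t)
    (h : ∀ t ∈ Set.Icc s T, u t ≤ a + K * ∫ r in t..T, u r) :
    ∀ t ∈ Set.Icc s T, u t ≤ 2 * a * Real.exp (2 * K * (T - t)) := by
  intro t ht
  -- The maximum of `u` in the exponentially weighted norm.
  have hw : ContinuousOn (fun t => u t * Real.exp (-(2 * K * (T - t)))) (Set.Icc s T) :=
    hu.mul (by fun_prop)
  obtain ⟨t₀, ht₀, hmax⟩ := isCompact_Icc.exists_isMaxOn ⟨t, ht⟩ hw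
  set m : ℝ := u t₀ * Real.exp (-(2 * K * (T - t₀))) with hm
  have hm0 : 0 ≤ m := mul_nonneg (hu0 t₀ ht₀) (Real.exp_pos _).le
  have hle : ∀ r ∈ Set.Icc s T, u r ≤ m * Real.exp (2 * K * (T - r)) := by
    intro r hr
    have h1 : u r * Real.exp (-(2 * K * (T - r))) ≤ m := hmax hr
    rwa [Real.exp_neg, ← div_eq_mul_inv, div_le_iff₀ (Real.exp_pos _)] at h1
  have hder : ∀ r : ℝ, HasDerivAt (fun r => -(m / 2 * Real.exp (2 * K * (T - r))))
      (K * (m * Real.exp (2 * K * (T - r)))) r := fun r => by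
    have h1 : HasDerivAt (fun r : ℝ => 2 * K * (T - r)) (2 * K * (-1)) r :=
      ((hasDerivAt_id r).const_sub T).const_mul _
    refine ((h1.exp.const_mul (m / 2)).neg).congr_deriv ?_
    ring
  have hsub : Set.uIcc t₀ T ⊆ Set.Icc s T := by
    rw [Set.uIcc_of_le ht₀.2]
    exact Set.Icc_subset_Icc_left ht₀.1
  have hcont : Continuous fun r : ℝ => m * Real.exp (2 * K * (T - r)) := by fun_prop
  have hint : K * ∫ r in t₀..T, u r ≤ m / 2 * Real.exp (2 * K * (T - t₀)) := by
    have h1 : ∫ r in t₀..T, u r ≤ ∫ r in t₀..T, m * Real.exp (2 * K * (T - r)) := by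
      refine intervalIntegral.integral_mono_on ht₀.2 (hu.mono hsub).intervalIntegrable
        (hcont.intervalIntegrable _ _) fun r hr => hle r ⟨ht₀.1.trans hr.1, hr.2⟩
    have h2 := intervalIntegral.integral_eq_sub_of_hasDerivAt (a := t₀) (b := T)
      (fun r _ => hder r) ((continuous_const.mul hcont).intervalIntegrable _ _)
    rw [intervalIntegral.integral_const_mul] at h2
    refine (mul_le_mul_of_nonneg_left h1 hK).trans ?_
    rw [h2, sub_self, mul_zero, Real.exp_zero]
    linarith
  have h0 := h t₀ ht₀
  have hexp : 1 ≤ Real.exp (2 * K * (T - t₀)) :=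
    Real.one_le_exp (mul_nonneg (by positivity) (by linarith [ht₀.2]))
  have e1 : u t₀ = m * Real.exp (2 * K * (T - t₀)) := by
    rw [hm, mul_assoc, ← Real.exp_add, neg_add_cancel, Real.exp_zero, mul_one]
  have ham : m ≤ 2 * a := by
    have h1 : m / 2 * Real.exp (2 * K * (T - t₀)) ≤ a := by linarith
    have h2 : m / 2 ≤ m / 2 * Real.exp (2 * K * (T - t₀)) :=
      le_mul_of_one_le_right (by linarith) hexp
    linarith
  exact (hle t ht).trans (mul_le_mul_of_nonneg_right ham (Real.exp_pos _).le)

lemma IsBackwardSolution.l1_le {α β : Type*} [Fintype α] [Fintype β] {T : ℝ} {Θ : Matrix α β ℝ}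
    {f M : ℝ → Matrix α β ℝ} (h : IsBackwardSolution T Θ f M) {t : ℝ} (ht : t ∈ Set.Icc 0 T) :
    IntervalIntegrable (fun r => (f r).l1) volume t T ∧
      (M t).l1 ≤ Θ.l1 + ∫ r in t..T, (f r).l1 := by
  have hTm : T ∈ Set.Icc 0 T := ⟨ht.1.trans ht.2, le_rfl⟩
  have hi : ∀ a b, IntervalIntegrable (fun r => |f r a b|) volume t T :=
    fun a b => (h.intervalIntegrable ht hTm a b).abs
  have hi' : ∀ a, IntervalIntegrable (fun r => ∑ b, |f r a b|) volume t T := fun a => by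
    simpa only [Finset.sum_fn] using IntervalIntegrable.sum Finset.univ fun b _ => hi a b
  unfold Matrix.l1
  refine ⟨by
    simpa only [Finset.sum_fn] using IntervalIntegrable.sum Finset.univ fun a _ => hi' a, ?_⟩
  rw [intervalIntegral.integral_finsetSum fun a _ => hi' a, ← Finset.sum_add_distrib]
  refine Finset.sum_le_sum fun a _ => ?_
  rw [intervalIntegral.integral_finsetSum fun b _ => hi a b, ← Finset.sum_add_distrib]
  refine Finset.sum_le_sum fun b _ => ?_
  rw [h.2.2 t ht a b]
  exact (abs_add_le _ _).trans
    (add_le_add le_rfl (intervalIntegral.abs_integral_le_integral_abs ht.2))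

/-- Solutions of backward equations are stable under uniform convergence of the solutions and
bounded pointwise convergence of the right-hand sides. -/
lemma IsBackwardSolution.of_tendsto {α β : Type*} {T : ℝ} {Θ : ℕ → Matrix α β ℝ} [Countable α]
    [Countable β] {Θ' : Matrix α β ℝ} {f M : ℕ → ℝ → Matrix α β ℝ} {f' M' : ℝ → Matrix α β ℝ}
    {i₀ : ℕ} {K : ℝ} (hT : 0 ≤ T) (h : ∀ i ≥ i₀, IsBackwardSolution T (Θ i) (f i) (M i))
    (hM : TendstoUniformlyOn M M' atTop (Set.Icc 0 T))
    (hΘ : ∀ a b, Tendsto (fun i => Θ i a b) atTop (nhds (Θ' a b)))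
    (hf : ∀ᵐ t : ℝ, t ∈ Set.Icc 0 T → ∀ a b, Tendsto (fun i => f i t a b) atTop (nhds (f' t a b)))
    (hK : ∀ᵐ t : ℝ, t ∈ Set.Icc 0 T → ∀ i ≥ i₀, ∀ a b, |f i t a b| ≤ K) :
    IsBackwardSolution T Θ' f' M' := by
  have hcont : ContinuousOn M' (Set.Icc 0 T) :=
    hM.continuousOn ((eventually_ge_atTop i₀).mono fun i hi => (h i hi).1).frequently
  refine ⟨hcont, fun a b => ?_, fun t ht a b => ?_⟩
  · rw [intervalIntegrable_iff_integrableOn_Icc_of_le hT]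
    have hmeas : AEStronglyMeasurable (fun t => f' t a b) (volume.restrict (Set.Icc 0 T)) := by
      refine aestronglyMeasurable_of_tendsto_ae (atTop : Filter ℕ)
        (f := fun i t => f (i + i₀) t a b) (fun i => ?_) ?_
      · exact ((intervalIntegrable_iff_integrableOn_Icc_of_le hT).mp
          ((h (i + i₀) (by omega)).2.1 a b)).aestronglyMeasurable
      · rw [ae_restrict_iff' measurableSet_Icc]
        filter_upwards [hf] with t ht ht'
        exact (ht ht' a b).comp (tendsto_add_atTop_nat i₀)
    refine Integrable.mono' (integrable_const K) hmeas ?_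
    rw [ae_restrict_iff' measurableSet_Icc]
    filter_upwards [hf, hK] with t h1 h2 ht
    exact le_of_tendsto (h1 ht a b).abs
      ((eventually_ge_atTop i₀).mono fun i hi => h2 ht i hi a b)
  · have hTm : T ∈ Set.Icc 0 T := ⟨ht.1.trans ht.2, le_rfl⟩
    have hsub : ∀ {r : ℝ}, r ∈ Set.uIoc t T → r ∈ Set.Icc 0 T := by
      intro r hr
      rw [Set.uIoc_of_le ht.2] at hr
      exact ⟨ht.1.trans hr.1.le, hr.2⟩
    have h1 : Tendsto (fun i => M i t a b) atTop (nhds (M' t a b)) :=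
      tendsto_pi_nhds.1 (tendsto_pi_nhds.1 (hM.tendsto_at ht) a) b
    have h2 : Tendsto (fun i => ∫ r in t..T, f i r a b) atTop (nhds (∫ r in t..T, f' r a b)) := by
      refine intervalIntegral.tendsto_integral_filter_of_dominated_convergence (fun _ => K) ?_ ?_
        intervalIntegrable_const ?_
      · filter_upwards [eventually_ge_atTop i₀] with i hi
        have := (h i hi).intervalIntegrable ht hTm a b
        exact this.aestronglyMeasurable_restrict_uIoc
      · filter_upwards [eventually_ge_atTop i₀] with i hi
        filter_upwards [hK] with r hr hr'
        exact hr (hsub hr') i hi a b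
      · filter_upwards [hf] with r hr hr'
        exact hr (hsub hr') a b
    refine tendsto_nhds_unique h1 (((hΘ a b).add h2).congr' ?_)
    filter_upwards [eventually_ge_atTop i₀] with i hi
    exact ((h i hi).2.2 t ht a b).symm

namespace FBLQData

variable {n m k : ℕ} {S : FBLQData n m k} {T : ℝ}

/-- `X` solves the differential equations of the non-Riccati-type system with terminal value
`Θ`. -/
structure IsStateSolution (S : FBLQData n m k) (T : ℝ) (Θ : FBState n m) (X : ℝ → FBState n m) :
    Prop where
  equation1 : IsBackwardSolution T Θ.P1 (fun t => S.drift1 (X t).P1 (X t).P2 (X t).P3 t)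
    fun t => (X t).P1
  equation2 : IsBackwardSolution T Θ.P2 (fun t => S.drift2 (X t).P1 (X t).P2 (X t).P3 t)
    fun t => (X t).P2
  equation3 : IsBackwardSolution T Θ.P3 (fun t => S.drift3 (X t).P1 (X t).P2 (X t).P3 t)
    fun t => (X t).P3

lemma IsStateSolution.continuousOn_gap {Θ Θ' : FBState n m} {X Y : ℝ → FBState n m}
    (hX : S.IsStateSolution T Θ X) (hY : S.IsStateSolution T Θ' Y) :
    ContinuousOn (fun t => (X t).gap (Y t)) (Set.Icc 0 T) := by
  have key : ∀ {α β : Type} [Fintype α] [Fintype β] {Θ : Matrix α β ℝ} {f M : ℝ → Matrix α β ℝ},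
      IsBackwardSolution T Θ f M → ContinuousOn (fun t => (M t).l1) (Set.Icc 0 T) :=
    fun h => continuousOn_finsetSum _ fun a _ => continuousOn_finsetSum _ fun b _ =>
      (h.continuousOn_apply a b).abs
  exact ((key (hX.equation1.sub hY.equation1)).add (key (hX.equation2.sub hY.equation2))).add
    (key (hX.equation3.sub hY.equation3))

/-- Two solutions along which the drifts are Lipschitz stay close. -/
lemma IsStateSolution.gap_le {Θ Θ' : FBState n m} {X Y : ℝ → FBState n m}
    (hX : S.IsStateSolution T Θ X) (hY : S.IsStateSolution T Θ' Y) {K s : ℝ} (hK : 0 ≤ K)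
    (hs : 0 ≤ s)
    (h : ∀ᵐ t : ℝ, t ∈ Set.Icc s T → S.driftGap t (X t) (Y t) ≤ K * (X t).gap (Y t)) :
    ∀ t ∈ Set.Icc s T, (X t).gap (Y t) ≤ 2 * Θ.gap Θ' * Real.exp (2 * K * (T - t)) := by
  have hsub : Set.Icc s T ⊆ Set.Icc 0 T := Set.Icc_subset_Icc_left hs
  have hc := (hX.continuousOn_gap hY).mono hsub
  refine backward_gronwall hK hc (fun t _ => FBState.gap_nonneg _ _)
    fun t ht => ?_
  obtain ⟨i1, b1⟩ := (hX.equation1.sub hY.equation1).l1_le (hsub ht)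
  obtain ⟨i2, b2⟩ := (hX.equation2.sub hY.equation2).l1_le (hsub ht)
  obtain ⟨i3, b3⟩ := (hX.equation3.sub hY.equation3).l1_le (hsub ht)
  have hint : ∫ r in t..T, S.driftGap r (X r) (Y r) ≤ K * ∫ r in t..T, (X r).gap (Y r) := by
    rw [← intervalIntegral.integral_const_mul]
    refine intervalIntegral.integral_mono_ae_restrict ht.2 ((i1.add i2).add i3) ?_ ?_
    · refine ((continuousOn_const.mul hc).mono ?_).intervalIntegrable
      rw [Set.uIcc_of_le ht.2]
      exact Set.Icc_subset_Icc_left ht.1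
    · rw [EventuallyLE, ae_restrict_iff' measurableSet_Icc]
      filter_upwards [h] with r hr hr'
      exact hr ⟨ht.1.trans hr'.1, hr'.2⟩
  unfold driftGap at hint
  rw [intervalIntegral.integral_add (i1.add i2) i3, intervalIntegral.integral_add i1 i2] at hint
  have e1 : (X t).gap (Y t)
      = ((X t).P1 - (Y t).P1).l1 + ((X t).P2 - (Y t).P2).l1 + ((X t).P3 - (Y t).P3).l1 := rfl
  have e2 : Θ.gap Θ' = (Θ.P1 - Θ'.P1).l1 + (Θ.P2 - Θ'.P2).l1 + (Θ.P3 - Θ'.P3).l1 := rfl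
  linarith

lemma Bounded.exists_coeffBound (h : S.Bounded T) :
    ∃ c : ℝ, ∀ᵐ t : ℝ, t ∈ Set.Icc 0 T → S.CoeffBound c t := by
  obtain ⟨cA1, nA1, hA1⟩ := h.A1.essBounded
  obtain ⟨cA2, nA2, hA2⟩ := h.A2.essBounded
  obtain ⟨cA3, nA3, hA3⟩ := h.A3.essBounded
  obtain ⟨cA4, nA4, hA4⟩ := h.A4.essBounded
  obtain ⟨cB1, nB1, hB1⟩ := h.B1.essBounded
  obtain ⟨cB2, nB2, hB2⟩ := h.B2.essBounded
  obtain ⟨cB3, nB3, hB3⟩ := h.B3.essBounded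
  obtain ⟨cB4, nB4, hB4⟩ := h.B4.essBounded
  obtain ⟨cC1, nC1, hC1⟩ := h.C1.essBounded
  obtain ⟨cC2, nC2, hC2⟩ := h.C2.essBounded
  obtain ⟨cC3, nC3, hC3⟩ := h.C3.essBounded
  obtain ⟨cC4, nC4, hC4⟩ := h.C4.essBounded
  obtain ⟨cD1, nD1, hD1⟩ := h.D1.essBounded
  obtain ⟨cD2, nD2, hD2⟩ := h.D2.essBounded
  obtain ⟨cD3, nD3, hD3⟩ := h.D3.essBounded
  obtain ⟨cD4, nD4, hD4⟩ := h.D4.essBounded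
  refine ⟨cA1 + cA2 + cA3 + cA4 + cB1 + cB2 + cB3 + cB4
    + cC1 + cC2 + cC3 + cC4 + cD1 + cD2 + cD3 + cD4, ?_⟩
  filter_upwards [hA1, hA2, hA3, hA4, hB1, hB2, hB3, hB4, hC1, hC2, hC3, hC4, hD1, hD2, hD3, hD4] 
    with t hA1 hA2 hA3 hA4 hB1 hB2 hB3 hB4 hC1 hC2 hC3 hC4 hD1 hD2 hD3 hD4 ht
  constructor
  · exact (hA1 ht).trans (by linarith)
  · exact (hA2 ht).trans (by linarith)
  · exact (hA3 ht).trans (by linarith)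
  · exact (hA4 ht).trans (by linarith)
  · exact (hB1 ht).trans (by linarith)
  · exact (hB2 ht).trans (by linarith)
  · exact (hB3 ht).trans (by linarith)
  · exact (hB4 ht).trans (by linarith)
  · exact (hC1 ht).trans (by linarith)
  · exact (hC2 ht).trans (by linarith)
  · exact (hC3 ht).trans (by linarith)
  · exact (hC4 ht).trans (by linarith)
  · exact (hD1 ht).trans (by linarith)
  · exact (hD2 ht).trans (by linarith)
  · exact (hD3 ht).trans (by linarith)
  · exact (hD4 ht).trans (by linarith)

/-- A solution along which the inverses are essentially bounded is unique: another solution agrees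
with it as long as it is close to it, since the drifts are Lipschitz there, and hence never leaves
its neighbourhood. -/
lemma IsStateSolution.eq_of_admissible {Θ : FBState n m} {X Y : ℝ → FBState n m} {c : ℝ}
    (hc : ∀ᵐ t : ℝ, t ∈ Set.Icc 0 T → S.CoeffBound c t)
    (hX : S.IsStateSolution T Θ X) (hXa : ∀ᵐ t : ℝ, t ∈ Set.Icc 0 T → S.Admissible c t (X t))
    (hY : S.IsStateSolution T Θ Y) : ∀ t ∈ Set.Icc 0 T, (X t).gap (Y t) = 0 := by
  obtain ⟨ε, hε, c', hcc', hnear⟩ := S.exists_admissible_of_gap_le c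
  obtain ⟨K, hK, hlip⟩ := S.exists_driftGap_le c'
  have hself : Θ.gap Θ = 0 := by simp [FBState.gap, Matrix.l1_zero]
  have hzero : ∀ s ∈ Set.Icc 0 T, (∀ t ∈ Set.Icc s T, (X t).gap (Y t) ≤ ε) →
      (X s).gap (Y s) = 0 := by
    intro s hs hclose
    refine le_antisymm ?_ (FBState.gap_nonneg _ _)
    have := hX.gap_le hY hK hs.1 ?_ s ⟨le_rfl, hs.2⟩
    · rwa [hself, mul_zero, zero_mul] at this
    · filter_upwards [hc, hXa] with t h1 h2 ht
      have ht' : t ∈ Set.Icc 0 T := ⟨hs.1.trans ht.1, ht.2⟩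
      exact (hlip t _ _ ((h1 ht').mono hcc') ((h2 ht').mono hcc')
        (hnear t _ _ (h1 ht') (h2 ht') (hclose t ht))).1
  have hgc := hX.continuousOn_gap hY
  -- The last time at which the two solutions are at distance `ε` does not exist.
  have hfar : ∀ t ∈ Set.Icc 0 T, (X t).gap (Y t) < ε := by
    intro t ht
    by_contra hn
    have hBc : IsCompact (Set.Icc 0 T ∩ (fun t => (X t).gap (Y t)) ⁻¹' Set.Ici ε) :=
      isCompact_Icc.of_isClosed_subset
        (hgc.preimage_isClosed_of_isClosed isClosed_Icc isClosed_Ici) Set.inter_subset_left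
    obtain ⟨t₁, ⟨ht₁, hg₁⟩, hmax⟩ :=
      hBc.exists_isMaxOn ⟨t, ht, not_lt.mp hn⟩ continuousOn_id
    have hafter : ∀ s, t₁ < s → s ≤ T → (X s).gap (Y s) < ε := by
      intro s h1 h2
      by_contra hn'
      exact absurd h1 (not_lt.mpr (hmax (show s ∈ Set.Icc 0 T ∩ _ from
        ⟨⟨ht₁.1.trans h1.le, h2⟩, not_lt.mp hn'⟩)))
    have hzero' : ∀ s, t₁ < s → s ≤ T → (X s).gap (Y s) = 0 := fun s h1 h2 =>
      hzero s ⟨ht₁.1.trans h1.le, h2⟩ fun r hr => (hafter r (h1.trans_le hr.1) hr.2).le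
    have h0 : (X t₁).gap (Y t₁) ≤ 0 := by
      rcases ht₁.2.eq_or_lt with hT | hT
      · have := hX.gap_le hY (K := 0) (s := T) le_rfl (ht₁.1.trans ht₁.2) ?_ T ⟨le_rfl, le_rfl⟩
        · rw [hself, mul_zero, zero_mul] at this
          rwa [hT]
        · have hne : ∀ᵐ r : ℝ, r ≠ T := by simp [ae_iff]
          filter_upwards [hne] with r hr hr'
          exact absurd (le_antisymm hr'.2 hr'.1) hr
      · have hcw : ContinuousWithinAt (fun s => (X s).gap (Y s)) (Set.Ioc t₁ T) t₁ :=
          (hgc t₁ ht₁).mono fun s hs => ⟨ht₁.1.trans hs.1.le, hs.2⟩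
        have : (nhdsWithin t₁ (Set.Ioc t₁ T)).NeBot := by
          rw [← mem_closure_iff_nhdsWithin_neBot, closure_Ioc hT.ne]
          exact ⟨le_rfl, hT.le⟩
        refine le_of_tendsto hcw ?_
        filter_upwards [self_mem_nhdsWithin] with s hs
        exact (hzero' s hs.1 hs.2).le
    exact absurd (hε.trans_le hg₁) (not_lt.mpr h0)
  exact fun s hs => hzero s hs fun t ht => (hfar t ⟨hs.1.trans ht.1, ht.2⟩).le

end FBLQData

/-! ### Convergence of the approximating triples -/

/-- A positive semidefinite matrix is bounded, entry by entry, through the diagonal of any matrix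
that dominates it. -/
lemma abs_apply_le_of_posSemidef {α : Type*} [Fintype α] [DecidableEq α] {X Y : Matrix α α ℝ}
    (hX : X.PosSemidef) (h : (Y - X).PosSemidef) {c : ℝ} (hY : ∀ a, Y a a ≤ c) (a b : α) :
    |X a b| ≤ c := by
  have hdiag : ∀ a, X a a ≤ c := fun a => by
    have := h.diag_nonneg (i := a)
    rw [Matrix.sub_apply] at this
    linarith [hY a]
  have hs : X b a = X a b := by
    have := hX.isHermitian
    rw [Matrix.IsHermitian, Matrix.conjTranspose_eq_transpose_of_trivial] at this
    exact congrFun (congrFun this a) b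
  have hq : ∀ σ : ℝ, 0 ≤ X a a + σ * X a b + (σ * X a b + σ * σ * X b b) := fun σ => by
    have := (Matrix.posSemidef_iff_dotProduct_mulVec.mp hX).2 (Pi.single a 1 + σ • Pi.single b 1)
    rw [star_trivial] at this
    simp only [Matrix.mulVec_add, Matrix.mulVec_smul, Matrix.mulVec_single_one, add_dotProduct,
      dotProduct_add, smul_dotProduct, dotProduct_smul, single_one_dotProduct, Matrix.col_apply,
      smul_eq_mul, hs] at this
    linarith
  have h1 := hq 1
  have h2 := hq (-1)
  rw [abs_le]
  constructor <;> linarith [hdiag a, hdiag b]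

/-- A sequence whose increments are dominated by a null sequence converges at that rate. -/
lemma exists_limit_of_abs_sub_le {x d : ℕ → ℝ} {i₀ : ℕ} (hd : Tendsto d atTop (nhds 0))
    (h : ∀ i ≥ i₀, ∀ j ≥ i₀, |x i - x j| ≤ d i + d j) : ∃ y, ∀ i ≥ i₀, |x i - y| ≤ d i := by
  have hC : CauchySeq x := by
    rw [Metric.cauchySeq_iff']
    intro ε hε
    have := hd.eventually (gt_mem_nhds (show (0 : ℝ) < ε / 2 by positivity))
    obtain ⟨N, hN⟩ := eventually_atTop.mp this
    refine ⟨max N i₀, fun j hj => ?_⟩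
    rw [Real.dist_eq]
    have h1 := h j ((le_max_right _ _).trans hj) (max N i₀) (le_max_right _ _)
    have h2 := hN j ((le_max_left _ _).trans hj)
    have h3 := hN (max N i₀) (le_max_left _ _)
    linarith
  obtain ⟨y, hy⟩ := cauchySeq_tendsto_of_complete hC
  refine ⟨y, fun i hi => ?_⟩
  have h1 : Tendsto (fun j => |x i - x j|) atTop (nhds |x i - y|) := (hy.const_sub (x i)).abs
  have h2 : Tendsto (fun j => d i + d j) atTop (nhds (d i + 0)) := hd.const_add _
  rw [add_zero] at h2
  exact le_of_tendsto_of_tendsto h1 h2 ((eventually_ge_atTop i₀).mono fun j hj => h i hi j hj)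

lemma Matrix.exists_limit_of_l1_sub_le {α β : Type*} [Fintype α] [Fintype β]
    {x : ℕ → Matrix α β ℝ} {d : ℕ → ℝ} {i₀ : ℕ} (hd : Tendsto d atTop (nhds 0))
    (h : ∀ i ≥ i₀, ∀ j ≥ i₀, (x i - x j).l1 ≤ d i + d j) :
    ∃ y, ∀ i ≥ i₀, (x i - y).l1 ≤ Fintype.card α * (Fintype.card β * d i) := by
  have : ∀ a b, ∃ y, ∀ i ≥ i₀, |x i a b - y| ≤ d i := fun a b =>
    exists_limit_of_abs_sub_le hd fun i hi j hj =>
      (Matrix.abs_apply_le_l1 (x i - x j) a b).trans (h i hi j hj)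
  choose y hy using this
  exact ⟨Matrix.of y, fun i hi => Matrix.l1_le_of_abs_apply_le fun a b => hy a b i hi⟩

lemma tendstoUniformlyOn_of_l1_sub_le {α β : Type*} [Fintype α] [Fintype β] {s : Set ℝ}
    {M : ℕ → ℝ → Matrix α β ℝ} {M' : ℝ → Matrix α β ℝ} {d : ℕ → ℝ} {i₀ : ℕ}
    (hd : Tendsto d atTop (nhds 0)) (h : ∀ i ≥ i₀, ∀ t ∈ s, (M i t - M' t).l1 ≤ d i) :
    TendstoUniformlyOn M M' atTop s := by
  -- The uniform structure on matrices is that of the entrywise supremum distance.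
  refine (Metric.tendstoUniformlyOn_iff (α := α → β → ℝ) (F := M) (f := M')).mpr ?_
  intro ε hε
  filter_upwards [eventually_ge_atTop i₀, hd.eventually (gt_mem_nhds hε)] with i hi hdi t ht
  refine (dist_pi_lt_iff hε).mpr fun a => (dist_pi_lt_iff hε).mpr fun b => ?_
  rw [dist_comm, Real.dist_eq]
  exact ((Matrix.abs_apply_le_l1 (M i t - M' t) a b).trans (h i hi t ht)).trans_lt hdi

namespace FBLQData

variable {n m k : ℕ} {S : FBLQData n m k} {T : ℝ}

/-- Convergence of a uniformly admissible sequence of solutions with converging terminal values;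
the limit is again uniformly admissible. -/
lemma exists_limit_of_admissible (hT : 0 ≤ T) {i₀ : ℕ} {Θ : ℕ → FBState n m} {Θ' : FBState n m}
    {X : ℕ → ℝ → FBState n m} {c : ℝ} {δ : ℕ → ℝ} (hδ : Tendsto δ atTop (nhds 0))
    (hΘ : ∀ i, (Θ i).gap Θ' ≤ δ i) (hΘ2 : ∀ i j, (Θ i).gap (Θ j) ≤ δ i + δ j)
    (hc : ∀ᵐ t : ℝ, t ∈ Set.Icc 0 T → S.CoeffBound c t)
    (hX : ∀ i ≥ i₀, S.IsStateSolution T (Θ i) (X i))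
    (hXa : ∀ᵐ t : ℝ, t ∈ Set.Icc 0 T → ∀ i ≥ i₀, S.Admissible c t (X i t)) :
    ∃ (Y : ℝ → FBState n m) (c' : ℝ), S.IsStateSolution T Θ' Y ∧ c ≤ c' ∧
      (∀ᵐ t : ℝ, t ∈ Set.Icc 0 T → S.Admissible c' t (Y t)) ∧
      TendstoUniformlyOn (fun i t => (X i t).P1) (fun t => (Y t).P1) atTop (Set.Icc 0 T) ∧
      TendstoUniformlyOn (fun i t => (X i t).P2) (fun t => (Y t).P2) atTop (Set.Icc 0 T) ∧
      TendstoUniformlyOn (fun i t => (X i t).P3) (fun t => (Y t).P3) atTop (Set.Icc 0 T) := by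
  obtain ⟨K, hK, hlip⟩ := S.exists_driftGap_le c
  have hδ0 : ∀ i, 0 ≤ δ i := fun i => (FBState.gap_nonneg _ _).trans (hΘ i)
  set D : ℝ := 2 * Real.exp (2 * K * T) with hD
  have hD0 : 0 < D := by positivity
  have hCauchy : ∀ i ≥ i₀, ∀ j ≥ i₀, ∀ t ∈ Set.Icc 0 T,
      (X i t).gap (X j t) ≤ D * δ i + D * δ j := by
    intro i hi j hj t ht
    have h1 := (hX i hi).gap_le (hX j hj) hK le_rfl (by
      filter_upwards [hc, hXa] with r h1 h2 hr
      exact (hlip r _ _ (h1 hr) (h2 hr i hi) (h2 hr j hj)).1) t ht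
    have h2 : Real.exp (2 * K * (T - t)) ≤ Real.exp (2 * K * T) :=
      Real.exp_le_exp.mpr (mul_le_mul_of_nonneg_left (by linarith [ht.1]) (by positivity))
    have h3 := FBState.gap_nonneg (Θ i) (Θ j)
    calc (X i t).gap (X j t) ≤ 2 * (Θ i).gap (Θ j) * Real.exp (2 * K * (T - t)) := h1
      _ ≤ 2 * (δ i + δ j) * Real.exp (2 * K * T) :=
          mul_le_mul (by linarith [hΘ2 i j]) h2 (Real.exp_pos _).le
            (by linarith [hδ0 i, hδ0 j])
      _ = D * δ i + D * δ j := by rw [hD]; ring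
  have hd : Tendsto (fun i => D * δ i) atTop (nhds 0) := by simpa using hδ.const_mul D
  -- The pointwise limit, with a rate that is uniform in time.
  set N : ℝ := n * n + m * n + m * m with hN
  have hlim : ∀ t : ℝ, ∃ Y : FBState n m, t ∈ Set.Icc 0 T →
      ∀ i ≥ i₀, (X i t).gap Y ≤ N * (D * δ i) := by
    intro t
    by_cases ht : t ∈ Set.Icc 0 T
    · obtain ⟨y1, h1⟩ := Matrix.exists_limit_of_l1_sub_le (x := fun i => (X i t).P1) hd
        fun i hi j hj => (FBState.l1_P1_le_gap _ _).trans (hCauchy i hi j hj t ht)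
      obtain ⟨y2, h2⟩ := Matrix.exists_limit_of_l1_sub_le (x := fun i => (X i t).P2) hd
        fun i hi j hj => (FBState.l1_P2_le_gap _ _).trans (hCauchy i hi j hj t ht)
      obtain ⟨y3, h3⟩ := Matrix.exists_limit_of_l1_sub_le (x := fun i => (X i t).P3) hd
        fun i hi j hj => (FBState.l1_P3_le_gap _ _).trans (hCauchy i hi j hj t ht)
      simp only [Fintype.card_fin] at h1 h2 h3
      refine ⟨⟨y1, y2, y3⟩, fun _ i hi => ?_⟩
      have e : N * (D * δ i) = n * (n * (D * δ i)) + m * (n * (D * δ i)) + m * (m * (D * δ i)) := by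
        rw [hN]; ring
      rw [e]
      exact add_le_add (add_le_add (h1 i hi) (h2 i hi)) (h3 i hi)
    · exact ⟨Θ', fun h => absurd h ht⟩
  choose Y hY using hlim
  have hd' : Tendsto (fun i => N * (D * δ i)) atTop (nhds 0) := by simpa using hd.const_mul N
  obtain ⟨ε, hε, c', hcc', hnear⟩ := S.exists_admissible_of_gap_le c
  have hYa : ∀ᵐ t : ℝ, t ∈ Set.Icc 0 T → S.Admissible c' t (Y t) := by
    obtain ⟨i, hi, hiε⟩ := ((eventually_ge_atTop i₀).and
      (hd'.eventually (gt_mem_nhds hε))).exists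
    filter_upwards [hc, hXa] with t h1 h2 ht
    exact hnear t _ _ (h1 ht) (h2 ht i hi) ((hY t ht i hi).trans hiε.le)
  obtain ⟨K', hK', hlip'⟩ := S.exists_driftGap_le c'
  have hdrift : ∀ᵐ t : ℝ, t ∈ Set.Icc 0 T → ∀ i ≥ i₀,
      S.driftGap t (X i t) (Y t) ≤ K' * (N * (D * δ i)) := by
    filter_upwards [hc, hXa, hYa] with t h1 h2 h3 ht i hi
    exact (hlip' t _ _ ((h1 ht).mono hcc') ((h2 ht i hi).mono hcc') (h3 ht)).1.trans
      (mul_le_mul_of_nonneg_left (hY t ht i hi) hK')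
  have hdd : Tendsto (fun i => K' * (N * (D * δ i))) atTop (nhds 0) := by
    simpa using hd'.const_mul K'
  have hbd : ∀ᵐ t : ℝ, t ∈ Set.Icc 0 T → ∀ i ≥ i₀,
      (S.drift1 (X i t).P1 (X i t).P2 (X i t).P3 t).l1 ≤ K ∧
      (S.drift2 (X i t).P1 (X i t).P2 (X i t).P3 t).l1 ≤ K ∧
      (S.drift3 (X i t).P1 (X i t).P2 (X i t).P3 t).l1 ≤ K := by
    filter_upwards [hc, hXa] with t h1 h2 ht i hi
    exact (hlip t _ _ (h1 ht) (h2 ht i hi) (h2 ht i hi)).2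
  have u1 : TendstoUniformlyOn (fun i t => (X i t).P1) (fun t => (Y t).P1) atTop (Set.Icc 0 T) :=
    tendstoUniformlyOn_of_l1_sub_le hd' fun i hi t ht =>
      (FBState.l1_P1_le_gap _ _).trans (hY t ht i hi)
  have u2 : TendstoUniformlyOn (fun i t => (X i t).P2) (fun t => (Y t).P2) atTop (Set.Icc 0 T) :=
    tendstoUniformlyOn_of_l1_sub_le hd' fun i hi t ht =>
      (FBState.l1_P2_le_gap _ _).trans (hY t ht i hi)
  have u3 : TendstoUniformlyOn (fun i t => (X i t).P3) (fun t => (Y t).P3) atTop (Set.Icc 0 T) :=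
    tendstoUniformlyOn_of_l1_sub_le hd' fun i hi t ht =>
      (FBState.l1_P3_le_gap _ _).trans (hY t ht i hi)
  have entry : ∀ {α β : Type} [Fintype α] [Fintype β] {x : ℕ → Matrix α β ℝ} {y : Matrix α β ℝ}
      {d : ℕ → ℝ}, Tendsto d atTop (nhds 0) → (∀ i ≥ i₀, (x i - y).l1 ≤ d i) → ∀ a b,
      Tendsto (fun i => x i a b) atTop (nhds (y a b)) := by
    intro α β _ _ x y d hd h a b
    rw [tendsto_iff_dist_tendsto_zero]
    refine squeeze_zero' (Eventually.of_forall fun _ => dist_nonneg) ?_ hd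
    filter_upwards [eventually_ge_atTop i₀] with i hi
    exact (Matrix.abs_apply_le_l1 (x i - y) a b).trans (h i hi)
  refine ⟨Y, c', ⟨?_, ?_, ?_⟩, hcc', hYa, u1, u2, u3⟩
  · refine IsBackwardSolution.of_tendsto hT (fun i hi => (hX i hi).equation1) u1
      (entry hδ fun i _ => (FBState.l1_P1_le_gap _ _).trans (hΘ i)) ?_ ?_ (K := K)
    · filter_upwards [hdrift] with t h1 ht
      refine entry hdd fun i hi => le_trans ?_ (h1 ht i hi)
      unfold driftGap
      linarith [Matrix.l1_nonneg (S.drift2 (X i t).P1 (X i t).P2 (X i t).P3 t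
        - S.drift2 (Y t).P1 (Y t).P2 (Y t).P3 t), Matrix.l1_nonneg (S.drift3 (X i t).P1 (X i t).P2
        (X i t).P3 t - S.drift3 (Y t).P1 (Y t).P2 (Y t).P3 t)]
    · filter_upwards [hbd] with t h1 ht i hi a b
      exact (Matrix.abs_apply_le_l1 _ a b).trans (h1 ht i hi).1
  · refine IsBackwardSolution.of_tendsto hT (fun i hi => (hX i hi).equation2) u2
      (entry hδ fun i _ => (FBState.l1_P2_le_gap _ _).trans (hΘ i)) ?_ ?_ (K := K)
    · filter_upwards [hdrift] with t h1 ht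
      refine entry hdd fun i hi => le_trans ?_ (h1 ht i hi)
      unfold driftGap
      linarith [Matrix.l1_nonneg (S.drift1 (X i t).P1 (X i t).P2 (X i t).P3 t
        - S.drift1 (Y t).P1 (Y t).P2 (Y t).P3 t), Matrix.l1_nonneg (S.drift3 (X i t).P1 (X i t).P2
        (X i t).P3 t - S.drift3 (Y t).P1 (Y t).P2 (Y t).P3 t)]
    · filter_upwards [hbd] with t h1 ht i hi a b
      exact (Matrix.abs_apply_le_l1 _ a b).trans (h1 ht i hi).2.1
  · refine IsBackwardSolution.of_tendsto hT (fun i hi => (hX i hi).equation3) u3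
      (entry hδ fun i _ => (FBState.l1_P3_le_gap _ _).trans (hΘ i)) ?_ ?_ (K := K)
    · filter_upwards [hdrift] with t h1 ht
      refine entry hdd fun i hi => le_trans ?_ (h1 ht i hi)
      unfold driftGap
      linarith [Matrix.l1_nonneg (S.drift1 (X i t).P1 (X i t).P2 (X i t).P3 t
        - S.drift1 (Y t).P1 (Y t).P2 (Y t).P3 t), Matrix.l1_nonneg (S.drift2 (X i t).P1 (X i t).P2
        (X i t).P3 t - S.drift2 (Y t).P1 (Y t).P2 (Y t).P3 t)]
    · filter_upwards [hbd] with t h1 ht i hi a b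
      exact (Matrix.abs_apply_le_l1 _ a b).trans (h1 ht i hi).2.2

end FBLQData

end

theorem mainTheorem4 {n m k : ℕ} (S : FBLQData n m k) (T : ℝ) (hT : 0 < T)
    (hbound : S.Bounded T) (hpos : S.Nonneg T)
    (i₀ : ℕ) (hi₀ : 1 ≤ i₀)
    (Pt : ℕ → ℝ → Matrix (Fin n ⊕ Fin m) (Fin n ⊕ Fin m) ℝ)
    (hPt : ∀ i ≥ i₀, S.IsRiccatiSolution T i (Pt i))
    (hL : ∀ i ≥ i₀, ∀ᵐ t ∂(volume.restrict (Set.Icc 0 T)),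
      IsUnit (S.L1of (Pt i t) t) ∧ IsUnit (S.L2of (Pt i t) t))
    (hM : ∀ i ≥ i₀, MemLinfty T (fun t => (S.M1 (Pt i t) t)⁻¹)) :
    (∀ i ≥ i₀, ∀ t ∈ Set.Icc 0 T,
      (blockP3 (Pt i t) - blockP3 (Pt (i + 1) t)).PosSemidef ∧
      (blockP3 (Pt (i + 1) t)).PosSemidef ∧
      (blockP1 (Pt (i + 1) t) - blockP1 (Pt i t)).PosSemidef ∧
      (blockP1 (Pt i t)).PosSemidef) ∧
    ((∃ c : ℝ, ∀ i ≥ i₀, ∀ t ∈ Set.Icc 0 T,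
        (c • (1 : Matrix (Fin n) (Fin n) ℝ) - blockP1 (Pt i t)).PosSemidef) →
      (∃ c : ℝ, ∀ i ≥ i₀, ∀ t ∈ Set.Icc 0 T, ∀ a b, |blockP2 (Pt i t) a b| ≤ c) →
      (∃ c : ℝ, ∀ i ≥ i₀, ∀ᵐ t ∂(volume.restrict (Set.Icc 0 T)),
        ∀ a b, |(S.L1of (Pt i t) t)⁻¹ a b| ≤ c) →
      (∃ c : ℝ, ∀ i ≥ i₀, ∀ᵐ t ∂(volume.restrict (Set.Icc 0 T)),
        ∀ a b, |(S.L2of (Pt i t) t)⁻¹ a b| ≤ c) →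
      (∃ c : ℝ, ∀ i ≥ i₀, ∀ᵐ t ∂(volume.restrict (Set.Icc 0 T)),
        IsUnit (S.L5of (Pt i t) t) ∧ ∀ a b, |(S.L5of (Pt i t) t)⁻¹ a b| ≤ c) →
      ∃ (P1 : ℝ → Matrix (Fin n) (Fin n) ℝ) (P2 : ℝ → Matrix (Fin m) (Fin n) ℝ)
        (P3 : ℝ → Matrix (Fin m) (Fin m) ℝ),
        S.IsSystemSolution T P1 P2 P3 ∧
        TendstoUniformlyOn (fun i t => blockP1 (Pt i t)) P1 atTop (Set.Icc 0 T) ∧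
        TendstoUniformlyOn (fun i t => blockP2 (Pt i t)) P2 atTop (Set.Icc 0 T) ∧
        TendstoUniformlyOn (fun i t => blockP3 (Pt i t)) P3 atTop (Set.Icc 0 T) ∧
        ∀ (Q1 : ℝ → Matrix (Fin n) (Fin n) ℝ) (Q2 : ℝ → Matrix (Fin m) (Fin n) ℝ)
          (Q3 : ℝ → Matrix (Fin m) (Fin m) ℝ), S.IsSystemSolution T Q1 Q2 Q3 →
          ∀ t ∈ Set.Icc 0 T, Q1 t = P1 t ∧ Q2 t = P2 t ∧ Q3 t = P3 t) := by
  have hT0 := hT.le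
  have hstep : ∀ i ≥ i₀, ∀ t ∈ Set.Icc 0 T, (Pt (i + 1) t - Pt i t).PosSemidef := fun i hi =>
    FBLQData.posSemidef_riccati_succ_sub hT0 hbound (hPt i hi) (hPt (i + 1) (by omega))
      (hM (i + 1) (by omega))
  have hmono : ∀ i ≥ i₀, ∀ t ∈ Set.Icc 0 T,
      (blockP3 (Pt i t) - blockP3 (Pt (i + 1) t)).PosSemidef ∧
      (blockP3 (Pt (i + 1) t)).PosSemidef ∧
      (blockP1 (Pt (i + 1) t) - blockP1 (Pt i t)).PosSemidef ∧
      (blockP1 (Pt i t)).PosSemidef := by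
    intro i hi t ht
    have hP := (hPt i hi).posDef t ht
    have hQ := (hPt (i + 1) (by omega)).posDef t ht
    exact ⟨posSemidef_blockP3_sub hP hQ (hstep i hi t ht), posSemidef_blockP3 hQ,
      posSemidef_blockP1_sub hP hQ (hstep i hi t ht), posSemidef_blockP1 hP⟩
  refine ⟨hmono, ?_⟩
  rintro ⟨k1, hk1⟩ ⟨k2, hk2⟩ ⟨l1, hl1⟩ ⟨l2, hl2⟩ ⟨l5, hl5⟩
  have hsys := fun i (hi : i ≥ i₀) => (hPt i hi).system hT0 hbound (hi₀.trans hi) (by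
    filter_upwards [hL i hi, hl5 i hi] with t h1 h2
    exact ⟨h1.1, h1.2, h2.1⟩)
  -- The third component is bounded by its first instance, by monotonicity.
  obtain ⟨k3, hk3⟩ := ((hsys i₀ le_rfl).2.2.hasDrift hT0).exists_l1_le hT0
  have hP3 : ∀ i ≥ i₀, ∀ t ∈ Set.Icc 0 T,
      (blockP3 (Pt i₀ t) - blockP3 (Pt i t)).PosSemidef := by
    intro i hi
    induction i, hi using Nat.le_induction with
    | base => exact fun t _ => by rw [sub_self]; exact Matrix.PosSemidef.zero
    | succ j hj ih =>
      intro t ht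
      have := (ih t ht).add (hmono j hj t ht).1
      rwa [sub_add_sub_cancel] at this
  have b1 : ∀ i ≥ i₀, ∀ t ∈ Set.Icc 0 T, (blockP1 (Pt i t)).l1 ≤ n * (n * k1) := by
    intro i hi t ht
    simpa using Matrix.l1_le_of_abs_apply_le
      (abs_apply_le_of_posSemidef (hmono i hi t ht).2.2.2 (hk1 i hi t ht) (c := k1) (by simp))
  have b2 : ∀ i ≥ i₀, ∀ t ∈ Set.Icc 0 T, (blockP2 (Pt i t)).l1 ≤ m * (n * k2) := by
    intro i hi t ht
    simpa using Matrix.l1_le_of_abs_apply_le (hk2 i hi t ht)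
  have b3 : ∀ i ≥ i₀, ∀ t ∈ Set.Icc 0 T, (blockP3 (Pt i t)).l1 ≤ m * (m * k3) := by
    intro i hi t ht
    simpa using Matrix.l1_le_of_abs_apply_le
      (abs_apply_le_of_posSemidef (posSemidef_blockP3 ((hPt i hi).posDef t ht)) (hP3 i hi t ht)
        (c := k3) fun a => (le_abs_self _).trans
          ((Matrix.abs_apply_le_l1 _ a a).trans (hk3 t ht)))
  obtain ⟨k0, hk0⟩ := hbound.exists_coeffBound
  -- A common bound for all quantities that enter the Lipschitz estimate.
  set c : ℝ := |k0| + |(n : ℝ) * (n * k1)| + |(m : ℝ) * (n * k2)| + |(m : ℝ) * (m * k3)|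
    + |(m : ℝ) * (m * l1)| + |(n : ℝ) * (n * l2)| + |(k : ℝ) * (k * l5)| with hc
  have hc0 : k0 ≤ c := by
    have := le_abs_self k0
    rw [hc]
    linarith [abs_nonneg ((n : ℝ) * (n * k1)), abs_nonneg ((m : ℝ) * (n * k2)),
      abs_nonneg ((m : ℝ) * (m * k3)), abs_nonneg ((m : ℝ) * (m * l1)),
      abs_nonneg ((n : ℝ) * (n * l2)), abs_nonneg ((k : ℝ) * (k * l5))]
  have hcoeff : ∀ᵐ t : ℝ, t ∈ Set.Icc 0 T → S.CoeffBound c t := by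
    filter_upwards [hk0] with t h ht using (h ht).mono hc0
  have hadm : ∀ᵐ t : ℝ, t ∈ Set.Icc 0 T → ∀ i ≥ i₀, S.Admissible c t (blockState (Pt i t)) := by
    have : ∀ i, i ≥ i₀ → ∀ᵐ t : ℝ, t ∈ Set.Icc 0 T → S.Admissible c t (blockState (Pt i t)) := by
      intro i hi
      rw [← ae_restrict_iff' measurableSet_Icc]
      filter_upwards [hL i hi, hl1 i hi, hl2 i hi, hl5 i hi, ae_restrict_mem measurableSet_Icc]
        with t hu h1 h2 h5 ht
      have q1 := (b1 i hi t ht).trans (le_abs_self _)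
      have q2 := (b2 i hi t ht).trans (le_abs_self _)
      have q3 := (b3 i hi t ht).trans (le_abs_self _)
      have p1 := (Matrix.l1_le_of_abs_apply_le h1).trans (le_abs_self _)
      have p2 := (Matrix.l1_le_of_abs_apply_le h2).trans (le_abs_self _)
      have p5 := (Matrix.l1_le_of_abs_apply_le h5.2).trans (le_abs_self _)
      rw [Fintype.card_fin] at p1 p2 p5
      have z0 := abs_nonneg k0
      have z1 := abs_nonneg ((n : ℝ) * (n * k1))
      have z2 := abs_nonneg ((m : ℝ) * (n * k2))
      have z3 := abs_nonneg ((m : ℝ) * (m * k3))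
      have z4 := abs_nonneg ((m : ℝ) * (m * l1))
      have z5 := abs_nonneg ((n : ℝ) * (n * l2))
      have z6 := abs_nonneg ((k : ℝ) * (k * l5))
      exact ⟨q1.trans (by linarith), q2.trans (by linarith), q3.trans (by linarith),
        ⟨hu.1, p1.trans (by linarith)⟩, ⟨hu.2, p2.trans (by linarith)⟩,
        ⟨h5.1, p5.trans (by linarith)⟩⟩
    filter_upwards [ae_all_iff.2 fun i => ae_all_iff.2 fun hi => this i hi] with t h ht i hi
    exact h i hi ht
  -- The terminal values differ from those of the limit system by `i⁻¹ I`.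
  let Θ : ℕ → FBState n m := fun i => ⟨S.G, S.F, ((i : ℝ)⁻¹) • 1⟩
  let δ : ℕ → ℝ := fun i => (((i : ℝ)⁻¹) • (1 : Matrix (Fin m) (Fin m) ℝ)).l1
  have hδ : Tendsto δ atTop (nhds 0) := by
    have : δ = fun i : ℕ => (i : ℝ)⁻¹ * (1 : Matrix (Fin m) (Fin m) ℝ).l1 := by
      funext i
      exact (Matrix.l1_smul _ _).trans (by rw [abs_of_nonneg (by positivity)])
    rw [this]
    simpa using (tendsto_inv_atTop_nhds_zero_nat (𝕜 := ℝ)).mul_const _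
  obtain ⟨Y, c', hY, hcc', hYa, u1, u2, u3⟩ := FBLQData.exists_limit_of_admissible hT0
    (Θ := Θ) (Θ' := ⟨S.G, S.F, 0⟩) (X := fun i t => blockState (Pt i t)) hδ
    (fun i => by simp [FBState.gap, Θ, δ, Matrix.l1_zero])
    (fun i j => by
      simpa [FBState.gap, Θ, δ, Matrix.l1_zero] using
        Matrix.l1_sub_le (((i : ℝ)⁻¹) • (1 : Matrix (Fin m) (Fin m) ℝ)) (((j : ℝ)⁻¹) • 1))
    hcoeff (fun i hi => ⟨(hsys i hi).1, (hsys i hi).2.1, (hsys i hi).2.2⟩) hadm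
  refine ⟨fun t => (Y t).P1, fun t => (Y t).P2, fun t => (Y t).P3,
    ⟨?_, hY.equation1, hY.equation2, hY.equation3⟩, u1, u2, u3, ?_⟩
  · rw [ae_restrict_iff' measurableSet_Icc]
    filter_upwards [hYa] with t h ht
    exact ⟨(h ht).L1.1, (h ht).L2.1, (h ht).L5.1⟩
  · intro Q1 Q2 Q3 hQ t ht
    have h0 := hY.eq_of_admissible (Y := fun t => ⟨Q1 t, Q2 t, Q3 t⟩)
      (hcoeff.mono fun t h ht => (h ht).mono hcc') hYa
      ⟨hQ.equation1, hQ.equation2, hQ.equation3⟩ t ht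
    exact ⟨(Matrix.eq_of_l1_sub_le_zero ((FBState.l1_P1_le_gap _ _).trans h0.le)).symm,
      (Matrix.eq_of_l1_sub_le_zero ((FBState.l1_P2_le_gap _ _).trans h0.le)).symm,
      (Matrix.eq_of_l1_sub_le_zero ((FBState.l1_P3_le_gap _ _).trans h0.le)).symm⟩
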